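/- Let $n\ge 2$, $0<s<1$, $T>0$, let $\Omega\subset\mathbb R^n$ be a bounded domain with smooth boundary and $\Omega_e=\mathbb R^n\setminus\overline\Omega$. Let $$a(x,t,z)=\sum_{k=1}^m a_k(x,t)|z|^{b_k}z,\qquad 0\le a_k\in C(\overline\Omega\times[0,T]),\quad 0<b_1<\dots<b_m .$$ Consider the problem $$\partial_t u+(-\Delta)^s u+a(x,t,u)=f\ \text{ in }\Omega\times(0,T),\qquad u=g\ \text{ in }\Omega_e\times(0,T),\qquad u=0\ \text{ on }\mathbb R^n\times\{0\},\tag{P}$$ where $f\in L^2(\Omega\times(0,T))$. Write $$\langle(-\Delta)^s u,v\rangle=\frac{c_{n,s}}2\iint_{\mathbb R^n\times\mathbb R^n}\frac{(u(x)-u(y))(v(x)-v(y))}{|x-y|^{n+2s}}\,dx\,dy,\qquad c_{n,s}=\frac{4^s s\,\Gamma(\frac n2+s)}{\pi^{n/2}\,\Gamma(1-s)} .$$ A solution of (P) is a measurable $u$ with finite energy $$\int_0^T\iint_{(\mathbb R^n\times\mathbb R^n)\setminus(\Omega^c\times\Omega^c)}\frac{|u(x,t)-u(y,t)|^2}{|x-y|^{n+2s}}\,dx\,dy\,dt<\infty,$$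 with $u\in C([0,T];L^2(\Omega))$ and $a(x,t,u)\in L^2(\Omega\times(0,T))$, such that $u=g$ a.e. in $\Omega_e\times(0,T)$, $u(\cdot,0)=0$ a.e. in $\mathbb R^n$, and for every $v\in H^s(\mathbb R^n)$ vanishing a.e. outside $\Omega$ and every $t\in[0,T]$, $$\int_\Omega u(x,t)v(x)\,dx+\int_0^t\Big(\langle(-\Delta)^su(\tau),v\rangle+\int_\Omega a(x,\tau,u(x,\tau))v(x)\,dx\Big)d\tau=\int_0^t\int_\Omega f(x,\tau)v(x)\,dx\,d\tau .$$ Then: 1. Every solution $u$ of (P) satisfies $$\|u\|_{L^\infty(\mathbb R^n\times(0,T))}\le T\,\|f\|_{L^\infty(\Omega\times(0,T))}+\|g\|_{L^\infty(\Omega_e\times(0,T))}$$ (the right-hand side may be $+\infty$). 2. Any two solutions of (P) with the same $f$ and $g$ coincide a.e. in $\mathbb R^n\times(0,T)$. 3. There is $\varepsilon>0$, depending only on $n,s,T,\Omega$ and $a$, such that for every $g\in C_c^\infty(\Omega_e\times(0,T))$ with $\sup_{x,t}\|D_x^jg(x,t)\|\le\varepsilon$ for $j=0,1,2$, problem (P)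 with $f=0$ has a solution, and it is unique up to equality a.e. in $\mathbb R^n\times(0,T)$. -/

import Mathlib

open MeasureTheory Set Filter Topology

namespace FracPara

/-- A bounded domain of `ℝⁿ` with smooth boundary: near every boundary point it is the sublevel
set `{ρ < 0}` of a smooth function with non-vanishing differential at that point. -/
structure IsSmoothBoundedDomain {n : ℕ} (Ω : Set (EuclideanSpace ℝ (Fin n))) : Prop where
  isOpen : IsOpen Ω
  isConnected : IsConnected Ω
  isBounded : Bornology.IsBounded Ω
  smooth_boundary : ∀ p ∈ frontier Ω, ∃ (U : Set (EuclideanSpace ℝ (Fin n)))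
    (ρ : EuclideanSpace ℝ (Fin n) → ℝ), IsOpen U ∧ p ∈ U ∧
      ContDiffOn ℝ ((⊤ : ℕ∞) : WithTop ℕ∞) ρ U ∧ fderiv ℝ ρ p ≠ 0 ∧
      Ω ∩ U = {x ∈ U | ρ x < 0}

/-- The exterior `Ω_e = ℝⁿ \ closure Ω`. -/
def exterior {n : ℕ} (Ω : Set (EuclideanSpace ℝ (Fin n))) : Set (EuclideanSpace ℝ (Fin n)) :=
  (closure Ω)ᶜ

/-- The nonlinearity `a(x, t, z) = ∑ₖ aₖ(x, t) |z|^{bₖ} z`. -/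
noncomputable def nonlinearity {n m : ℕ} (a : Fin m → EuclideanSpace ℝ (Fin n) → ℝ → ℝ)
    (b : Fin m → ℝ) (x : EuclideanSpace ℝ (Fin n)) (t z : ℝ) : ℝ :=
  ∑ k, a k x t * (|z| ^ b k * z)

/-- The normalizing constant of the fractional Laplacian,
`c_{n,s} = 4^s s Γ(n/2 + s) / (π^{n/2} Γ(1 - s))`, for which `(-Δ)^s` has symbol `|ξ|^{2s}`. -/
noncomputable def fracConst (n : ℕ) (s : ℝ) : ℝ :=
  (4 : ℝ) ^ s * s * Real.Gamma ((n : ℝ) / 2 + s) /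
    (Real.pi ^ ((n : ℝ) / 2) * Real.Gamma (1 - s))

/-- The bilinear form of the fractional Laplacian,
`⟨(-Δ)^s u, v⟩ = (c_{n,s} / 2) ∬ (u(x) - u(y)) (v(x) - v(y)) / |x - y|^{n + 2s} dx dy`. -/
noncomputable def fracForm {n : ℕ} (s : ℝ) (u v : EuclideanSpace ℝ (Fin n) → ℝ) : ℝ :=
  fracConst n s / 2 * ∫ p : EuclideanSpace ℝ (Fin n) × EuclideanSpace ℝ (Fin n),
    (u p.1 - u p.2) * (v p.1 - v p.2) / ‖p.1 - p.2‖ ^ ((n : ℝ) + 2 * s)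

/-- The energy space of test functions: elements of `H^s(ℝⁿ)` (an `L²` function with finite
Gagliardo seminorm) that vanish almost everywhere outside `Ω`. -/
structure IsTestFunction {n : ℕ} (s : ℝ) (Ω : Set (EuclideanSpace ℝ (Fin n)))
    (v : EuclideanSpace ℝ (Fin n) → ℝ) : Prop where
  memLp : MemLp v 2 volume
  finite_energy : Integrable
    (fun p : EuclideanSpace ℝ (Fin n) × EuclideanSpace ℝ (Fin n) =>
      (v p.1 - v p.2) ^ 2 / ‖p.1 - p.2‖ ^ ((n : ℝ) + 2 * s)) volume
  eq_zero : ∀ᵐ x ∂(volume.restrict Ωᶜ), v x = 0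

/-- `u` is a (finite energy, weak) solution of
`∂ₜu + (-Δ)^s u + a(x, t, u) = f` in `Ω × (0, T)`, `u = g` in `Ω_e × (0, T)`,
`u = 0` on `ℝⁿ × {0}`.

Only pairs `(x, y)` with `x ∈ Ω` or `y ∈ Ω` enter the energy of `u`, since the pairs of points
outside `Ω` do not contribute to `⟨(-Δ)^s u, v⟩` when `v` vanishes outside `Ω`.
The equation is tested against `v` and integrated in time from the zero initial state. -/
structure IsSolution {n m : ℕ} (s T : ℝ) (Ω : Set (EuclideanSpace ℝ (Fin n)))
    (a : Fin m → EuclideanSpace ℝ (Fin n) → ℝ → ℝ) (b : Fin m → ℝ)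
    (f g u : EuclideanSpace ℝ (Fin n) → ℝ → ℝ) : Prop where
  measurable : AEStronglyMeasurable (fun q : EuclideanSpace ℝ (Fin n) × ℝ => u q.1 q.2)
    (volume.restrict (univ ×ˢ Ioo 0 T))
  /-- Finite energy: `∫₀ᵀ ∬ |u(x,t) - u(y,t)|² / |x - y|^{n + 2s} dx dy dt < ∞`. -/
  finite_energy : IntegrableOn
    (fun q : ℝ × EuclideanSpace ℝ (Fin n) × EuclideanSpace ℝ (Fin n) =>
      (u q.2.1 q.1 - u q.2.2 q.1) ^ 2 / ‖q.2.1 - q.2.2‖ ^ ((n : ℝ) + 2 * s))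
    (Ioo 0 T ×ˢ (Ωᶜ ×ˢ Ωᶜ)ᶜ) volume
  /-- `u(t) ∈ L²(Ω)` for `t ∈ [0, T]`. -/
  memLp : ∀ t ∈ Icc 0 T, MemLp (fun x => u x t) 2 (volume.restrict Ω)
  /-- `t ↦ u(t)` is continuous from `[0, T]` to `L²(Ω)`. -/
  continuous : ∀ t₀ ∈ Icc 0 T,
    Tendsto (fun t => eLpNorm (fun x => u x t - u x t₀) 2 (volume.restrict Ω))
      (𝓝[Icc 0 T] t₀) (𝓝 0)
  /-- `a(x, t, u) ∈ L²(Ω × (0, T))`. -/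
  nonlinear_memLp : MemLp
    (fun q : EuclideanSpace ℝ (Fin n) × ℝ => nonlinearity a b q.1 q.2 (u q.1 q.2)) 2
    (volume.restrict (Ω ×ˢ Ioo 0 T))
  /-- `u = g` in `Ω_e × (0, T)`. -/
  exterior_eq : ∀ᵐ q ∂((volume : Measure (EuclideanSpace ℝ (Fin n) × ℝ)).restrict
    (exterior Ω ×ˢ Ioo 0 T)), u q.1 q.2 = g q.1 q.2
  /-- `u = 0` on `ℝⁿ × {0}`. -/
  initial_eq : ∀ᵐ x, u x 0 = 0
  /-- The weak form of the equation. -/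
  equation : ∀ v : EuclideanSpace ℝ (Fin n) → ℝ, IsTestFunction s Ω v → ∀ t ∈ Icc 0 T,
    (∫ x in Ω, u x t * v x) +
      ∫ τ in (0 : ℝ)..t, (fracForm s (fun x => u x τ) v +
        ∫ x in Ω, nonlinearity a b x τ (u x τ) * v x) =
      ∫ τ in (0 : ℝ)..t, ∫ x in Ω, f x τ * v x

end FracPara

/-!
All three parts rest on a comparison principle for the linear equation `∂ₜw + (-Δ)^s w + q = 0`
with a given reaction term `q` (`WeakSol`), of which a solution of the nonlinear problem is an
instance with `q = a(x, t, w) - f`.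

*Comparison* (`WeakSol.nonpos`). If `w ≤ 0` outside `Ω` and at time `0`, and `q ≥ 0` where `w > 0`,
then `w ≤ 0`. Formally one tests with the positive part `w₊`, for which
`⟨(-Δ)^s w, w₊⟩ ≥ 0`. There is no time derivative to test with; instead the equation is integrated
over `(t - h, t)`, tested with `w₊(t)`, and averaged in `t`. As `h → 0` the correlations of the
equation at time `t - σ` with `w₊(t)` converge, because time translations act continuously on `L²`
(`tendsto_average_correlation`).

*The bound and uniqueness.* Comparing `± u` with `G + F t`, where `F` and `G` are the sup norms of
`f` and `g`, gives the bound, since `a(x, t, z)` has the sign of `z` (`WeakSol.ae_abs_le`,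
`IsSolution.eLpNorm_top_le`). The difference of two solutions has a reaction term of its own sign,
as `a` is monotone in `z`, so the same maximum principle with zero data gives uniqueness
(`IsSolution.ae_eq`). The exterior condition concerns `ℝⁿ \ closure Ω` only, whence the need to know
that the smooth boundary is a null set (`IsSmoothBoundedDomain.volume_frontier`).

*Existence.* Write `u = w + g`. As `g` vanishes near `closure Ω`, `(-Δ)^s g` is a bounded function
in `Ω` given by a nonsingular integral (`IsSeparatedDatum.weakSol`), and `w` has to vanish outside
`Ω` and solve `∂ₜw + (-Δ)^s w + a(x, t, w) = -(-Δ)^s g`. Truncating `z` in `a(x, t, z)` makes the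
reaction bounded and Lipschitz; the truncated problem is solved by a fixed point argument
(`exists_weakSol_of_bounded_lipschitz`), and by the maximum principle its solution stays below the
level of truncation if this is chosen as `T` times the bound of `(-Δ)^s g`
(`exists_isSolution`). No smallness of `g` enters.

The linear evolution problem behind the fixed point is solved in the Hilbert space `L²(0, T; H)`
without semigroups or Galerkin approximation. With `ι : V → H` the embedding of the energy space
and `𝒱` the operator `f ↦ ∫₀ᵗ f`, the unknown is `y`, the elliptic operator applied to the solution
`w = ι ι* y`, and the equation reads `ι ι* y + 𝒱 y = 𝒱 G`. Both operators are accretive and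
they commute, which makes the regularizations `ι ι* + 𝒱 + ε`, invertible by Lax–Milgram, converge
(`exists_add_eq_of_commute`). The weight `e^{-2κt}` makes `𝒱` strongly accretive
(`volterra_accretive`), so that the solution map is a contraction for Lipschitz reaction terms
(`exists_nonlinear_evolution`).
-/

namespace FracPara

/-! ### The boundary is a null set -/

/-- A set is null if at each of its points it leaves out, at all small scales `r`, a ball of radius
comparable to `r` at distance comparable to `r` from the point: such a point is not a density
point. -/
theorem measure_eq_zero_of_forall_exists_ball {n : ℕ} {S : Set (EuclideanSpace ℝ (Fin n))}
    (h : ∀ p ∈ S, ∃ v : EuclideanSpace ℝ (Fin n), ∃ δ > 0, ∀ᶠ r : ℝ in 𝓝[>] 0,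
      Disjoint S (Metric.closedBall (p + r • v) (r * δ))) :
    volume S = 0 := by
  have key : ∀ K : ℕ, ∀ᵐ p ∂(volume.restrict S), ∀ v : EuclideanSpace ℝ (Fin n), ∀ δ > 0,
      ‖v‖ ≤ K * δ → ¬ ∀ᶠ r : ℝ in 𝓝[>] 0,
        Disjoint S (Metric.closedBall (p + r • v) (r * δ)) := by
    intro K
    filter_upwards [IsUnifLocDoublingMeasure.ae_tendsto_measure_inter_div
      (volume : Measure (EuclideanSpace ℝ (Fin n))) S K] with p hp v δ hδ hv hd
    have hpos : ∀ᶠ r : ℝ in 𝓝[>] (0 : ℝ), 0 < r := eventually_mem_nhdsWithin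
    have h1 : Tendsto (fun r : ℝ => r * δ) (𝓝[>] 0) (𝓝[>] 0) := by
      refine tendsto_nhdsWithin_iff.2 ⟨?_, ?_⟩
      · have : Tendsto (fun r : ℝ => r * δ) (𝓝 0) (𝓝 (0 * δ)) := tendsto_id.mul_const δ
        rw [zero_mul] at this
        exact this.mono_left nhdsWithin_le_nhds
      · filter_upwards [hpos] with r hr using mul_pos hr hδ
    have h2 := hp (fun r : ℝ => p + r • v) (fun r : ℝ => r * δ) h1 (by
      filter_upwards [hpos] with r hr
      rw [Metric.mem_closedBall, dist_self_add_right, norm_smul, Real.norm_of_nonneg hr.le]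
      nlinarith)
    have h3 : Tendsto (fun _ : ℝ => (0 : ENNReal)) (𝓝[>] (0 : ℝ)) (𝓝 1) := by
      refine h2.congr' ?_
      filter_upwards [hd] with r hr
      rw [Set.disjoint_iff_inter_eq_empty.1 hr]
      simp
    exact zero_ne_one (tendsto_nhds_unique tendsto_const_nhds h3)
  have hall : ∀ᵐ p ∂(volume.restrict S), p ∉ S := by
    filter_upwards [ae_all_iff.2 key] with p hp hpS
    obtain ⟨v, δ, hδ, hd⟩ := h p hpS
    obtain ⟨K, hK⟩ := exists_nat_ge (‖v‖ / δ)
    exact hp K v δ hδ ((div_le_iff₀ hδ).1 hK) hd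
  rw [ae_iff] at hall
  simp only [not_not] at hall
  rwa [← Measure.restrict_apply_self]

theorem IsSmoothBoundedDomain.volume_frontier {n : ℕ} {Ω : Set (EuclideanSpace ℝ (Fin n))}
    (hΩ : IsSmoothBoundedDomain Ω) : volume (frontier Ω) = 0 := by
  refine measure_eq_zero_of_forall_exists_ball fun p hp => ?_
  obtain ⟨U, ρ, hU, hpU, hρ, hρ', hΩU⟩ := hΩ.smooth_boundary p hp
  have hpΩ : p ∉ Ω := fun h => (hΩ.isOpen.inter_frontier_eq ▸ (⟨h, hp⟩ : p ∈ Ω ∩ frontier Ω) :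
    p ∈ (∅ : Set _))
  have hdiff : DifferentiableAt ℝ ρ p :=
    ((hρ p hpU).contDiffAt (hU.mem_nhds hpU)).differentiableAt (by simp)
  have hρp : ρ p = 0 := by
    have h1 : 0 ≤ ρ p := by
      by_contra! h
      exact hpΩ ((hΩU ▸ (⟨hpU, h⟩ : p ∈ {x ∈ U | ρ x < 0}) : p ∈ Ω ∩ U)).1
    refine le_antisymm ?_ h1
    by_contra! h
    have h2 : ∀ᶠ y in 𝓝 p, 0 < ρ y ∧ y ∈ U :=
      (hdiff.continuousAt.eventually (lt_mem_nhds h)).and (hU.mem_nhds hpU)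
    obtain ⟨y, ⟨hy1, hy2⟩, hy3⟩ := mem_closure_iff_nhds.1 hp.1 _ h2
    have : y ∈ {x ∈ U | ρ x < 0} := hΩU ▸ ⟨hy3, hy2⟩
    exact absurd this.2 hy1.le.not_gt
  obtain ⟨v₀, hv₀⟩ : ∃ v₀, fderiv ℝ ρ p v₀ ≠ 0 := by
    by_contra! h
    exact hρ' (ContinuousLinearMap.ext h)
  set L := fderiv ℝ ρ p with hL
  set v := (-(L v₀)⁻¹) • v₀ with hv
  have hLv : L v = -1 := by
    rw [hv, map_smul, smul_eq_mul, neg_mul, inv_mul_cancel₀ hv₀]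
  have hL0 : 0 ≤ ‖L‖ := norm_nonneg L
  set δ : ℝ := 1 / (2 * (‖L‖ + 1)) with hδ
  have hδ0 : 0 < δ := by positivity
  have hLδ : ‖L‖ * δ ≤ 1 / 2 := by
    rw [hδ, mul_one_div, div_le_iff₀ (by positivity)]
    linarith
  set η : ℝ := 1 / (4 * (‖v‖ + δ)) with hη
  have hvδ : 0 < ‖v‖ + δ := by positivity
  have hη0 : 0 < η := by positivity
  have hnear := (hdiff.hasFDerivAt.isLittleO.bound hη0).and (hU.mem_nhds hpU)
  obtain ⟨ε, hε, hball⟩ := Metric.eventually_nhds_iff.1 hnear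
  refine ⟨v, δ, hδ0, ?_⟩
  have hsmall : ∀ᶠ r : ℝ in 𝓝[>] (0 : ℝ), r ∈ Ioo 0 (ε / (‖v‖ + δ)) :=
    Ioo_mem_nhdsGT (by positivity)
  filter_upwards [hsmall] with r hr
  rw [Set.disjoint_right]
  intro y hy hyf
  have hdist : ‖y - p - r • v‖ ≤ r * δ := by
    rw [Metric.mem_closedBall, dist_eq_norm] at hy
    rwa [sub_sub]
  have hyp : ‖y - p‖ ≤ r * (‖v‖ + δ) := by
    calc ‖y - p‖ = ‖(y - p - r • v) + r • v‖ := by rw [sub_add_cancel]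
      _ ≤ ‖y - p - r • v‖ + ‖r • v‖ := norm_add_le _ _
      _ ≤ r * δ + r * ‖v‖ := by
        rw [norm_smul, Real.norm_of_nonneg hr.1.le]; linarith
      _ = _ := by ring
  have hlt : dist y p < ε := by
    rw [dist_eq_norm]
    exact hyp.trans_lt ((lt_div_iff₀ hvδ).1 hr.2)
  obtain ⟨h1, h2⟩ := hball hlt
  rw [hρp, sub_zero] at h1
  have h3 : η * ‖y - p‖ ≤ r / 4 := by
    calc η * ‖y - p‖ ≤ η * (r * (‖v‖ + δ)) := by gcongr
      _ = r / 4 := by rw [hη]; field_simp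
  have h4 : L (y - p) ≤ -r / 2 := by
    have : L (y - p) = L (y - p - r • v) - r := by
      rw [map_sub L (y - p), map_smul, hLv]; simp
    have h5 : L (y - p - r • v) ≤ ‖L‖ * (r * δ) :=
      (le_abs_self _).trans ((L.le_opNorm _).trans (by gcongr))
    have h6 := hr.1
    nlinarith
  have h7 : ρ y < 0 := by
    have := (abs_le.1 (h1.trans h3)).2
    have h6 := hr.1
    linarith
  have hyΩ : y ∈ Ω := ((hΩU ▸ (⟨h2, h7⟩ : y ∈ {x ∈ U | ρ x < 0}) : y ∈ Ω ∩ U)).1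
  exact (hΩ.isOpen.inter_frontier_eq ▸ (⟨hyΩ, hyf⟩ : y ∈ Ω ∩ frontier Ω) : y ∈ (∅ : Set _))

/-! ### Difference quotients and the fractional form -/

/-- The weighted difference `(w(x) - w(y)) / |x - y|^{(n + 2s)/2}`, so that the Gagliardo energy is
the squared `L²` norm of `diffQuot s w`. -/
noncomputable def diffQuot {n : ℕ} (s : ℝ) (w : EuclideanSpace ℝ (Fin n) → ℝ)
    (p : EuclideanSpace ℝ (Fin n) × EuclideanSpace ℝ (Fin n)) : ℝ :=
  (w p.1 - w p.2) / ‖p.1 - p.2‖ ^ (((n : ℝ) + 2 * s) / 2)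

/-- The pairs of points that are not both outside `Ω`. -/
def nearPairs {n : ℕ} (Ω : Set (EuclideanSpace ℝ (Fin n))) :
    Set (EuclideanSpace ℝ (Fin n) × EuclideanSpace ℝ (Fin n)) :=
  (Ωᶜ ×ˢ Ωᶜ)ᶜ

section

variable {n : ℕ} {s T : ℝ} {Ω : Set (EuclideanSpace ℝ (Fin n))}

theorem measurableSet_nearPairs (hΩ : MeasurableSet Ω) : MeasurableSet (nearPairs Ω) :=
  (hΩ.compl.prod hΩ.compl).compl

theorem diffQuot_mul_diffQuot (u v : EuclideanSpace ℝ (Fin n) → ℝ)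
    (p : EuclideanSpace ℝ (Fin n) × EuclideanSpace ℝ (Fin n)) :
    diffQuot s u p * diffQuot s v p =
      (u p.1 - u p.2) * (v p.1 - v p.2) / ‖p.1 - p.2‖ ^ ((n : ℝ) + 2 * s) := by
  have h : ‖p.1 - p.2‖ ^ ((n : ℝ) + 2 * s) =
      ‖p.1 - p.2‖ ^ (((n : ℝ) + 2 * s) / 2) * ‖p.1 - p.2‖ ^ (((n : ℝ) + 2 * s) / 2) := by
    rw [← sq, ← Real.rpow_mul_natCast (norm_nonneg _)]
    simp
  rw [diffQuot, diffQuot, h, div_mul_div_comm]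

theorem diffQuot_sq (u : EuclideanSpace ℝ (Fin n) → ℝ)
    (p : EuclideanSpace ℝ (Fin n) × EuclideanSpace ℝ (Fin n)) :
    diffQuot s u p ^ 2 = (u p.1 - u p.2) ^ 2 / ‖p.1 - p.2‖ ^ ((n : ℝ) + 2 * s) := by
  rw [sq, diffQuot_mul_diffQuot, sq]

theorem diffQuot_linComb (α β : ℝ) (u v : EuclideanSpace ℝ (Fin n) → ℝ)
    (p : EuclideanSpace ℝ (Fin n) × EuclideanSpace ℝ (Fin n)) :
    diffQuot s (fun x => α * u x + β * v x) p = α * diffQuot s u p + β * diffQuot s v p := by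
  simp only [diffQuot]
  ring

theorem abs_diffQuot_le {u v : EuclideanSpace ℝ (Fin n) → ℝ}
    {p : EuclideanSpace ℝ (Fin n) × EuclideanSpace ℝ (Fin n)}
    (h : |u p.1 - u p.2| ≤ |v p.1 - v p.2|) : |diffQuot s u p| ≤ |diffQuot s v p| := by
  simp only [diffQuot, abs_div]
  gcongr

theorem measurable_norm_sub_rpow (r : ℝ) : Measurable
    fun p : EuclideanSpace ℝ (Fin n) × EuclideanSpace ℝ (Fin n) => ‖p.1 - p.2‖ ^ r :=
  (measurable_fst.sub measurable_snd).norm.pow_const r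

theorem aestronglyMeasurable_diffQuot {v : EuclideanSpace ℝ (Fin n) → ℝ}
    (hv : AEStronglyMeasurable v volume) : AEStronglyMeasurable (diffQuot s v) volume := by
  have h1 : AEStronglyMeasurable
      (fun p : EuclideanSpace ℝ (Fin n) × EuclideanSpace ℝ (Fin n) => v p.1 - v p.2) volume :=
    hv.comp_fst.sub hv.comp_snd
  exact (h1.aemeasurable.div (measurable_norm_sub_rpow _).aemeasurable).aestronglyMeasurable

theorem aestronglyMeasurable_diffQuot_time {u : EuclideanSpace ℝ (Fin n) → ℝ → ℝ}
    (hmeas : AEStronglyMeasurable (fun p : ℝ × EuclideanSpace ℝ (Fin n) => u p.2 p.1)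
      ((volume.restrict (Ioo 0 T)).prod volume)) :
    AEStronglyMeasurable
      (fun p : ℝ × EuclideanSpace ℝ (Fin n) × EuclideanSpace ℝ (Fin n) =>
        diffQuot s (fun x => u x p.1) p.2) ((volume.restrict (Ioo 0 T)).prod volume) := by
  have h1 : Measure.QuasiMeasurePreserving
      (fun p : ℝ × EuclideanSpace ℝ (Fin n) × EuclideanSpace ℝ (Fin n) => (p.1, p.2.1))
      ((volume.restrict (Ioo 0 T)).prod volume) ((volume.restrict (Ioo 0 T)).prod volume) :=
    QuasiMeasurePreserving.prodMap (.id _) Measure.quasiMeasurePreserving_fst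
  have h2 : Measure.QuasiMeasurePreserving
      (fun p : ℝ × EuclideanSpace ℝ (Fin n) × EuclideanSpace ℝ (Fin n) => (p.1, p.2.2))
      ((volume.restrict (Ioo 0 T)).prod volume) ((volume.restrict (Ioo 0 T)).prod volume) :=
    QuasiMeasurePreserving.prodMap (.id _) Measure.quasiMeasurePreserving_snd
  exact (((hmeas.comp_quasiMeasurePreserving h1).sub
      (hmeas.comp_quasiMeasurePreserving h2)).aemeasurable.div
        ((measurable_norm_sub_rpow _).comp measurable_snd).aemeasurable).aestronglyMeasurable

/-- Almost everywhere equal functions have almost everywhere equal difference quotients. -/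
theorem diffQuot_congr_ae {u v : EuclideanSpace ℝ (Fin n) → ℝ} (h : u =ᵐ[volume] v) :
    diffQuot s u =ᵐ[volume] diffQuot s v := by
  have h1 := (Measure.quasiMeasurePreserving_fst
    (μ := (volume : Measure (EuclideanSpace ℝ (Fin n))))
    (ν := (volume : Measure (EuclideanSpace ℝ (Fin n))))).ae h
  have h2 := (Measure.quasiMeasurePreserving_snd
    (μ := (volume : Measure (EuclideanSpace ℝ (Fin n))))
    (ν := (volume : Measure (EuclideanSpace ℝ (Fin n))))).ae h
  filter_upwards [h1, h2] with p hp1 hp2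
  simp only [diffQuot, hp1, hp2]

theorem fracForm_eq_integral_diffQuot (u v : EuclideanSpace ℝ (Fin n) → ℝ) :
    fracForm s u v = fracConst n s / 2 *
      ∫ p : EuclideanSpace ℝ (Fin n) × EuclideanSpace ℝ (Fin n),
        diffQuot s u p * diffQuot s v p := by
  simp only [fracForm, diffQuot_mul_diffQuot]

theorem fracForm_congr_ae {u u' v : EuclideanSpace ℝ (Fin n) → ℝ} (h : u =ᵐ[volume] u') :
    fracForm s u v = fracForm s u' v := by
  rw [fracForm_eq_integral_diffQuot, fracForm_eq_integral_diffQuot]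
  congr 1
  refine integral_congr_ae ?_
  filter_upwards [diffQuot_congr_ae (s := s) h] with p hp
  rw [hp]

theorem fracConst_pos (hs : 0 < s) (hs' : s < 1) : 0 < fracConst n s := by
  have h1 : 0 < Real.Gamma ((n : ℝ) / 2 + s) := Real.Gamma_pos_of_pos (by positivity)
  have h2 : 0 < Real.Gamma (1 - s) := Real.Gamma_pos_of_pos (by linarith)
  have h3 := Real.pi_pos
  unfold fracConst
  positivity

namespace IsTestFunction

variable {v : EuclideanSpace ℝ (Fin n) → ℝ}

theorem memLp_diffQuot (hv : IsTestFunction s Ω v) : MemLp (diffQuot s v) 2 volume := by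
  rw [memLp_two_iff_integrable_sq (aestronglyMeasurable_diffQuot hv.memLp.1)]
  simpa only [diffQuot_sq] using hv.finite_energy

theorem ae_eq_zero (hv : IsTestFunction s Ω v) (hΩ : MeasurableSet Ω) :
    ∀ᵐ x, x ∉ Ω → v x = 0 :=
  (ae_restrict_iff' hΩ.compl).1 hv.eq_zero

end IsTestFunction

theorem ae_diffQuot_eq_zero {v : EuclideanSpace ℝ (Fin n) → ℝ} (hv : ∀ᵐ x, x ∉ Ω → v x = 0) :
    ∀ᵐ p, p ∉ nearPairs Ω → diffQuot s v p = 0 := by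
  have h1 := (Measure.quasiMeasurePreserving_fst
    (μ := (volume : Measure (EuclideanSpace ℝ (Fin n))))
    (ν := (volume : Measure (EuclideanSpace ℝ (Fin n))))).ae hv
  have h2 := (Measure.quasiMeasurePreserving_snd
    (μ := (volume : Measure (EuclideanSpace ℝ (Fin n))))
    (ν := (volume : Measure (EuclideanSpace ℝ (Fin n))))).ae hv
  filter_upwards [h1, h2] with p hp1 hp2 hp
  simp only [nearPairs, mem_compl_iff, not_not, mem_prod] at hp
  simp [diffQuot, hp1 hp.1, hp2 hp.2]

theorem setIntegral_diffQuot_mul {u v : EuclideanSpace ℝ (Fin n) → ℝ}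
    (hv : ∀ᵐ x, x ∉ Ω → v x = 0) :
    ∫ p in nearPairs Ω, diffQuot s u p * diffQuot s v p =
      ∫ p : EuclideanSpace ℝ (Fin n) × EuclideanSpace ℝ (Fin n),
        diffQuot s u p * diffQuot s v p := by
  refine setIntegral_eq_integral_of_ae_compl_eq_zero ?_
  filter_upwards [ae_diffQuot_eq_zero (s := s) hv] with p hp h
  rw [hp h, mul_zero]

theorem fracForm_eq_setIntegral {u v : EuclideanSpace ℝ (Fin n) → ℝ}
    (hv : ∀ᵐ x, x ∉ Ω → v x = 0) :
    fracForm s u v = fracConst n s / 2 * ∫ p in nearPairs Ω, diffQuot s u p * diffQuot s v p := by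
  rw [fracForm_eq_integral_diffQuot, setIntegral_diffQuot_mul hv]

theorem integrable_mul_snd {X : Type*} [MeasurableSpace X] {μ : Measure ℝ} [IsFiniteMeasure μ]
    {ν : Measure X} [SFinite ν] {f : ℝ × X → ℝ} {v : X → ℝ} (hf : MemLp f 2 (μ.prod ν))
    (hv : MemLp v 2 ν) : Integrable (fun p : ℝ × X => f p * v p.2) (μ.prod ν) :=
  hf.integrable_mul (hv.comp_snd μ)

/-! ### Weak solutions of the equation with a prescribed reaction term -/

/-- `w` is a weak finite energy solution of `∂ₜw + (-Δ)^s w + q = 0` in `Ω × (0, T)`, without any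
condition on the exterior or initial values. The reaction term `q` is a given function; a
nonlinear equation is recovered by letting `q` depend on `w`. Time is the first variable of the
product measures, so that slices in time are almost everywhere defined by Fubini's theorem. -/
structure WeakSol (s T : ℝ) (Ω : Set (EuclideanSpace ℝ (Fin n)))
    (w q : EuclideanSpace ℝ (Fin n) → ℝ → ℝ) : Prop where
  meas : AEStronglyMeasurable (fun p : ℝ × EuclideanSpace ℝ (Fin n) => w p.2 p.1)
    ((volume.restrict (Ioo 0 T)).prod volume)
  energy : MemLp (fun p : ℝ × EuclideanSpace ℝ (Fin n) × EuclideanSpace ℝ (Fin n) =>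
    diffQuot s (fun x => w x p.1) p.2) 2
      ((volume.restrict (Ioo 0 T)).prod (volume.restrict (nearPairs Ω)))
  memLp : ∀ t ∈ Icc 0 T, MemLp (fun x => w x t) 2 (volume.restrict Ω)
  continuous : ∀ t₀ ∈ Icc 0 T,
    Tendsto (fun t => eLpNorm (fun x => w x t - w x t₀) 2 (volume.restrict Ω))
      (𝓝[Icc 0 T] t₀) (𝓝 0)
  source : MemLp (fun p : ℝ × EuclideanSpace ℝ (Fin n) => q p.2 p.1) 2
    ((volume.restrict (Ioo 0 T)).prod (volume.restrict Ω))
  equation : ∀ v : EuclideanSpace ℝ (Fin n) → ℝ, IsTestFunction s Ω v → ∀ t ∈ Icc 0 T,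
    (∫ x in Ω, w x t * v x) +
      ∫ τ in (0 : ℝ)..t, (fracForm s (fun x => w x τ) v + ∫ x in Ω, q x τ * v x) =
      ∫ x in Ω, w x 0 * v x

theorem intervalIntegrable_of_integrable_Ioo {F : ℝ → ℝ}
    (h : Integrable F (volume.restrict (Ioo 0 T))) {t₁ t₂ : ℝ} (h₁ : t₁ ∈ Icc 0 T)
    (h₂ : t₂ ∈ Icc 0 T) : IntervalIntegrable F volume t₁ t₂ := by
  have : IntegrableOn F (Icc 0 T) volume :=
    (integrableOn_Icc_iff_integrableOn_Ioo (by simp) (by simp)).2 h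
  rw [intervalIntegrable_iff]
  refine this.mono_set fun x hx => ?_
  rw [uIoc, mem_Ioc] at hx
  exact ⟨(le_min h₁.1 h₂.1).trans hx.1.le, hx.2.trans (max_le h₁.2 h₂.2)⟩

theorem ae_uIoc_of_ae_Ioo {P : ℝ → Prop} (h : ∀ᵐ τ ∂(volume.restrict (Ioo 0 T)), P τ) {t : ℝ}
    (ht : t ∈ Icc 0 T) : ∀ᵐ τ, τ ∈ uIoc 0 t → P τ := by
  rw [ae_restrict_iff' measurableSet_Ioo] at h
  filter_upwards [h, Measure.ae_ne volume T] with τ h1 h2 hτ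
  rw [uIoc_of_le ht.1] at hτ
  exact h1 ⟨hτ.1, lt_of_le_of_ne (hτ.2.trans ht.2) h2⟩

theorem integrable_setIntegral_mul {q : EuclideanSpace ℝ (Fin n) → ℝ → ℝ}
    (hq : MemLp (fun p : ℝ × EuclideanSpace ℝ (Fin n) => q p.2 p.1) 2
      ((volume.restrict (Ioo 0 T)).prod (volume.restrict Ω)))
    {v : EuclideanSpace ℝ (Fin n) → ℝ} (hv : MemLp v 2 volume) :
    Integrable (fun τ => ∫ x in Ω, q x τ * v x) (volume.restrict (Ioo 0 T)) :=
  (integrable_mul_snd hq (hv.restrict Ω)).integral_prod_left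

theorem integrable_fracForm {w : EuclideanSpace ℝ (Fin n) → ℝ → ℝ}
    (hw : MemLp (fun p : ℝ × EuclideanSpace ℝ (Fin n) × EuclideanSpace ℝ (Fin n) =>
      diffQuot s (fun x => w x p.1) p.2) 2
        ((volume.restrict (Ioo 0 T)).prod (volume.restrict (nearPairs Ω))))
    (hΩ : MeasurableSet Ω)
    {v : EuclideanSpace ℝ (Fin n) → ℝ} (hv : IsTestFunction s Ω v) :
    Integrable (fun τ => fracForm s (fun x => w x τ) v) (volume.restrict (Ioo 0 T)) := by
  simp only [fracForm_eq_setIntegral (hv.ae_eq_zero hΩ)]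
  exact (integrable_mul_snd hw (hv.memLp_diffQuot.restrict _)).integral_prod_left.const_mul _

namespace WeakSol

variable {w q w₁ q₁ w₂ q₂ : EuclideanSpace ℝ (Fin n) → ℝ → ℝ}

theorem integrable_form (hw : WeakSol s T Ω w q) (hΩ : MeasurableSet Ω)
    {v : EuclideanSpace ℝ (Fin n) → ℝ} (hv : IsTestFunction s Ω v) :
    Integrable (fun τ => fracForm s (fun x => w x τ) v + ∫ x in Ω, q x τ * v x)
      (volume.restrict (Ioo 0 T)) :=
  (integrable_fracForm hw.energy hΩ hv).add (integrable_setIntegral_mul hw.source hv.memLp)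

theorem linComb (h₁ : WeakSol s T Ω w₁ q₁) (h₂ : WeakSol s T Ω w₂ q₂) (hΩ : MeasurableSet Ω)
    (hT : 0 ≤ T) (α β : ℝ) :
    WeakSol s T Ω (fun x t => α * w₁ x t + β * w₂ x t) (fun x t => α * q₁ x t + β * q₂ x t) where
  meas := (h₁.meas.const_mul α).add (h₂.meas.const_mul β)
  energy := by
    simp only [diffQuot_linComb]
    exact (h₁.energy.const_mul α).add (h₂.energy.const_mul β)
  memLp t ht := ((h₁.memLp t ht).const_mul α).add ((h₂.memLp t ht).const_mul β)
  continuous t₀ ht₀ := by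
    have e : ∀ (γ : ℝ) (w : EuclideanSpace ℝ (Fin n) → ℝ → ℝ),
        Tendsto (fun t => eLpNorm (fun x => w x t - w x t₀) 2 (volume.restrict Ω))
          (𝓝[Icc 0 T] t₀) (𝓝 0) →
        Tendsto (fun t => eLpNorm (fun x => γ * (w x t - w x t₀)) 2 (volume.restrict Ω))
          (𝓝[Icc 0 T] t₀) (𝓝 0) := by
      intro γ w hw
      have := ENNReal.Tendsto.const_mul (a := ‖γ‖ₑ) hw (Or.inr (by simp))
      rw [mul_zero] at this
      refine this.congr fun t => ?_
      exact (eLpNorm_const_smul γ (fun x => w x t - w x t₀) 2 (volume.restrict Ω)).symm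
    have h := (e α w₁ (h₁.continuous t₀ ht₀)).add (e β w₂ (h₂.continuous t₀ ht₀))
    rw [add_zero] at h
    refine tendsto_of_tendsto_of_tendsto_of_le_of_le' tendsto_const_nhds h
      (Eventually.of_forall fun _ => zero_le) ?_
    filter_upwards [self_mem_nhdsWithin] with t ht
    have m : ∀ (γ : ℝ) (w : EuclideanSpace ℝ (Fin n) → ℝ → ℝ),
        (∀ t ∈ Icc 0 T, MemLp (fun x => w x t) 2 (volume.restrict Ω)) →
        AEStronglyMeasurable (fun x => γ * (w x t - w x t₀)) (volume.restrict Ω) :=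
      fun γ w hw => ((hw t ht).1.sub (hw t₀ ht₀).1).const_mul γ
    refine le_trans (le_of_eq ?_) (eLpNorm_add_le (m α w₁ h₁.memLp) (m β w₂ h₂.memLp) (by norm_num))
    congr 1
    ext x
    simp only [Pi.add_apply]
    ring
  source := (h₁.source.const_mul α).add (h₂.source.const_mul β)
  equation v hv t ht := by
    have h0 : (0 : ℝ) ∈ Icc 0 T := ⟨le_rfl, hT⟩
    have hvΩ : MemLp v 2 (volume.restrict Ω) := hv.memLp.restrict Ω
    have hsp : ∀ t' ∈ Icc 0 T, ∫ x in Ω, (α * w₁ x t' + β * w₂ x t') * v x =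
        α * (∫ x in Ω, w₁ x t' * v x) + β * ∫ x in Ω, w₂ x t' * v x := by
      intro t' ht'
      rw [← integral_const_mul, ← integral_const_mul, ← integral_add]
      · simp only [add_mul, mul_assoc]
      · exact ((h₁.memLp t' ht').integrable_mul hvΩ).const_mul α
      · exact ((h₂.memLp t' ht').integrable_mul hvΩ).const_mul β
    have hform : ∀ᵐ τ ∂(volume.restrict (Ioo 0 T)),
        (fracForm s (fun x => α * w₁ x τ + β * w₂ x τ) v +
          ∫ x in Ω, (α * q₁ x τ + β * q₂ x τ) * v x) =
        α * (fracForm s (fun x => w₁ x τ) v + ∫ x in Ω, q₁ x τ * v x) +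
        β * (fracForm s (fun x => w₂ x τ) v + ∫ x in Ω, q₂ x τ * v x) := by
      filter_upwards [(integrable_mul_snd h₁.energy (hv.memLp_diffQuot.restrict _)).prod_right_ae,
        (integrable_mul_snd h₂.energy (hv.memLp_diffQuot.restrict _)).prod_right_ae,
        (integrable_mul_snd h₁.source hvΩ).prod_right_ae,
        (integrable_mul_snd h₂.source hvΩ).prod_right_ae] with τ i1 i2 i3 i4
      have e1 : fracForm s (fun x => α * w₁ x τ + β * w₂ x τ) v =
          α * fracForm s (fun x => w₁ x τ) v + β * fracForm s (fun x => w₂ x τ) v := by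
        simp only [fracForm_eq_setIntegral (hv.ae_eq_zero hΩ), diffQuot_linComb, add_mul, mul_assoc]
        rw [integral_add (i1.const_mul α) (i2.const_mul β), integral_const_mul, integral_const_mul]
        ring
      have e2 : ∫ x in Ω, (α * q₁ x τ + β * q₂ x τ) * v x =
          α * (∫ x in Ω, q₁ x τ * v x) + β * ∫ x in Ω, q₂ x τ * v x := by
        simp only [add_mul, mul_assoc]
        rw [integral_add (i3.const_mul α) (i4.const_mul β), integral_const_mul, integral_const_mul]
      rw [e1, e2]
      ring
    rw [hsp t ht, hsp 0 h0, intervalIntegral.integral_congr_ae (ae_uIoc_of_ae_Ioo hform ht),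
      intervalIntegral.integral_add
        ((intervalIntegrable_of_integrable_Ioo (h₁.integrable_form hΩ hv) h0 ht).const_mul α)
        ((intervalIntegrable_of_integrable_Ioo (h₂.integrable_form hΩ hv) h0 ht).const_mul β),
      intervalIntegral.integral_const_mul, intervalIntegral.integral_const_mul,
      ← h₁.equation v hv t ht, ← h₂.equation v hv t ht]
    ring

theorem congr_source (h : WeakSol s T Ω w q₁)
    (hq : (fun p : ℝ × EuclideanSpace ℝ (Fin n) => q₁ p.2 p.1) =ᵐ[(volume.restrict (Ioo 0 T)).prod
      (volume.restrict Ω)] fun p => q₂ p.2 p.1) : WeakSol s T Ω w q₂ where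
  meas := h.meas
  energy := h.energy
  memLp := h.memLp
  continuous := h.continuous
  source := h.source.ae_eq hq
  equation v hv t ht := by
    rw [← h.equation v hv t ht]
    congr 1
    refine intervalIntegral.integral_congr_ae (ae_uIoc_of_ae_Ioo ?_ ht)
    filter_upwards [Measure.ae_ae_of_ae_prod hq] with τ hτ
    congr 1
    refine integral_congr_ae ?_
    filter_upwards [hτ] with x hx
    rw [hx]

end WeakSol

/-- A function of time alone that grows at the constant rate `F` has the reaction term `-F`. -/
theorem weakSol_affine (hΩv : volume Ω ≠ ⊤) (C F : ℝ) :
    WeakSol s T Ω (fun _ t => C + F * t) (fun _ _ => -F) := by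
  have : IsFiniteMeasure (volume.restrict Ω) := ⟨by simpa using hΩv.lt_top⟩
  have hz : ∀ t : ℝ, diffQuot s (fun _ : EuclideanSpace ℝ (Fin n) => C + F * t) = 0 := by
    intro t; ext p; simp [diffQuot]
  have hf : ∀ (t : ℝ) (v : EuclideanSpace ℝ (Fin n) → ℝ),
      fracForm s (fun _ : EuclideanSpace ℝ (Fin n) => C + F * t) v = 0 := by
    intro t v; simp [fracForm]
  refine ⟨by fun_prop, ?_, fun t _ => memLp_const _, fun t₀ _ => ?_, memLp_const _, ?_⟩
  · simp only [hz, Pi.zero_apply]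
    exact MemLp.zero'
  · have h1 : ∀ t, eLpNorm (fun _ : EuclideanSpace ℝ (Fin n) => C + F * t - (C + F * t₀)) 2
        (volume.restrict Ω) = ‖F * (t - t₀)‖ₑ *
          (volume.restrict Ω) univ ^ (1 / (2 : ENNReal).toReal) := by
      intro t
      rw [eLpNorm_const' _ (by norm_num) (by norm_num)]
      congr 2
      ring
    simp only [h1]
    have h2 : Tendsto (fun t => ‖F * (t - t₀)‖ₑ) (𝓝[Icc 0 T] t₀) (𝓝 0) := by
      have : Continuous fun t => ‖F * (t - t₀)‖ₑ := by fun_prop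
      have h := this.tendsto t₀
      simp only [sub_self, mul_zero, enorm_zero] at h
      exact h.mono_left nhdsWithin_le_nhds
    have h3 := ENNReal.Tendsto.mul_const
      (b := (volume.restrict Ω) univ ^ (1 / (2 : ENNReal).toReal))
      h2 (Or.inr (ENNReal.rpow_ne_top_of_nonneg (by positivity) (measure_ne_top _ _)))
    rwa [zero_mul] at h3
  · intro v hv t ht
    simp only [hf, integral_const_mul, zero_add, intervalIntegral.integral_const, sub_zero,
      smul_eq_mul, mul_zero, add_zero]
    ring

theorem IsSolution.weakSol {m : ℕ} {a : Fin m → EuclideanSpace ℝ (Fin n) → ℝ → ℝ} {b : Fin m → ℝ}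
    {f g u : EuclideanSpace ℝ (Fin n) → ℝ → ℝ} (hu : IsSolution s T Ω a b f g u)
    (hΩ : MeasurableSet Ω) (hT : 0 ≤ T)
    (hf : MemLp (fun q : EuclideanSpace ℝ (Fin n) × ℝ => f q.1 q.2) 2
      (volume.restrict (Ω ×ˢ Ioo 0 T))) :
    WeakSol s T Ω u (fun x t => nonlinearity a b x t (u x t) - f x t) := by
  have hswap : ∀ {h : EuclideanSpace ℝ (Fin n) → ℝ → ℝ},
      MemLp (fun q : EuclideanSpace ℝ (Fin n) × ℝ => h q.1 q.2) 2
        (volume.restrict (Ω ×ˢ Ioo 0 T)) →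
      MemLp (fun p : ℝ × EuclideanSpace ℝ (Fin n) => h p.2 p.1) 2
        ((volume.restrict (Ioo 0 T)).prod (volume.restrict Ω)) := by
    intro h hh
    rw [Measure.volume_eq_prod, ← Measure.prod_restrict] at hh
    exact hh.comp_measurePreserving Measure.measurePreserving_swap
  have hmeas : AEStronglyMeasurable (fun p : ℝ × EuclideanSpace ℝ (Fin n) => u p.2 p.1)
      ((volume.restrict (Ioo 0 T)).prod volume) := by
    have h := hu.measurable
    rw [Measure.volume_eq_prod, ← Measure.prod_restrict, Measure.restrict_univ] at h
    exact h.prod_swap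
  have ha := hswap (h := fun x t => nonlinearity a b x t (u x t)) hu.nonlinear_memLp
  have hf' := hswap hf
  have henergy : MemLp (fun p : ℝ × EuclideanSpace ℝ (Fin n) × EuclideanSpace ℝ (Fin n) =>
      diffQuot s (fun x => u x p.1) p.2) 2
      ((volume.restrict (Ioo 0 T)).prod (volume.restrict (nearPairs Ω))) := by
    have h3 := aestronglyMeasurable_diffQuot_time (s := s) hmeas
    have h4 : (volume.restrict (Ioo 0 T)).prod (volume.restrict (nearPairs Ω)) ≤
        (volume.restrict (Ioo 0 T)).prod volume :=
      Measure.prod_mono le_rfl Measure.restrict_le_self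
    rw [memLp_two_iff_integrable_sq (h3.mono_measure h4)]
    have h := hu.finite_energy
    rw [IntegrableOn, Measure.volume_eq_prod, ← Measure.prod_restrict] at h
    simp only [diffQuot_sq]
    exact h
  refine ⟨hmeas, henergy, hu.memLp, hu.continuous, ha.sub hf', fun v hv t ht => ?_⟩
  · have h0 : (0 : ℝ) ∈ Icc 0 T := ⟨le_rfl, hT⟩
    have hvΩ : MemLp v 2 (volume.restrict Ω) := hv.memLp.restrict Ω
    have hin : ∫ x in Ω, u x 0 * v x = 0 := by
      refine integral_eq_zero_of_ae ?_
      filter_upwards [ae_restrict_of_ae hu.initial_eq] with x hx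
      simp [hx]
    have hsplit : ∀ᵐ τ ∂(volume.restrict (Ioo 0 T)),
        (fracForm s (fun x => u x τ) v +
          ∫ x in Ω, (nonlinearity a b x τ (u x τ) - f x τ) * v x) =
        (fracForm s (fun x => u x τ) v + ∫ x in Ω, nonlinearity a b x τ (u x τ) * v x) -
          ∫ x in Ω, f x τ * v x := by
      filter_upwards [(integrable_mul_snd ha hvΩ).prod_right_ae,
        (integrable_mul_snd hf' hvΩ).prod_right_ae] with τ i1 i2
      simp only [sub_mul]
      rw [integral_sub i1 i2]
      ring
    rw [hin, intervalIntegral.integral_congr_ae (ae_uIoc_of_ae_Ioo hsplit ht),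
      intervalIntegral.integral_sub _
        (intervalIntegrable_of_integrable_Ioo (integrable_setIntegral_mul hf' hv.memLp) h0 ht),
      ← hu.equation v hv t ht]
    · ring
    · exact intervalIntegrable_of_integrable_Ioo ((integrable_fracForm henergy hΩ hv).add
        (integrable_setIntegral_mul ha hv.memLp)) h0 ht

end

/-! ### Correlations of space-time functions under small time shifts -/

section

variable {X : Type*} [MeasurableSpace X] {ν : Measure X} [SFinite ν]

theorem measurePreserving_timeShift (σ : ℝ) :
    MeasurePreserving (fun p : ℝ × X => (p.1 - σ, p.2)) (volume.prod ν) (volume.prod ν) :=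
  (measurePreserving_sub_right volume σ).prod (MeasurePreserving.id ν)

theorem integrable_shift_mul {Z Y : ℝ × X → ℝ} (hZ : MemLp Z 2 (volume.prod ν))
    (hY : MemLp Y 2 (volume.prod ν)) (μ : Measure ℝ) [IsFiniteMeasure μ] :
    Integrable (fun p : ℝ × ℝ × X => Z (p.2.1 - p.1, p.2.2) * Y p.2) (μ.prod (volume.prod ν)) := by
  have hshear : MeasurePreserving (fun p : ℝ × ℝ × X => (p.1, (p.2.1 - p.1, p.2.2)))
      (μ.prod (volume.prod ν)) (μ.prod (volume.prod ν)) :=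
    (MeasurePreserving.id μ).skew_product (g := fun σ (p : ℝ × X) => (p.1 - σ, p.2))
      (by fun_prop) (Eventually.of_forall fun σ => (measurePreserving_timeShift σ).map_eq)
  exact ((hZ.comp_snd μ).comp_measurePreserving hshear).integrable_mul (hY.comp_snd μ)

theorem continuous_correlation [TopologicalSpace X] [R1Space X] [BorelSpace (ℝ × X)]
    [(volume.prod ν : Measure (ℝ × X)).InnerRegularCompactLTTop]
    [IsLocallyFiniteMeasure (volume.prod ν : Measure (ℝ × X))]
    {Z Y : ℝ × X → ℝ} (hZ : MemLp Z 2 (volume.prod ν)) (hY : MemLp Y 2 (volume.prod ν)) :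
    Continuous fun σ : ℝ => ∫ p, Z (p.1 - σ, p.2) * Y p ∂(volume.prod ν) := by
  let g : C(ℝ, C(ℝ × X, ℝ × X)) :=
    (ContinuousMap.mk (fun q : ℝ × ℝ × X => (q.2.1 - q.1, q.2.2)) (by fun_prop)).curry
  have h1 := Continuous.compMeasurePreservingLp (p := 2) (μ := volume.prod ν) (ν := volume.prod ν)
    (f := fun _ : ℝ => hZ.toLp Z) (g := g) continuous_const g.continuous
    measurePreserving_timeShift (by norm_num)
  have h2 := h1.inner (𝕜 := ℝ) (continuous_const (y := hY.toLp Y))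
  refine h2.congr fun σ => ?_
  rw [L2.inner_def]
  refine integral_congr_ae ?_
  have h3 := Lp.coeFn_compMeasurePreserving (hZ.toLp Z) (measurePreserving_timeShift (ν := ν) σ)
  have h4 := (measurePreserving_timeShift (ν := ν) σ).quasiMeasurePreserving.ae hZ.coeFn_toLp
  filter_upwards [h3, h4, hY.coeFn_toLp] with p h3 h4 h5
  have h6 : (Lp.compMeasurePreserving (g σ) (measurePreserving_timeShift (ν := ν) σ)
      (hZ.toLp Z)) p = Z (p.1 - σ, p.2) := h3.trans h4
  rw [h5]
  simp only [RCLike.inner_apply, conj_trivial]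
  rw [h6, mul_comm]

theorem integral_integral_shift_mul {Z Y : ℝ × X → ℝ} (hZ : MemLp Z 2 (volume.prod ν))
    (hY : MemLp Y 2 (volume.prod ν)) (h : ℝ) :
    Integrable (fun t => ∫ σ in (0 : ℝ)..h, ∫ x, Z (t - σ, x) * Y (t, x) ∂ν) ∧
    ∫ t, ∫ σ in (0 : ℝ)..h, ∫ x, Z (t - σ, x) * Y (t, x) ∂ν =
      ∫ σ in (0 : ℝ)..h, ∫ p, Z (p.1 - σ, p.2) * Y p ∂(volume.prod ν) := by
  have key : ∀ μ : Measure ℝ, IsFiniteMeasure μ →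
      Integrable (fun t => ∫ σ, ∫ x, Z (t - σ, x) * Y (t, x) ∂ν ∂μ) ∧
      ∫ t, ∫ σ, ∫ x, Z (t - σ, x) * Y (t, x) ∂ν ∂μ =
        ∫ σ, ∫ p, Z (p.1 - σ, p.2) * Y p ∂(volume.prod ν) ∂μ := by
    intro μ _
    have h1 := integrable_shift_mul hZ hY μ
    have h2 : Integrable (fun p : ℝ × ℝ => ∫ x, Z (p.2 - p.1, x) * Y (p.2, x) ∂ν)
        (μ.prod volume) :=
      ((measurePreserving_prodAssoc μ volume ν).integrable_comp_of_integrable h1).integral_prod_left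
    refine ⟨h2.integral_prod_right, ?_⟩
    rw [← integral_integral_swap h2]
    refine integral_congr_ae ?_
    filter_upwards [h1.prod_right_ae] with σ hσ
    rw [integral_prod _ hσ]
  obtain ⟨i1, e1⟩ := key (volume.restrict (Ioc 0 h)) inferInstance
  obtain ⟨i2, e2⟩ := key (volume.restrict (Ioc h 0)) inferInstance
  simp only [intervalIntegral]
  exact ⟨i1.sub i2, by rw [integral_sub i1 i2, e1, e2]⟩

theorem tendsto_average_zero {C : ℝ → ℝ} (hC : Continuous C) :
    Tendsto (fun h : ℝ => h⁻¹ * ∫ σ in (0 : ℝ)..h, C σ) (𝓝[>] 0) (𝓝 (C 0)) := by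
  have h1 := (intervalIntegral.integral_hasDerivAt_right (hC.intervalIntegrable 0 0)
    (hC.stronglyMeasurableAtFilter _ _) hC.continuousAt).tendsto_slope_zero_right
  simpa only [zero_add, intervalIntegral.integral_same, sub_zero, smul_eq_mul] using h1

/-- The time-shifted correlation of two square integrable functions, averaged over shifts in
`(0, h)`, converges to their inner product as `h → 0`: translations act continuously on `L²`. -/
theorem tendsto_average_correlation [TopologicalSpace X] [R1Space X] [BorelSpace (ℝ × X)]
    [(volume.prod ν : Measure (ℝ × X)).InnerRegularCompactLTTop]
    [IsLocallyFiniteMeasure (volume.prod ν : Measure (ℝ × X))]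
    {Z Y : ℝ × X → ℝ} (hZ : MemLp Z 2 (volume.prod ν)) (hY : MemLp Y 2 (volume.prod ν)) :
    Tendsto (fun h : ℝ => h⁻¹ * ∫ t, ∫ σ in (0 : ℝ)..h, ∫ x, Z (t - σ, x) * Y (t, x) ∂ν)
      (𝓝[>] 0) (𝓝 (∫ p, Z p * Y p ∂(volume.prod ν))) := by
  have h1 := tendsto_average_zero (continuous_correlation hZ hY)
  simp only [sub_zero] at h1
  refine h1.congr fun h => ?_
  rw [(integral_integral_shift_mul hZ hY h).2]

end

/-! ### The comparison principle -/

section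

variable {n : ℕ} {s T : ℝ} {Ω : Set (EuclideanSpace ℝ (Fin n))}

theorem memLp_two_slice {X : Type*} [MeasurableSpace X] {μ : Measure ℝ} [SFinite μ]
    {ν : Measure X} [SFinite ν] {f : ℝ × X → ℝ} (hf : MemLp f 2 (μ.prod ν)) :
    ∀ᵐ t ∂μ, MemLp (fun x => f (t, x)) 2 ν := by
  filter_upwards [hf.1.prodMk_left, hf.integrable_sq.prod_right_ae] with t h1 h2
  exact (memLp_two_iff_integrable_sq h1).2 h2

theorem abs_max_zero_sub_max_zero_le (a b : ℝ) : |max a 0 - max b 0| ≤ |a - b| := by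
  simpa using abs_max_sub_max_le_abs a b 0

theorem half_sq_max_sub_le (a b : ℝ) :
    (max a 0) ^ 2 / 2 - (max b 0) ^ 2 / 2 ≤ (a - b) * max a 0 := by
  rcases le_total a 0 with ha | ha <;> rcases le_total b 0 with hb | hb <;>
    simp only [max_eq_left, max_eq_right, ha, hb] <;> nlinarith [sq_nonneg (a - b)]

theorem memLp_posPart {X : Type*} [MeasurableSpace X] {μ : Measure X} {f : X → ℝ}
    (hf : MemLp f 2 μ) : MemLp (fun x => max (f x) 0) 2 μ :=
  hf.mono (hf.1.sup aestronglyMeasurable_const) (Eventually.of_forall fun x => by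
    simpa using abs_max_zero_sub_max_zero_le (f x) 0)

theorem isTestFunction_posPart {w : EuclideanSpace ℝ (Fin n) → ℝ} (hΩ : MeasurableSet Ω)
    (hmeas : AEStronglyMeasurable w volume) (hneg : ∀ᵐ x, x ∉ Ω → w x ≤ 0)
    (hw : MemLp w 2 (volume.restrict Ω))
    (henergy : MemLp (diffQuot s w) 2 (volume.restrict (nearPairs Ω))) :
    IsTestFunction s Ω (fun x => max (w x) 0) := by
  have hmeas' : AEStronglyMeasurable (fun x => max (w x) 0) volume :=
    hmeas.sup aestronglyMeasurable_const
  have hzero : ∀ᵐ x, x ∉ Ω → max (w x) 0 = 0 := by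
    filter_upwards [hneg] with x hx hxΩ using max_eq_right (hx hxΩ)
  refine ⟨?_, ?_, (ae_restrict_iff' hΩ.compl).2 hzero⟩
  · refine ((memLp_indicator_iff_restrict hΩ).2 (memLp_posPart hw)).ae_eq ?_
    filter_upwards [hzero] with x hx
    by_cases hxΩ : x ∈ Ω
    · rw [indicator_of_mem hxΩ]
    · rw [indicator_of_notMem hxΩ, hx hxΩ]
  · have h1 : MemLp (diffQuot s fun x => max (w x) 0) 2 (volume.restrict (nearPairs Ω)) :=
      henergy.mono (aestronglyMeasurable_diffQuot hmeas').restrict (Eventually.of_forall fun p =>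
        abs_diffQuot_le (abs_max_zero_sub_max_zero_le _ _))
    have h2 := ((memLp_indicator_iff_restrict (measurableSet_nearPairs hΩ)).2 h1).ae_eq
      (g := diffQuot s fun x => max (w x) 0) (by
        filter_upwards [ae_diffQuot_eq_zero (s := s) hzero] with p hp
        by_cases hpΩ : p ∈ nearPairs Ω
        · rw [indicator_of_mem hpΩ]
        · rw [indicator_of_notMem hpΩ, hp hpΩ])
    simpa only [diffQuot_sq] using h2.integrable_sq

theorem diffQuot_mul_posPart_nonneg (w : EuclideanSpace ℝ (Fin n) → ℝ)
    (p : EuclideanSpace ℝ (Fin n) × EuclideanSpace ℝ (Fin n)) :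
    0 ≤ diffQuot s w p * diffQuot s (fun x => max (w x) 0) p := by
  rw [diffQuot_mul_diffQuot]
  refine div_nonneg ?_ (by positivity)
  rcases le_total (w p.1) 0 with ha | ha <;> rcases le_total (w p.2) 0 with hb | hb <;>
    simp only [max_eq_left, max_eq_right, ha, hb] <;> nlinarith [sq_nonneg (w p.1 - w p.2)]

theorem integral_sq_eq_toReal_eLpNorm_sq {X : Type*} [MeasurableSpace X] {μ : Measure X}
    {f : X → ℝ} (hf : MemLp f 2 μ) : ∫ x, f x ^ 2 ∂μ = (eLpNorm f 2 μ).toReal ^ 2 := by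
  rw [← Lp.norm_toLp f hf, ← real_inner_self_eq_norm_sq, L2.inner_def]
  refine integral_congr_ae ?_
  filter_upwards [hf.coeFn_toLp] with x hx
  simp [hx, sq]

/-- The squared `L²(Ω)` norm of the positive part is continuous along an `L²(Ω)`-continuous
curve. -/
theorem continuousOn_integral_sq_posPart {w : EuclideanSpace ℝ (Fin n) → ℝ → ℝ}
    (hw : ∀ t ∈ Icc 0 T, MemLp (fun x => w x t) 2 (volume.restrict Ω))
    (hcont : ∀ t₀ ∈ Icc 0 T,
      Tendsto (fun t => eLpNorm (fun x => w x t - w x t₀) 2 (volume.restrict Ω))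
        (𝓝[Icc 0 T] t₀) (𝓝 0)) :
    ContinuousOn (fun t => ∫ x in Ω, (max (w x t) 0) ^ 2) (Icc 0 T) := by
  have hpos := fun t ht => memLp_posPart (hw t ht)
  have hN : ContinuousOn
      (fun t => (eLpNorm (fun x => max (w x t) 0) 2 (volume.restrict Ω)).toReal) (Icc 0 T) := by
    intro t₀ ht₀
    rw [ContinuousWithinAt, tendsto_iff_dist_tendsto_zero]
    have h1 := (ENNReal.tendsto_toReal ENNReal.zero_ne_top).comp (hcont t₀ ht₀)
    refine squeeze_zero' (Eventually.of_forall fun _ => dist_nonneg) ?_ h1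
    filter_upwards [self_mem_nhdsWithin] with t ht
    have e1 := Lp.norm_toLp _ (hpos t ht)
    have e2 := Lp.norm_toLp _ (hpos t₀ ht₀)
    have e3 := Lp.norm_toLp _ ((hpos t ht).sub (hpos t₀ ht₀))
    rw [MemLp.toLp_sub (hpos t ht) (hpos t₀ ht₀)] at e3
    rw [Real.dist_eq, ← e1, ← e2]
    refine (abs_norm_sub_norm_le _ _).trans (e3.le.trans ?_)
    have hsub := (hw t ht).sub (hw t₀ ht₀)
    refine ENNReal.toReal_mono hsub.2.ne (eLpNorm_mono fun x => ?_)
    simpa using abs_max_zero_sub_max_zero_le (w x t) (w x t₀)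
  refine (hN.pow 2).congr fun t ht => ?_
  exact integral_sq_eq_toReal_eLpNorm_sq (hpos t ht)

theorem memLp_indicator_timeSet {X : Type*} [MeasurableSpace X] {ν : Measure X} [SFinite ν]
    {f : ℝ × X → ℝ} {A : Set X} (hA : MeasurableSet A) {t₀ : ℝ} (ht₀ : t₀ ≤ T)
    (hf : MemLp f 2 ((volume.restrict (Ioo 0 T)).prod (ν.restrict A))) :
    MemLp ((Ioo 0 t₀ ×ˢ A).indicator f) 2 (volume.prod ν) := by
  rw [memLp_indicator_iff_restrict (measurableSet_Ioo.prod hA), ← Measure.prod_restrict]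
  refine hf.mono_measure (Measure.prod_mono (Measure.restrict_mono ?_ le_rfl) le_rfl)
  exact Ioo_subset_Ioo_right ht₀

theorem integral_indicator_mul_indicator {X : Type*} [MeasurableSpace X] {ν : Measure X}
    {f g : ℝ × X → ℝ} {A : Set X} (hA : MeasurableSet A) {I J : Set ℝ} {t : ℝ} (ht : t ∈ J)
    (τ : ℝ) :
    ∫ x, (I ×ˢ A).indicator f (τ, x) * (J ×ˢ A).indicator g (t, x) ∂ν =
      I.indicator (fun τ => ∫ x in A, f (τ, x) * g (t, x) ∂ν) τ := by
  by_cases hτ : τ ∈ I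
  · rw [indicator_of_mem hτ, ← integral_indicator hA]
    congr 1
    ext x
    by_cases hx : x ∈ A <;> simp [indicator, hτ, ht, hx]
  · rw [indicator_of_notMem hτ]
    simp [indicator, hτ]

theorem WeakSol.integral_increment {w q : EuclideanSpace ℝ (Fin n) → ℝ → ℝ}
    (hw : WeakSol s T Ω w q) (hΩ : MeasurableSet Ω) {v : EuclideanSpace ℝ (Fin n) → ℝ}
    (hv : IsTestFunction s Ω v) {t' t : ℝ} (ht' : t' ∈ Icc 0 T) (ht : t ∈ Icc 0 T) :
    ∫ x in Ω, (w x t - w x t') * v x =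
      -∫ τ in t'..t, (fracForm s (fun x => w x τ) v + ∫ x in Ω, q x τ * v x) := by
  have h0 : (0 : ℝ) ∈ Icc 0 T := ⟨le_rfl, ht.1.trans ht.2⟩
  have hi := hw.integrable_form hΩ hv
  have hvΩ : MemLp v 2 (volume.restrict Ω) := hv.memLp.restrict Ω
  rw [← intervalIntegral.integral_interval_sub_left
    (intervalIntegrable_of_integrable_Ioo hi h0 ht)
    (intervalIntegrable_of_integrable_Ioo hi h0 ht')]
  have e : ∫ x in Ω, (w x t - w x t') * v x = (∫ x in Ω, w x t * v x) - ∫ x in Ω, w x t' * v x := by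
    simp only [sub_mul]
    exact integral_sub ((hw.memLp t ht).integrable_mul hvΩ) ((hw.memLp t' ht').integrable_mul hvΩ)
  linarith [hw.equation v hv t ht, hw.equation v hv t' ht']

theorem integral_shift_average {Ψ : ℝ → ℝ} (hΨ : Integrable Ψ) (h0 : ∀ τ ≤ 0, Ψ τ = 0) (t h : ℝ) :
    ∫ σ in (0 : ℝ)..h, Ψ (t - σ) = ∫ τ in (max (t - h) 0)..t, Ψ τ := by
  rw [intervalIntegral.integral_comp_sub_left, sub_zero]
  rcases le_total 0 (t - h) with hth | hth
  · rw [max_eq_left hth]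
  · rw [max_eq_right hth, ← intervalIntegral.integral_add_adjacent_intervals
      (hΨ.intervalIntegrable (a := t - h) (b := 0)) hΨ.intervalIntegrable]
    rw [intervalIntegral.integral_zero_ae, zero_add]
    refine Eventually.of_forall fun τ hτ => h0 τ ?_
    rw [uIoc_of_le hth] at hτ
    exact hτ.2

/-- **Comparison principle.** A weak solution that is nonpositive outside `Ω` and at time `0`, and
whose reaction term is nonnegative wherever the solution is positive, is nonpositive.

For almost every `t` the positive part `w₊(t)` is a test function. Testing the equation, integrated
over `(t - h, t)`, with it and using `½ a₊² - ½ b₊² ≤ (a - b) a₊` bounds the increment of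
`½‖w₊‖²` by correlations of the equation at time `t - σ` with `w₊(t)`; averaging in `t` and letting
`h → 0` leaves `½‖w₊(t₀)‖² ≤ -∫ (⟨(-Δ)^s w, w₊⟩ + q w₊) ≤ 0`. -/
theorem WeakSol.nonpos {w q : EuclideanSpace ℝ (Fin n) → ℝ → ℝ}
    (hw : WeakSol s T Ω w q) (hs : 0 < s) (hs' : s < 1) (hΩ : MeasurableSet Ω)
    (hneg : ∀ᵐ p ∂((volume.restrict (Ioo 0 T)).prod
      (volume : Measure (EuclideanSpace ℝ (Fin n)))), p.2 ∉ Ω → w p.2 p.1 ≤ 0)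
    (hinit : ∀ᵐ x ∂(volume.restrict Ω), w x 0 ≤ 0)
    (hsign : ∀ᵐ p ∂((volume.restrict (Ioo 0 T)).prod (volume.restrict Ω)),
      0 < w p.2 p.1 → 0 ≤ q p.2 p.1) :
    ∀ᵐ p ∂((volume.restrict (Ioo 0 T)).prod (volume : Measure (EuclideanSpace ℝ (Fin n)))),
      w p.2 p.1 ≤ 0 := by
  have hc : 0 < fracConst n s := fracConst_pos hs hs'
  have htest : ∀ᵐ t ∂(volume.restrict (Ioo 0 T)),
      IsTestFunction s Ω (fun x => max (w x t) 0) := by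
    filter_upwards [hw.meas.prodMk_left, Measure.ae_ae_of_ae_prod hneg,
      memLp_two_slice hw.energy, ae_restrict_mem measurableSet_Ioo] with t h1 h2 h3 h4
    exact isTestFunction_posPart hΩ h1 h2 (hw.memLp t ⟨h4.1.le, h4.2.le⟩) h3
  have hQ := measurableSet_nearPairs hΩ
  set N : ℝ → ℝ := fun t => ∫ x in Ω, (max (w x t) 0) ^ 2 with hN
  have hNcont : ContinuousOn N (Icc 0 T) := continuousOn_integral_sq_posPart hw.memLp hw.continuous
  have hN0 : N 0 = 0 := by
    refine integral_eq_zero_of_ae ?_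
    filter_upwards [hinit] with x hx
    simp [max_eq_right hx]
  -- the squared norm vanishes at every interior time
  have hzero : ∀ t₀ ∈ Ioo 0 T, N t₀ = 0 := by
    intro t₀ ht₀
    have hT : 0 ≤ T := (ht₀.1.trans ht₀.2).le
    have hpos_meas : AEStronglyMeasurable
        (fun p : ℝ × EuclideanSpace ℝ (Fin n) => max (w p.2 p.1) 0)
        ((volume.restrict (Ioo 0 T)).prod volume) := hw.meas.sup aestronglyMeasurable_const
    have hYe : MemLp (fun p : ℝ × EuclideanSpace ℝ (Fin n) × EuclideanSpace ℝ (Fin n) =>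
        diffQuot s (fun x => max (w x p.1) 0) p.2) 2
        ((volume.restrict (Ioo 0 T)).prod (volume.restrict (nearPairs Ω))) :=
      hw.energy.mono ((aestronglyMeasurable_diffQuot_time
        (u := fun x t => max (w x t) 0) hpos_meas).mono_measure
          (Measure.prod_mono le_rfl Measure.restrict_le_self)) (Eventually.of_forall fun p =>
            abs_diffQuot_le (abs_max_zero_sub_max_zero_le _ _))
    have hYs : MemLp (fun p : ℝ × EuclideanSpace ℝ (Fin n) => max (w p.2 p.1) 0) 2
        ((volume.restrict (Ioo 0 T)).prod (volume.restrict Ω)) := by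
      have hm := hpos_meas.mono_measure (Measure.prod_mono (le_refl (volume.restrict (Ioo 0 T)))
        (Measure.restrict_le_self (s := Ω)))
      have hm2 : AEStronglyMeasurable
          (fun p : ℝ × EuclideanSpace ℝ (Fin n) => max (w p.2 p.1) 0 ^ 2)
          ((volume.restrict (Ioo 0 T)).prod (volume.restrict Ω)) := hm.pow 2
      rw [memLp_two_iff_integrable_sq hm, integrable_prod_iff hm2]
      refine ⟨?_, ?_⟩
      · filter_upwards [ae_restrict_mem measurableSet_Ioo] with t ht
        exact (memLp_posPart (hw.memLp t ⟨ht.1.le, ht.2.le⟩)).integrable_sq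
      · simp only [norm_pow, Real.norm_eq_abs, sq_abs]
        exact (hNcont.integrableOn_compact isCompact_Icc).mono_set Ioo_subset_Icc_self
    set Z := (Ioo 0 T ×ˢ nearPairs Ω).indicator
      (fun p : ℝ × EuclideanSpace ℝ (Fin n) × EuclideanSpace ℝ (Fin n) =>
        diffQuot s (fun x => w x p.1) p.2) with hZ
    set Y := (Ioo 0 t₀ ×ˢ nearPairs Ω).indicator
      (fun p : ℝ × EuclideanSpace ℝ (Fin n) × EuclideanSpace ℝ (Fin n) =>
        diffQuot s (fun x => max (w x p.1) 0) p.2) with hY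
    set Z' := (Ioo 0 T ×ˢ Ω).indicator
      (fun p : ℝ × EuclideanSpace ℝ (Fin n) => q p.2 p.1) with hZ'
    set Y' := (Ioo 0 t₀ ×ˢ Ω).indicator
      (fun p : ℝ × EuclideanSpace ℝ (Fin n) => max (w p.2 p.1) 0) with hY'
    have mZ : MemLp Z 2 (volume.prod volume) := memLp_indicator_timeSet hQ le_rfl hw.energy
    have mY : MemLp Y 2 (volume.prod volume) := memLp_indicator_timeSet hQ ht₀.2.le hYe
    have mZ' : MemLp Z' 2 (volume.prod volume) := memLp_indicator_timeSet hΩ le_rfl hw.source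
    have mY' : MemLp Y' 2 (volume.prod volume) := memLp_indicator_timeSet hΩ ht₀.2.le hYs
    -- continuous extension of `N` to all times, vanishing at negative times
    set P : ℝ → ℝ := fun t => N (max 0 (min t T)) / 2 with hP
    have hPcont : Continuous P := by
      refine Continuous.div_const ?_ 2
      exact hNcont.comp_continuous (by fun_prop)
        fun t => ⟨le_max_left _ _, max_le hT (min_le_right _ _)⟩
    have hPneg : ∀ t ≤ 0, P t = 0 := by
      intro t ht
      have : max 0 (min t T) = 0 := max_eq_left ((min_le_left _ _).trans ht)
      simp only [hP, this, hN0, zero_div]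
    have hPmid : ∀ t ∈ Icc 0 T, P t = N t / 2 := by
      intro t ht
      simp only [hP, min_eq_left ht.2, max_eq_right ht.1]
    set J : ℝ → ℝ → ℝ := fun h t => fracConst n s / 2 *
      (∫ σ in (0 : ℝ)..h, ∫ p, Z (t - σ, p) * Y (t, p)) +
        ∫ σ in (0 : ℝ)..h, ∫ x, Z' (t - σ, x) * Y' (t, x) with hJ
    have hJint : ∀ h, Integrable (J h) := fun h =>
      ((integral_integral_shift_mul mZ mY h).1.const_mul _).add
        (integral_integral_shift_mul mZ' mY' h).1
    have hJzero : ∀ h, ∀ t ∉ Ioo 0 t₀, J h t = 0 := by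
      intro h t ht
      simp [hJ, hY, hY', indicator, ht]
    -- the increment over a time step, tested with the positive part
    have hstep : ∀ h > 0, ∀ᵐ t ∂(volume.restrict (Ioo 0 t₀)), P t - P (t - h) ≤ -J h t := by
      intro h hh
      have htest' := ae_mono (Measure.restrict_mono (Ioo_subset_Ioo_right ht₀.2.le) le_rfl) htest
      filter_upwards [htest', ae_restrict_mem measurableSet_Ioo] with t hv ht
      have htI : t ∈ Icc 0 T := ⟨ht.1.le, (ht.2.trans ht₀.2).le⟩
      set t' := max (t - h) 0 with ht'
      have ht'I : t' ∈ Icc 0 T := ⟨le_max_right _ _, max_le (by linarith [htI.2]) hT⟩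
      have hPt' : P (t - h) = N t' / 2 := by
        rcases le_total 0 (t - h) with hth | hth
        · rw [ht', max_eq_left hth]
          exact hPmid _ ⟨hth, by linarith [htI.2]⟩
        · rw [ht', max_eq_right hth, hPneg _ hth, hN0, zero_div]
      set v : EuclideanSpace ℝ (Fin n) → ℝ := fun x => max (w x t) 0 with hvdef
      set A : ℝ → ℝ := (Ioo 0 T).indicator
        fun τ => ∫ p in nearPairs Ω, diffQuot s (fun x => w x τ) p * diffQuot s v p with hA
      set B : ℝ → ℝ := (Ioo 0 T).indicator fun τ => ∫ x in Ω, q x τ * v x with hB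
      have iA : Integrable A := (integrable_indicator_iff measurableSet_Ioo).2
        (integrable_mul_snd hw.energy (hv.memLp_diffQuot.restrict _)).integral_prod_left
      have iB : Integrable B := (integrable_indicator_iff measurableSet_Ioo).2
        (integrable_setIntegral_mul hw.source hv.memLp)
      have hneg0 : ∀ (F : ℝ → ℝ), ∀ τ ≤ 0, (Ioo 0 T).indicator F τ = 0 :=
        fun F τ hτ => indicator_of_notMem (fun h => absurd h.1 hτ.not_gt) _
      have eA : ∀ σ, ∫ p, Z (t - σ, p) * Y (t, p) = A (t - σ) := fun σ =>
        integral_indicator_mul_indicator hQ ht _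
      have eB : ∀ σ, ∫ x, Z' (t - σ, x) * Y' (t, x) = B (t - σ) := fun σ =>
        integral_indicator_mul_indicator hΩ ht _
      have hJt : J h t = ∫ τ in t'..t, (fracForm s (fun x => w x τ) v + ∫ x in Ω, q x τ * v x) := by
        simp only [hJ, eA, eB]
        rw [integral_shift_average iA (hneg0 _), integral_shift_average iB (hneg0 _),
          ← intervalIntegral.integral_const_mul, ← intervalIntegral.integral_add
            (iA.intervalIntegrable.const_mul _) iB.intervalIntegrable]
        refine intervalIntegral.integral_congr_ae (Eventually.of_forall fun τ hτ => ?_)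
        rw [uIoc_of_le (max_le (by linarith) ht.1.le)] at hτ
        have hτI : τ ∈ Ioo 0 T := ⟨(le_max_right _ _).trans_lt hτ.1,
          hτ.2.trans_lt (ht.2.trans ht₀.2)⟩
        simp only [hA, hB, indicator_of_mem hτI, fracForm_eq_setIntegral (hv.ae_eq_zero hΩ)]
      have hle : N t / 2 - N t' / 2 ≤ ∫ x in Ω, (w x t - w x t') * v x := by
        have i1 := (memLp_posPart (hw.memLp t htI)).integrable_sq.div_const 2
        have i2 := (memLp_posPart (hw.memLp t' ht'I)).integrable_sq.div_const 2
        have i3 : Integrable (fun x => (w x t - w x t') * v x) (volume.restrict Ω) :=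
          ((hw.memLp t htI).sub (hw.memLp t' ht'I)).integrable_mul (hv.memLp.restrict Ω)
        rw [hN, ← integral_div, ← integral_div, ← integral_sub i1 i2]
        exact integral_mono (i1.sub i2) i3 fun x => half_sq_max_sub_le _ _
      rw [hw.integral_increment hΩ hv ht'I htI, ← hJt] at hle
      rwa [hPmid t htI, hPt']
    -- integrating the increments telescopes
    have htel : ∀ h > 0, ∫ σ in (0 : ℝ)..h, P (t₀ - σ) ≤ -∫ t, J h t := by
      intro h hh
      have hPs : Continuous fun t => P (t - h) := by fun_prop
      have e1 : ∫ t in (0 : ℝ)..t₀, (P t - P (t - h)) = ∫ σ in (0 : ℝ)..h, P (t₀ - σ) := by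
        rw [intervalIntegral.integral_sub (hPcont.intervalIntegrable _ _)
          (hPs.intervalIntegrable _ _),
          intervalIntegral.integral_comp_sub_right, intervalIntegral.integral_comp_sub_left,
          intervalIntegral.integral_interval_sub_interval_comm (hPcont.intervalIntegrable _ _)
            (hPcont.intervalIntegrable _ _) (hPcont.intervalIntegrable _ _), zero_sub, sub_zero,
          intervalIntegral.integral_symm (t₀ - h) t₀]
        have : ∫ t in (0 : ℝ)..(-h), P t = 0 := by
          refine intervalIntegral.integral_zero_ae (Eventually.of_forall fun t ht => hPneg t ?_)
          rw [uIoc_of_ge (by linarith)] at ht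
          exact ht.2
        rw [this]
        ring
      have e2 : ∫ t in Ioo 0 t₀, J h t = ∫ t, J h t :=
        setIntegral_eq_integral_of_forall_compl_eq_zero (hJzero h)
      rw [← e1, ← e2, ← integral_neg, intervalIntegral.integral_of_le ht₀.1.le,
        integral_Ioc_eq_integral_Ioo]
      refine integral_mono_ae ?_ (hJint h).neg.restrict (hstep h hh)
      exact ((hPcont.sub hPs).integrableOn_Icc
        (a := 0) (b := t₀)).mono_set Ioo_subset_Icc_self
    -- averaging over `h → 0`
    have hlim1 : Tendsto (fun h : ℝ => h⁻¹ * ∫ σ in (0 : ℝ)..h, P (t₀ - σ)) (𝓝[>] 0)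
        (𝓝 (P t₀)) := by
      have := tendsto_average_zero (C := fun σ => P (t₀ - σ)) (by fun_prop)
      simpa using this
    have hlim2 : Tendsto (fun h : ℝ => h⁻¹ * -∫ t, J h t) (𝓝[>] 0)
        (𝓝 (-(fracConst n s / 2 * (∫ p, Z p * Y p ∂(volume.prod volume)) +
          ∫ p, Z' p * Y' p ∂(volume.prod volume)))) := by
      refine (((tendsto_average_correlation mZ mY).const_mul (fracConst n s / 2)).add
        (tendsto_average_correlation mZ' mY')).neg.congr fun h => ?_
      simp only [hJ]
      rw [integral_add ((integral_integral_shift_mul mZ mY h).1.const_mul _)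
        (integral_integral_shift_mul mZ' mY' h).1, integral_const_mul]
      ring
    have hle := le_of_tendsto_of_tendsto hlim1 hlim2 (by
      filter_upwards [self_mem_nhdsWithin] with h hh
      exact mul_le_mul_of_nonneg_left (htel h hh) (inv_nonneg.2 (le_of_lt hh)))
    have hE : 0 ≤ ∫ p, Z p * Y p ∂(volume.prod volume) := by
      refine integral_nonneg fun p => ?_
      simp only [hZ, hY, indicator, Pi.zero_apply]
      split_ifs <;> simp [diffQuot_mul_posPart_nonneg]
    have hS : 0 ≤ ∫ p, Z' p * Y' p ∂(volume.prod volume) := by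
      refine integral_nonneg_of_ae ?_
      rw [Measure.prod_restrict, ae_restrict_iff' (measurableSet_Ioo.prod hΩ)] at hsign
      filter_upwards [hsign] with p hp
      simp only [hZ', hY', indicator, Pi.zero_apply]
      split_ifs with h1 h2
      · rcases le_or_gt (w p.2 p.1) 0 with h | h
        · simp [max_eq_right h]
        · exact mul_nonneg (hp h1 h) (le_max_right _ _)
      all_goals simp
    rw [hPmid t₀ ⟨ht₀.1.le, ht₀.2.le⟩] at hle
    have hNnn : 0 ≤ N t₀ := integral_nonneg fun x => sq_nonneg _
    have : 0 ≤ fracConst n s / 2 * ∫ p, Z p * Y p ∂(volume.prod volume) := by positivity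
    linarith
  -- from all time slices to space-time
  have hslice : ∀ t ∈ Ioo 0 T, ∀ᵐ x, x ∈ Ω → w x t ≤ 0 := by
    intro t ht
    have h1 := (integral_eq_zero_iff_of_nonneg (fun x => sq_nonneg _)
      (memLp_posPart (hw.memLp t ⟨ht.1.le, ht.2.le⟩)).integrable_sq).1 (hzero t ht)
    rw [← ae_restrict_iff' hΩ]
    filter_upwards [h1] with x hx
    have : max (w x t) 0 = 0 := by simpa using hx
    exact max_eq_right_iff.1 this
  have hall : ∀ᵐ t ∂(volume.restrict (Ioo 0 T)), ∀ᵐ x, w x t ≤ 0 := by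
    filter_upwards [Measure.ae_ae_of_ae_prod hneg, ae_restrict_mem measurableSet_Ioo] with t h1 h2
    filter_upwards [h1, hslice t h2] with x h3 h4
    by_cases hx : x ∈ Ω
    exacts [h4 hx, h3 hx]
  have hmk := hw.meas.ae_eq_mk
  have hmk2 : ∀ᵐ p ∂((volume.restrict (Ioo 0 T)).prod
      (volume : Measure (EuclideanSpace ℝ (Fin n)))), hw.meas.mk _ p ≤ 0 := by
    rw [Measure.ae_prod_iff_ae_ae
      (measurableSet_le hw.meas.stronglyMeasurable_mk.measurable measurable_const)]
    filter_upwards [hall, Measure.ae_ae_of_ae_prod hmk] with t h1 h2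
    filter_upwards [h1, h2] with x h3 h4
    rw [← h4]
    exact h3
  filter_upwards [hmk, hmk2] with p h1 h2
  rw [h1]
  exact h2

end

/-! ### The maximum principle and uniqueness -/

theorem monotone_abs_rpow_mul {b : ℝ} (hb : 0 < b) : Monotone fun z : ℝ => |z| ^ b * z := by
  intro x y hxy
  rcases le_total 0 x with hx | hx
  · have hy := hx.trans hxy
    simp only [abs_of_nonneg hx, abs_of_nonneg hy]
    gcongr
  · rcases le_total 0 y with hy | hy
    · have h1 : |x| ^ b * x ≤ 0 := mul_nonpos_of_nonneg_of_nonpos (by positivity) hx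
      have h2 : 0 ≤ |y| ^ b * y := by positivity
      exact h1.trans h2
    · simp only [abs_of_nonpos hx, abs_of_nonpos hy]
      have : (-y) ^ b * (-y) ≤ (-x) ^ b * (-x) := by
        have : 0 ≤ -y := by linarith
        have : 0 ≤ -x := by linarith
        gcongr
      linarith

section

variable {n m : ℕ} {s T : ℝ} {Ω : Set (EuclideanSpace ℝ (Fin n))}
  {a : Fin m → EuclideanSpace ℝ (Fin n) → ℝ → ℝ} {b : Fin m → ℝ}

theorem nonlinearity_mono {x : EuclideanSpace ℝ (Fin n)} {t : ℝ} (ha : ∀ k, 0 ≤ a k x t)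
    (hb : ∀ k, 0 < b k) : Monotone (nonlinearity a b x t) := fun _ _ hz =>
  Finset.sum_le_sum fun k _ => mul_le_mul_of_nonneg_left (monotone_abs_rpow_mul (hb k) hz) (ha k)

theorem nonlinearity_zero (x : EuclideanSpace ℝ (Fin n)) (t : ℝ) : nonlinearity a b x t 0 = 0 := by
  simp [nonlinearity]

/-- A maximum principle: if the reaction term is at least `-F` where the solution is positive and
at most `F` where it is negative, a solution vanishing at time `0` grows at most at rate `F` above
its exterior bound `G`. -/
theorem WeakSol.ae_abs_le {w q : EuclideanSpace ℝ (Fin n) → ℝ → ℝ} (hw : WeakSol s T Ω w q)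
    (hs : 0 < s) (hs' : s < 1) (hT : 0 ≤ T) (hΩ : MeasurableSet Ω) (hΩv : volume Ω ≠ ⊤) {F G : ℝ}
    (hF : 0 ≤ F) (hG : 0 ≤ G)
    (hext : ∀ᵐ p ∂((volume.restrict (Ioo 0 T)).prod
      (volume : Measure (EuclideanSpace ℝ (Fin n)))), p.2 ∉ Ω → |w p.2 p.1| ≤ G)
    (hinit : ∀ᵐ x ∂(volume.restrict Ω), w x 0 = 0)
    (hsign : ∀ᵐ p ∂((volume.restrict (Ioo 0 T)).prod (volume.restrict Ω)),
      (0 < w p.2 p.1 → -F ≤ q p.2 p.1) ∧ (w p.2 p.1 < 0 → q p.2 p.1 ≤ F)) :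
    ∀ᵐ p ∂((volume.restrict (Ioo 0 T)).prod (volume : Measure (EuclideanSpace ℝ (Fin n)))),
      |w p.2 p.1| ≤ G + F * T := by
  have hpos : ∀ᵐ p ∂((volume.restrict (Ioo 0 T)).prod
      (volume : Measure (EuclideanSpace ℝ (Fin n)))), 0 < p.1 ∧ p.1 < T :=
    Measure.quasiMeasurePreserving_fst.ae (ae_restrict_mem measurableSet_Ioo)
  have hpos' : ∀ᵐ p ∂((volume.restrict (Ioo 0 T)).prod
      (volume.restrict Ω)), 0 < p.1 ∧ p.1 < T :=
    Measure.quasiMeasurePreserving_fst.ae (ae_restrict_mem measurableSet_Ioo)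
  have key : ∀ σ : ℝ, σ = 1 ∨ σ = -1 →
      ∀ᵐ p ∂((volume.restrict (Ioo 0 T)).prod (volume : Measure (EuclideanSpace ℝ (Fin n)))),
        σ * w p.2 p.1 + -1 * (G + F * p.1) ≤ 0 := by
    intro σ hσ
    refine (hw.linComb (weakSol_affine hΩv G F) hΩ hT σ (-1)).nonpos hs hs' hΩ ?_ ?_ ?_
    · filter_upwards [hext, hpos] with p hp hp0 hpΩ
      have h1 := abs_le.1 (hp hpΩ)
      have h2 : 0 ≤ F * p.1 := mul_nonneg hF hp0.1.le
      rcases hσ with rfl | rfl <;> linarith [h1.1, h1.2]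
    · filter_upwards [hinit] with x hx
      rw [hx]
      linarith
    · filter_upwards [hsign, hpos'] with p hp hp0 hpw
      have h2 : 0 ≤ F * p.1 := mul_nonneg hF hp0.1.le
      rcases hσ with rfl | rfl
      · linarith [hp.1 (by linarith)]
      · linarith [hp.2 (by linarith)]
  filter_upwards [key 1 (Or.inl rfl), key (-1) (Or.inr rfl), hpos] with p h1 h2 hp
  have h3 : F * p.1 ≤ F * T := mul_le_mul_of_nonneg_left hp.2.le hF
  exact abs_le.2 ⟨by linarith, by linarith⟩

theorem ae_swap_of_ae_prod {p : EuclideanSpace ℝ (Fin n) → ℝ → Prop}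
    {A : Set (EuclideanSpace ℝ (Fin n))}
    (h : ∀ᵐ q ∂((volume.restrict (Ioo 0 T)).prod
      ((volume : Measure (EuclideanSpace ℝ (Fin n))).restrict A)), p q.2 q.1) :
    ∀ᵐ q ∂((volume : Measure (EuclideanSpace ℝ (Fin n) × ℝ)).restrict (A ×ˢ Ioo 0 T)),
      p q.1 q.2 := by
  rw [Measure.volume_eq_prod, ← Measure.prod_restrict]
  exact Measure.measurePreserving_swap.quasiMeasurePreserving.ae h

theorem ae_prod_of_ae_swap {p : EuclideanSpace ℝ (Fin n) → ℝ → Prop}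
    {A : Set (EuclideanSpace ℝ (Fin n))}
    (h : ∀ᵐ q ∂((volume : Measure (EuclideanSpace ℝ (Fin n) × ℝ)).restrict (A ×ˢ Ioo 0 T)),
      p q.1 q.2) :
    ∀ᵐ q ∂((volume.restrict (Ioo 0 T)).prod
      ((volume : Measure (EuclideanSpace ℝ (Fin n))).restrict A)), p q.2 q.1 := by
  rw [Measure.volume_eq_prod, ← Measure.prod_restrict] at h
  exact Measure.measurePreserving_swap.quasiMeasurePreserving.ae h

/-- As the boundary of `Ω` is a null set, exterior conditions hold almost everywhere off `Ω`. -/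
theorem ae_off_of_ae_exterior (hΩ : IsSmoothBoundedDomain Ω)
    {p : EuclideanSpace ℝ (Fin n) → ℝ → Prop}
    (h : ∀ᵐ q ∂((volume : Measure (EuclideanSpace ℝ (Fin n) × ℝ)).restrict
      (exterior Ω ×ˢ Ioo 0 T)), p q.1 q.2) :
    ∀ᵐ q ∂((volume.restrict (Ioo 0 T)).prod (volume : Measure (EuclideanSpace ℝ (Fin n)))),
      q.2 ∉ Ω → p q.2 q.1 := by
  have h1 := ae_prod_of_ae_swap h
  have hext : MeasurableSet (exterior Ω) := isClosed_closure.isOpen_compl.measurableSet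
  have h2 : (volume.restrict (Ioo 0 T)).prod
      ((volume : Measure (EuclideanSpace ℝ (Fin n))).restrict (exterior Ω)) =
      ((volume.restrict (Ioo 0 T)).prod volume).restrict (univ ×ˢ exterior Ω) := by
    rw [← Measure.prod_restrict, Measure.restrict_univ]
  rw [h2, ae_restrict_iff' (MeasurableSet.univ.prod hext)] at h1
  have h3 : ∀ᵐ q ∂((volume.restrict (Ioo 0 T)).prod (volume : Measure (EuclideanSpace ℝ (Fin n)))),
      q.2 ∉ frontier Ω :=
    Measure.quasiMeasurePreserving_snd.ae (measure_eq_zero_iff_ae_notMem.1 hΩ.volume_frontier)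
  filter_upwards [h1, h3] with q hq1 hq2 hq3
  refine hq1 ⟨mem_univ _, fun hq4 => hq2 ?_⟩
  rw [hΩ.isOpen.frontier_eq]
  exact ⟨hq4, hq3⟩

theorem IsSmoothBoundedDomain.volume_ne_top (hΩ : IsSmoothBoundedDomain Ω) : volume Ω ≠ ⊤ :=
  hΩ.isBounded.measure_lt_top.ne

theorem ae_mem_cylinder (hΩ : MeasurableSet Ω) :
    ∀ᵐ p ∂((volume.restrict (Ioo 0 T)).prod (volume.restrict Ω)), p.1 ∈ Ioo 0 T ∧ p.2 ∈ Ω :=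
  (Measure.quasiMeasurePreserving_fst.ae (ae_restrict_mem measurableSet_Ioo)).and
    (Measure.quasiMeasurePreserving_snd.ae (ae_restrict_mem hΩ))

theorem IsSolution.eLpNorm_top_le {f g u : EuclideanSpace ℝ (Fin n) → ℝ → ℝ}
    (hu : IsSolution s T Ω a b f g u) (hs : 0 < s) (hs' : s < 1) (hT : 0 < T)
    (hΩ : IsSmoothBoundedDomain Ω)
    (ha : ∀ k, ∀ x ∈ closure Ω, ∀ t ∈ Icc 0 T, 0 ≤ a k x t) (hb : ∀ k, 0 < b k)
    (hf : MemLp (fun q : EuclideanSpace ℝ (Fin n) × ℝ => f q.1 q.2) 2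
      (volume.restrict (Ω ×ˢ Ioo 0 T))) :
    eLpNorm (fun q : EuclideanSpace ℝ (Fin n) × ℝ => u q.1 q.2) ⊤
        (volume.restrict (univ ×ˢ Ioo 0 T)) ≤
      ENNReal.ofReal T * eLpNorm (fun q : EuclideanSpace ℝ (Fin n) × ℝ => f q.1 q.2) ⊤
          (volume.restrict (Ω ×ˢ Ioo 0 T)) +
        eLpNorm (fun q : EuclideanSpace ℝ (Fin n) × ℝ => g q.1 q.2) ⊤
          (volume.restrict (exterior Ω ×ˢ Ioo 0 T)) := by
  have hΩm := hΩ.isOpen.measurableSet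
  set F := eLpNorm (fun q : EuclideanSpace ℝ (Fin n) × ℝ => f q.1 q.2) ⊤
    (volume.restrict (Ω ×ˢ Ioo 0 T)) with hF
  set G := eLpNorm (fun q : EuclideanSpace ℝ (Fin n) × ℝ => g q.1 q.2) ⊤
    (volume.restrict (exterior Ω ×ˢ Ioo 0 T)) with hG
  by_cases hFtop : F = ⊤
  · rw [hFtop, ENNReal.mul_top (by simpa using hT), top_add]
    exact le_top
  by_cases hGtop : G = ⊤
  · rw [hGtop, add_top]
    exact le_top
  have hbound : ∀ {h : EuclideanSpace ℝ (Fin n) × ℝ → ℝ}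
      {μ : Measure (EuclideanSpace ℝ (Fin n) × ℝ)}, eLpNorm h ⊤ μ ≠ ⊤ →
      ∀ᵐ q ∂μ, |h q| ≤ (eLpNorm h ⊤ μ).toReal := by
    intro h μ hfin
    rw [eLpNorm_exponent_top] at hfin ⊢
    filter_upwards [ae_le_eLpNormEssSup (f := h) (μ := μ)] with q hq
    have := ENNReal.toReal_mono hfin hq
    simpa using this
  have hfb := ae_prod_of_ae_swap (p := fun x t => |f x t| ≤ F.toReal) (hbound hFtop)
  have hgb : ∀ᵐ q ∂((volume.restrict (Ioo 0 T)).prod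
      (volume : Measure (EuclideanSpace ℝ (Fin n)))), q.2 ∉ Ω → |u q.2 q.1| ≤ G.toReal := by
    refine ae_off_of_ae_exterior hΩ (p := fun x t => |u x t| ≤ G.toReal) ?_
    filter_upwards [hbound hGtop, hu.exterior_eq] with q hq1 hq2
    rw [hq2]
    exact hq1
  have hmain := (hu.weakSol hΩm hT.le hf).ae_abs_le hs hs' hT.le hΩm hΩ.volume_ne_top
    (F := F.toReal) (G := G.toReal) ENNReal.toReal_nonneg ENNReal.toReal_nonneg hgb
    (ae_restrict_of_ae hu.initial_eq) (by
      filter_upwards [hfb, ae_mem_cylinder hΩm] with p hp hmem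
      have hmono : Monotone (nonlinearity a b p.2 p.1) := nonlinearity_mono
        (fun k => ha k _ (subset_closure hmem.2) _ ⟨hmem.1.1.le, hmem.1.2.le⟩) hb
      have h0 := nonlinearity_zero (a := a) (b := b) p.2 p.1
      have h1 := abs_le.1 hp
      refine ⟨fun hpos => ?_, fun hneg => ?_⟩
      · linarith [hmono hpos.le, h1.2]
      · linarith [hmono hneg.le, h1.1])
  rw [← Measure.restrict_univ (μ := (volume : Measure (EuclideanSpace ℝ (Fin n))))] at hmain
  have hmain' := ae_swap_of_ae_prod (p := fun x t => |u x t| ≤ G.toReal + F.toReal * T) hmain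
  rw [eLpNorm_exponent_top]
  refine (eLpNormEssSup_le_of_ae_bound hmain').trans (le_of_eq ?_)
  rw [ENNReal.ofReal_add ENNReal.toReal_nonneg (by positivity),
    ENNReal.ofReal_mul ENNReal.toReal_nonneg, ENNReal.ofReal_toReal hFtop,
    ENNReal.ofReal_toReal hGtop, add_comm, mul_comm]

theorem IsSolution.ae_eq {f g u₁ u₂ : EuclideanSpace ℝ (Fin n) → ℝ → ℝ}
    (h₁ : IsSolution s T Ω a b f g u₁) (h₂ : IsSolution s T Ω a b f g u₂)
    (hs : 0 < s) (hs' : s < 1) (hT : 0 < T) (hΩ : IsSmoothBoundedDomain Ω)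
    (ha : ∀ k, ∀ x ∈ closure Ω, ∀ t ∈ Icc 0 T, 0 ≤ a k x t) (hb : ∀ k, 0 < b k)
    (hf : MemLp (fun q : EuclideanSpace ℝ (Fin n) × ℝ => f q.1 q.2) 2
      (volume.restrict (Ω ×ˢ Ioo 0 T))) :
    ∀ᵐ q ∂((volume : Measure (EuclideanSpace ℝ (Fin n) × ℝ)).restrict (univ ×ˢ Ioo 0 T)),
      u₁ q.1 q.2 = u₂ q.1 q.2 := by
  have hΩm := hΩ.isOpen.measurableSet
  have hext : ∀ᵐ q ∂((volume.restrict (Ioo 0 T)).prod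
      (volume : Measure (EuclideanSpace ℝ (Fin n)))), q.2 ∉ Ω →
        |1 * u₁ q.2 q.1 + -1 * u₂ q.2 q.1| ≤ 0 := by
    refine ae_off_of_ae_exterior hΩ (p := fun x t => |1 * u₁ x t + -1 * u₂ x t| ≤ 0) ?_
    filter_upwards [h₁.exterior_eq, h₂.exterior_eq] with q hq1 hq2
    rw [hq1, hq2]
    simp
  have hmain := ((h₁.weakSol hΩm hT.le hf).linComb (h₂.weakSol hΩm hT.le hf)
    hΩm hT.le 1 (-1)).ae_abs_le hs hs' hT.le hΩm hΩ.volume_ne_top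
    (F := 0) (G := 0) le_rfl le_rfl hext (by
      filter_upwards [ae_restrict_of_ae h₁.initial_eq,
        ae_restrict_of_ae h₂.initial_eq] with x hx1 hx2
      rw [hx1, hx2]
      simp) (by
      filter_upwards [ae_mem_cylinder hΩm] with p hmem
      have hmono : Monotone (nonlinearity a b p.2 p.1) := nonlinearity_mono
        (fun k => ha k _ (subset_closure hmem.2) _ ⟨hmem.1.1.le, hmem.1.2.le⟩) hb
      refine ⟨fun hpos => ?_, fun hneg => ?_⟩
      · linarith [hmono (show u₂ p.2 p.1 ≤ u₁ p.2 p.1 by linarith)]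
      · linarith [hmono (show u₁ p.2 p.1 ≤ u₂ p.2 p.1 by linarith)])
  refine ae_swap_of_ae_prod (p := fun x t => u₁ x t = u₂ x t) ?_
  rw [Measure.restrict_univ]
  filter_upwards [hmain] with p hp
  have := abs_le.1 hp
  linarith [this.1, this.2]

end

/-! ### A linear equation with commuting accretive operators -/

local notation "⟪" x ", " y "⟫" => inner ℝ x y

/-- A sequence whose squared norms are monotone and bounded and control the mutual distances is
convergent. -/
theorem exists_tendsto_of_sq_dist_le {X : Type*} [NormedAddCommGroup X] [CompleteSpace X]
    {y : ℕ → X} {C : ℝ} (hC : ∀ k, ‖y k‖ ≤ C)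
    (hy : ∀ k l, k ≤ l → ‖y k - y l‖ ^ 2 ≤ ‖y l‖ ^ 2 - ‖y k‖ ^ 2) :
    ∃ z, Tendsto y atTop (𝓝 z) := by
  have hmono : Monotone fun k => ‖y k‖ ^ 2 := fun k l hkl => by
    have := hy k l hkl
    nlinarith [sq_nonneg ‖y k - y l‖]
  have hbdd : BddAbove (range fun k => ‖y k‖ ^ 2) := ⟨C ^ 2, by
    rintro _ ⟨k, rfl⟩
    exact pow_le_pow_left₀ (norm_nonneg _) (hC k) 2⟩
  have hcau := (tendsto_atTop_ciSup hmono hbdd).cauchySeq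
  refine cauchySeq_tendsto_of_complete (Metric.cauchySeq_iff'.2 fun ε hε => ?_)
  obtain ⟨N, hN⟩ := Metric.cauchySeq_iff'.1 hcau (ε ^ 2) (by positivity)
  refine ⟨N, fun k hk => ?_⟩
  have h1 := hN k hk
  rw [Real.dist_eq] at h1
  have h2 := hy N k hk
  rw [dist_comm, dist_eq_norm]
  refine lt_of_pow_lt_pow_left₀ 2 hε.le (h2.trans_lt ((le_abs_self _).trans_lt h1))

section

variable {X Y : Type*} [NormedAddCommGroup X] [InnerProductSpace ℝ X] [CompleteSpace X]
  [NormedAddCommGroup Y] [InnerProductSpace ℝ Y]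

/-- A bounded coercive operator on a real Hilbert space is onto (Lax–Milgram). -/
theorem surjective_of_coercive (A : X →L[ℝ] X) {ε : ℝ} (hε : 0 < ε)
    (hA : ∀ x, ε * ‖x‖ ^ 2 ≤ ⟪A x, x⟫) : Function.Surjective A := by
  have hB : IsCoercive ((innerSL ℝ).comp A) := ⟨ε, hε, fun u => by
    have := hA u
    simp only [ContinuousLinearMap.comp_apply, innerSL_apply_apply]
    nlinarith⟩
  intro z
  refine ⟨hB.continuousLinearEquivOfBilin.symm z, ?_⟩
  refine ext_inner_right ℝ fun w => ?_
  have := hB.continuousLinearEquivOfBilin_apply (hB.continuousLinearEquivOfBilin.symm z) w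
  rw [ContinuousLinearEquiv.apply_symm_apply] at this
  simpa using this.symm

/-- Solvability of `J J* y + K y = K G` when `K` is accretive and commutes with `J` and `J*`.
The regularized problems `(J J* + K + ε) y = K G` are solved by Lax–Milgram with `‖y‖ ≤ ‖G‖`, and
accretivity makes their solutions converge strongly as `ε → 0`. -/
theorem exists_add_eq_of_commute (J : Y →L[ℝ] X) (J' : X →L[ℝ] Y)
    (hadj : ∀ v x, ⟪J v, x⟫ = ⟪v, J' x⟫) (K : X →L[ℝ] X) (K' : Y →L[ℝ] Y)
    (hK : ∀ x, 0 ≤ ⟪K x, x⟫) (hK' : ∀ v, 0 ≤ ⟪K' v, v⟫)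
    (hJ : ∀ v, K (J v) = J (K' v)) (hJ' : ∀ x, K' (J' x) = J' (K x)) (G : X) :
    ∃ y, J (J' y) + K y = K G := by
  have hR : ∀ x, 0 ≤ ⟪J (J' x), x⟫ := fun x => by
    rw [hadj]
    exact real_inner_self_nonneg
  have hKR : ∀ x, 0 ≤ ⟪K x, J (J' x)⟫ := fun x => by
    rw [real_inner_comm, hadj, real_inner_comm, ← hJ']
    exact hK' _
  have hreg : ∀ ε : ℝ, 0 < ε → ∃ y, J (J' y) + K y + ε • y = K G ∧ ‖y‖ ≤ ‖G‖ := by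
    intro ε hε
    set A : X →L[ℝ] X := J.comp J' + K + ε • ContinuousLinearMap.id ℝ X with hA
    have hAx : ∀ x, A x = J (J' x) + K x + ε • x := fun x => by simp [hA]
    obtain ⟨x, hx⟩ := surjective_of_coercive A hε (fun x => by
      rw [hAx, inner_add_left, inner_add_left, real_inner_smul_left, real_inner_self_eq_norm_sq]
      linarith [hR x, hK x]) G
    rw [hAx] at hx
    refine ⟨K x, ?_, ?_⟩
    · rw [← hx, map_add, map_add, map_smul, hJ, hJ']
    · have h1 : ‖G‖ ^ 2 = ‖J (J' x) + ε • x‖ ^ 2 + 2 * ⟪J (J' x) + ε • x, K x⟫ + ‖K x‖ ^ 2 := by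
        rw [← hx, add_right_comm, norm_add_sq_real]
      have h2 : 0 ≤ ⟪J (J' x) + ε • x, K x⟫ := by
        rw [inner_add_left, real_inner_smul_left, real_inner_comm, real_inner_comm (K x) x]
        have := hKR x
        have := mul_nonneg hε.le (hK x)
        linarith
      refine (sq_le_sq₀ (norm_nonneg _) (norm_nonneg _)).1 ?_
      nlinarith [sq_nonneg ‖J (J' x) + ε • x‖]
  choose! y hy hyG using hreg
  have hcomp : ∀ ε δ : ℝ, 0 < δ → δ ≤ ε → ‖y ε - y δ‖ ^ 2 ≤ ‖y δ‖ ^ 2 - ‖y ε‖ ^ 2 := by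
    intro ε δ hδ hδε
    have hε := hδ.trans_le hδε
    have h1 : J (J' (y ε - y δ)) + K (y ε - y δ) = δ • y δ - ε • y ε := by
      have h2 := hy ε hε
      rw [← hy δ hδ] at h2
      simp only [map_sub]
      rw [← sub_eq_zero] at h2 ⊢
      rw [← h2]
      abel
    have h3 : 0 ≤ ⟪δ • y δ - ε • y ε, y ε - y δ⟫ := by
      rw [← h1, inner_add_left]
      exact add_nonneg (hR _) (hK _)
    simp only [inner_sub_left, inner_sub_right, real_inner_smul_left,
      real_inner_self_eq_norm_sq] at h3
    rw [real_inner_comm (y ε) (y δ)] at h3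
    rw [norm_sub_sq_real]
    -- `(ε + δ) ‖y ε - y δ‖² ≤ (ε - δ) (‖y δ‖² - ‖y ε‖²)`
    have h4 : (ε + δ) * (‖y ε‖ ^ 2 - 2 * ⟪y ε, y δ⟫ + ‖y δ‖ ^ 2) ≤
        (ε - δ) * (‖y δ‖ ^ 2 - ‖y ε‖ ^ 2) := by
      linarith
    have h5 : 0 ≤ ‖y ε‖ ^ 2 - 2 * ⟪y ε, y δ⟫ + ‖y δ‖ ^ 2 := by
      rw [← norm_sub_sq_real]
      positivity
    have h6 : 0 ≤ ‖y δ‖ ^ 2 - ‖y ε‖ ^ 2 := by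
      rcases hδε.eq_or_lt with h | h
      · rw [h]; simp
      · by_contra! hlt
        nlinarith [mul_nonneg (add_pos hε hδ).le h5]
    nlinarith
  have hpos : ∀ k : ℕ, (0 : ℝ) < 1 / (k + 1) := fun k => Nat.one_div_pos_of_nat
  obtain ⟨z, hz⟩ := exists_tendsto_of_sq_dist_le (y := fun k : ℕ => y (1 / ((k : ℝ) + 1)))
    (C := ‖G‖) (fun k => hyG _ (hpos k))
    (fun k l hkl => hcomp _ _ (hpos l) (Nat.one_div_le_one_div hkl))
  refine ⟨z, ?_⟩
  have h1 : Tendsto (fun k : ℕ => J (J' (y (1 / ((k : ℝ) + 1)))) + K (y (1 / ((k : ℝ) + 1))) +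
      (1 / ((k : ℝ) + 1)) • y (1 / ((k : ℝ) + 1))) atTop (𝓝 (J (J' z) + K z + (0 : ℝ) • z)) :=
    ((((J.continuous.comp J'.continuous).tendsto z).comp hz).add
      ((K.continuous.tendsto z).comp hz)).add
      (tendsto_one_div_add_atTop_nhds_zero_nat.smul hz)
  simp only [hy _ (hpos _), zero_smul, add_zero] at h1
  exact tendsto_nhds_unique h1 tendsto_const_nhds

end

/-! ### The Volterra operator on an exponentially weighted Bochner space -/

/-- The measure `e^{-2κt} dt` on `(0, T]`. -/
noncomputable def expMeasure (κ T : ℝ) : Measure ℝ :=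
  (volume.restrict (Ioc 0 T)).withDensity fun t =>
    (Real.toNNReal (Real.exp (-(2 * κ) * t)) : ENNReal)

section

variable {κ T : ℝ}

theorem measurable_expDensity :
    Measurable fun t : ℝ => Real.toNNReal (Real.exp (-(2 * κ) * t)) := by
  fun_prop

theorem expMeasure_absolutelyContinuous : expMeasure κ T ≪ volume.restrict (Ioc 0 T) :=
  withDensity_absolutelyContinuous _ _

theorem restrict_le_smul_expMeasure (hκ : 0 ≤ κ) :
    volume.restrict (Ioc 0 T) ≤ ENNReal.ofReal (Real.exp (2 * κ * T)) • expMeasure κ T := by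
  rw [expMeasure, ← withDensity_smul _ (by fun_prop)]
  conv_lhs => rw [← withDensity_one (μ := volume.restrict (Ioc 0 T))]
  refine withDensity_mono ?_
  filter_upwards [ae_restrict_mem measurableSet_Ioc] with t ht
  simp only [Pi.one_apply, Pi.smul_apply, smul_eq_mul]
  change (1 : ENNReal) ≤ ENNReal.ofReal _ * ENNReal.ofReal _
  rw [← ENNReal.ofReal_mul (Real.exp_pos _).le, ← Real.exp_add, ← ENNReal.ofReal_one]
  refine ENNReal.ofReal_le_ofReal (Real.one_le_exp ?_)
  nlinarith [ht.2, mul_nonneg hκ (sub_nonneg.2 ht.2)]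

instance : IsFiniteMeasure (expMeasure κ T) := by
  refine isFiniteMeasure_withDensity (ne_of_lt ?_)
  have h : Continuous fun t : ℝ => Real.exp (-(2 * κ) * t) := by fun_prop
  have := (h.integrableOn_Icc (μ := volume) (a := 0) (b := T)).mono_set Ioc_subset_Icc_self
  exact (hasFiniteIntegral_iff_ofReal (Eventually.of_forall fun t => (Real.exp_pos _).le)).1 this.2

theorem absolutelyContinuous_expMeasure (hκ : 0 ≤ κ) :
    volume.restrict (Ioc 0 T) ≪ expMeasure κ T :=
  (Measure.absolutelyContinuous_of_le (restrict_le_smul_expMeasure hκ)).trans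
    (Measure.smul_absolutelyContinuous)

variable {H : Type*} [NormedAddCommGroup H]

theorem MemLp.restrict_of_expMeasure (hκ : 0 ≤ κ) {f : ℝ → H} (hf : MemLp f 2 (expMeasure κ T)) :
    MemLp f 2 (volume.restrict (Ioc 0 T)) :=
  hf.of_measure_le_smul (by simp) (restrict_le_smul_expMeasure hκ)

theorem integrableOn_of_expMeasure (hκ : 0 ≤ κ) {f : ℝ → H} (hf : MemLp f 2 (expMeasure κ T)) :
    IntegrableOn f (Ioc 0 T) :=
  (MemLp.restrict_of_expMeasure hκ hf).integrable (by norm_num)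

variable [InnerProductSpace ℝ H]

theorem integral_expMeasure (g : ℝ → ℝ) :
    ∫ t, g t ∂(expMeasure κ T) = ∫ t in Ioc 0 T, Real.exp (-(2 * κ) * t) * g t := by
  rw [expMeasure, integral_withDensity_eq_integral_smul measurable_expDensity]
  refine integral_congr_ae (Eventually.of_forall fun t => ?_)
  simp only [NNReal.smul_def, smul_eq_mul]
  rw [Real.coe_toNNReal _ (Real.exp_pos _).le]

/-- The primitive `t ↦ ∫₀ᵗ f` of the restriction of `f` to `(0, T]`. -/
noncomputable def primitive (T : ℝ) (f : ℝ → H) (t : ℝ) : H :=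
  ∫ τ in (0 : ℝ)..t, (Ioc 0 T).indicator f τ

theorem continuous_primitive {f : ℝ → H} (hf : IntegrableOn f (Ioc 0 T)) :
    Continuous (primitive T f) :=
  intervalIntegral.continuous_primitive
    (fun _ _ => ((integrable_indicator_iff measurableSet_Ioc).2 hf).intervalIntegrable) 0

theorem primitive_zero (f : ℝ → H) : primitive T f 0 = 0 := intervalIntegral.integral_same

theorem primitive_eq {f : ℝ → H} {t : ℝ} (ht : t ∈ Icc 0 T) :
    primitive T f t = ∫ τ in (0 : ℝ)..t, f τ := by
  refine intervalIntegral.integral_congr_ae (Eventually.of_forall fun τ hτ => ?_)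
  rw [uIoc_of_le ht.1] at hτ
  exact indicator_of_mem (show τ ∈ Ioc 0 T from ⟨hτ.1, hτ.2.trans ht.2⟩) _

theorem primitive_congr {f g : ℝ → H} (h : f =ᵐ[volume.restrict (Ioc 0 T)] g) (t : ℝ) :
    primitive T f t = primitive T g t := by
  refine intervalIntegral.integral_congr_ae ?_
  filter_upwards [(ae_restrict_iff' measurableSet_Ioc).1 h] with τ hτ _
  by_cases hmem : τ ∈ Ioc 0 T
  · simp only [indicator_of_mem hmem, hτ hmem]
  · simp only [indicator_of_notMem hmem]

theorem norm_primitive_le {f : ℝ → H} (hf : IntegrableOn f (Ioc 0 T)) (t : ℝ) :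
    ‖primitive T f t‖ ≤ ∫ τ in Ioc 0 T, ‖f τ‖ := by
  have hi := (integrable_indicator_iff measurableSet_Ioc).2 hf
  calc ‖primitive T f t‖ ≤ |∫ τ in (0 : ℝ)..t, ‖(Ioc 0 T).indicator f τ‖| :=
        intervalIntegral.norm_integral_le_abs_integral_norm
    _ ≤ ∫ τ in uIoc 0 t, ‖(Ioc 0 T).indicator f τ‖ := by
        rw [intervalIntegral.abs_integral_eq_abs_integral_uIoc,
          abs_of_nonneg (integral_nonneg fun _ => norm_nonneg _)]
    _ ≤ ∫ τ, ‖(Ioc 0 T).indicator f τ‖ :=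
        setIntegral_le_integral hi.norm (Eventually.of_forall fun _ => norm_nonneg _)
    _ = ∫ τ in Ioc 0 T, ‖f τ‖ := by
        simp only [norm_indicator_eq_indicator_norm]
        exact integral_indicator measurableSet_Ioc

theorem memLp_primitive (hκ : 0 ≤ κ) {f : ℝ → H} (hf : MemLp f 2 (expMeasure κ T)) :
    MemLp (primitive T f) 2 (expMeasure κ T) :=
  MemLp.of_bound (continuous_primitive (integrableOn_of_expMeasure hκ hf)).aestronglyMeasurable _
    (Eventually.of_forall (norm_primitive_le (integrableOn_of_expMeasure hκ hf)))

theorem primitive_add {f g : ℝ → H} (hf : IntegrableOn f (Ioc 0 T)) (hg : IntegrableOn g (Ioc 0 T))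
    (t : ℝ) : primitive T (f + g) t = primitive T f t + primitive T g t := by
  simp only [primitive, indicator_add']
  exact intervalIntegral.integral_add
    ((integrable_indicator_iff measurableSet_Ioc).2 hf).intervalIntegrable
    ((integrable_indicator_iff measurableSet_Ioc).2 hg).intervalIntegrable

theorem primitive_smul (c : ℝ) (f : ℝ → H) (t : ℝ) :
    primitive T (c • f) t = c • primitive T f t := by
  simp only [primitive]
  rw [← intervalIntegral.integral_smul]
  congr 1
  ext τ
  by_cases h : τ ∈ Ioc 0 T <;> simp [h]

theorem exists_norm_primitive_le (hκ : 0 ≤ κ) : ∃ C : ℝ, 0 ≤ C ∧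
    ∀ f : Lp H 2 (expMeasure κ T), ∀ t, ‖primitive T f t‖ ≤ C * ‖f‖ := by
  set c : ENNReal := ENNReal.ofReal (Real.exp (2 * κ * T)) ^ (1 / (2 : ENNReal).toReal) *
    (volume.restrict (Ioc 0 T)) univ ^ (1 / (1 : ENNReal).toReal - 1 / (2 : ENNReal).toReal) with hc
  have hcfin : c ≠ ⊤ := by
    refine ENNReal.mul_ne_top ?_ ?_
    · exact ENNReal.rpow_ne_top_of_nonneg (by positivity) ENNReal.ofReal_ne_top
    · exact ENNReal.rpow_ne_top_of_nonneg (by norm_num) (measure_ne_top _ _)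
  refine ⟨c.toReal, ENNReal.toReal_nonneg, fun f t => ?_⟩
  have hf := Lp.memLp f
  have hi := integrableOn_of_expMeasure hκ hf
  refine (norm_primitive_le hi t).trans ?_
  rw [integral_norm_eq_lintegral_enorm hi.1, ← eLpNorm_one_eq_lintegral_enorm, Lp.norm_def,
    ← ENNReal.toReal_mul]
  refine ENNReal.toReal_mono (ENNReal.mul_ne_top hcfin hf.2.ne) ?_
  calc eLpNorm f 1 (volume.restrict (Ioc 0 T))
      ≤ eLpNorm f 2 (volume.restrict (Ioc 0 T)) * (volume.restrict (Ioc 0 T)) univ ^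
        (1 / (1 : ENNReal).toReal - 1 / (2 : ENNReal).toReal) :=
        eLpNorm_le_eLpNorm_mul_rpow_measure_univ (by norm_num) hi.1
    _ ≤ (ENNReal.ofReal (Real.exp (2 * κ * T)) ^ (1 / (2 : ENNReal).toReal) *
          eLpNorm f 2 (expMeasure κ T)) * (volume.restrict (Ioc 0 T)) univ ^
        (1 / (1 : ENNReal).toReal - 1 / (2 : ENNReal).toReal) := by
        gcongr
        refine (eLpNorm_mono_measure _ (restrict_le_smul_expMeasure hκ)).trans ?_
        rw [eLpNorm_smul_measure_of_ne_top (by norm_num)]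
        simp
    _ = c * eLpNorm f 2 (expMeasure κ T) := by rw [hc]; ring

/-- The Volterra operator `f ↦ ∫₀ᵗ f` on the weighted Bochner space. -/
noncomputable def volterra (H : Type*) [NormedAddCommGroup H] [InnerProductSpace ℝ H]
    [CompleteSpace H] (T : ℝ) {κ : ℝ} (hκ : 0 ≤ κ) :
    Lp H 2 (expMeasure κ T) →L[ℝ] Lp H 2 (expMeasure κ T) :=
  LinearMap.mkContinuousOfExistsBound
    { toFun := fun f => (memLp_primitive hκ (Lp.memLp f)).toLp
      map_add' := fun f g => by
        rw [← MemLp.toLp_add]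
        refine MemLp.toLp_congr _ _ (Eventually.of_forall fun t => ?_)
        have h := absolutelyContinuous_expMeasure (T := T) hκ (Lp.coeFn_add f g)
        rw [primitive_congr h, primitive_add (integrableOn_of_expMeasure hκ (Lp.memLp f))
          (integrableOn_of_expMeasure hκ (Lp.memLp g))]
        rfl
      map_smul' := fun c f => by
        rw [RingHom.id_apply, ← MemLp.toLp_const_smul]
        refine MemLp.toLp_congr _ _ (Eventually.of_forall fun t => ?_)
        have h := absolutelyContinuous_expMeasure (T := T) hκ (Lp.coeFn_smul c f)
        rw [primitive_congr h, primitive_smul]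
        rfl }
    (by
      obtain ⟨C, hC0, hC⟩ := exists_norm_primitive_le (H := H) (T := T) hκ
      refine ⟨measureUnivNNReal (expMeasure κ T) ^ ((2 : ENNReal).toReal)⁻¹ * C, fun f => ?_⟩
      refine (Lp.norm_le_of_ae_bound (mul_nonneg hC0 (norm_nonneg f)) ?_).trans
        (le_of_eq (mul_assoc _ _ _).symm)
      filter_upwards [(memLp_primitive hκ (Lp.memLp f)).coeFn_toLp] with t ht
      simp only [LinearMap.coe_mk, AddHom.coe_mk]
      rw [ht]
      exact hC f t)

variable [CompleteSpace H]

theorem coeFn_volterra (hκ : 0 ≤ κ) (f : Lp H 2 (expMeasure κ T)) :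
    volterra H T hκ f =ᵐ[expMeasure κ T] primitive T f :=
  (memLp_primitive hκ (Lp.memLp f)).coeFn_toLp

theorem volterra_compLpL (hκ : 0 ≤ κ) {H' : Type*} [NormedAddCommGroup H']
    [InnerProductSpace ℝ H'] [CompleteSpace H'] (L : H →L[ℝ] H') (f : Lp H 2 (expMeasure κ T)) :
    volterra H' T hκ (L.compLpL 2 _ f) = L.compLpL 2 _ (volterra H T hκ f) := by
  refine Lp.ext ?_
  filter_upwards [coeFn_volterra hκ (L.compLpL 2 _ f), coeFn_volterra hκ f,
    L.coeFn_compLpL (volterra H T hκ f)] with t h1 h2 h3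
  rw [h1, h3, h2, primitive_congr (absolutelyContinuous_expMeasure (T := T) hκ (L.coeFn_compLpL f)),
    primitive, primitive]
  have hi := ((integrable_indicator_iff measurableSet_Ioc).2
    (integrableOn_of_expMeasure hκ (Lp.memLp f))).intervalIntegrable (a := 0) (b := t)
  rw [← L.intervalIntegral_comp_comm hi]
  congr 1
  ext τ
  by_cases h : τ ∈ Ioc 0 T <;> simp [h]

/-- The exponential weight makes the Volterra operator strongly accretive. For continuous `f` with
primitive `p` this is the identity
`d/dt (½ e^{-2κt} ‖p‖²) = e^{-2κt} ⟪p, f⟫ - κ e^{-2κt} ‖p‖²`, integrated over `(0, T)`. -/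
theorem volterra_accretive (hκ : 0 ≤ κ) (hT : 0 ≤ T) (f : Lp H 2 (expMeasure κ T)) :
    κ * ‖volterra H T hκ f‖ ^ 2 ≤ ⟪volterra H T hκ f, f⟫ := by
  refine DenseRange.induction_on
    (p := fun f => κ * ‖volterra H T hκ f‖ ^ 2 ≤ ⟪volterra H T hκ f, f⟫)
    (BoundedContinuousFunction.toLp_denseRange (p := 2) H (expMeasure κ T) ℝ (by norm_num)) f
    (isClosed_le (by fun_prop) (by fun_prop)) fun φ => ?_
  set F := BoundedContinuousFunction.toLp (E := H) 2 (expMeasure κ T) ℝ φ with hF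
  have hFφ : F =ᵐ[expMeasure κ T] φ := BoundedContinuousFunction.coeFn_toLp _ _ _ _
  set p : ℝ → H := fun t => ∫ τ in (0 : ℝ)..t, φ τ with hp
  have hpd : ∀ t, HasDerivAt p (φ t) t := fun t =>
    (φ.continuous.integral_hasStrictDerivAt 0 t).hasDerivAt
  have hpc : Continuous p := continuous_iff_continuousAt.2 fun t => (hpd t).continuousAt
  have hvol : volterra H T hκ F =ᵐ[expMeasure κ T] p := by
    filter_upwards [coeFn_volterra hκ F,
      expMeasure_absolutelyContinuous (ae_restrict_mem measurableSet_Ioc)] with t h1 h2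
    rw [h1, primitive_congr (absolutelyContinuous_expMeasure (T := T) hκ hFφ),
      primitive_eq ⟨h2.1.le, h2.2⟩]
  have e1 : ⟪volterra H T hκ F, F⟫ = ∫ t in (0 : ℝ)..T, Real.exp (-(2 * κ) * t) * ⟪p t, φ t⟫ := by
    rw [L2.inner_def, intervalIntegral.integral_of_le hT, ← integral_expMeasure]
    refine integral_congr_ae ?_
    filter_upwards [hvol, hFφ] with t h1 h2
    rw [h1, h2]
  have e2 : ‖volterra H T hκ F‖ ^ 2 = ∫ t in (0 : ℝ)..T, Real.exp (-(2 * κ) * t) * ⟪p t, p t⟫ := by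
    rw [← real_inner_self_eq_norm_sq, L2.inner_def, intervalIntegral.integral_of_le hT,
      ← integral_expMeasure]
    refine integral_congr_ae ?_
    filter_upwards [hvol] with t h1
    rw [h1]
  have hφc := φ.continuous
  have c1 : Continuous fun t => Real.exp (-(2 * κ) * t) * ⟪p t, φ t⟫ := by fun_prop
  have c2 : Continuous fun t => Real.exp (-(2 * κ) * t) * ⟪p t, p t⟫ := by fun_prop
  have hd : ∀ t, HasDerivAt (fun t => Real.exp (-(2 * κ) * t) * ⟪p t, p t⟫ / 2)
      (Real.exp (-(2 * κ) * t) * ⟪p t, φ t⟫ - κ * (Real.exp (-(2 * κ) * t) * ⟪p t, p t⟫)) t := by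
    intro t
    have h1 : HasDerivAt (fun t => Real.exp (-(2 * κ) * t))
        (Real.exp (-(2 * κ) * t) * (-(2 * κ) * 1)) t :=
      ((hasDerivAt_id t).const_mul (-(2 * κ))).exp
    have h2 := (h1.mul ((hpd t).inner ℝ (hpd t))).div_const 2
    refine h2.congr_deriv ?_
    rw [real_inner_comm (p t) (φ t)]
    ring
  have hftc := intervalIntegral.integral_eq_sub_of_hasDerivAt (a := 0) (b := T)
    (fun t _ => hd t) ((c1.sub (c2.const_mul κ)).intervalIntegrable _ _)
  rw [intervalIntegral.integral_sub (c1.intervalIntegrable _ _)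
    ((c2.const_mul κ).intervalIntegrable _ _), intervalIntegral.integral_const_mul] at hftc
  have hp0 : p 0 = 0 := intervalIntegral.integral_same
  have hpT : 0 ≤ Real.exp (-(2 * κ) * T) * ⟪p T, p T⟫ / 2 := by
    have := real_inner_self_nonneg (x := p T)
    positivity
  change κ * ‖volterra H T hκ F‖ ^ 2 ≤ ⟪volterra H T hκ F, F⟫
  rw [e1, e2]
  rw [hp0, inner_zero_left, mul_zero, zero_div, sub_zero] at hftc
  linarith

end

/-! ### Abstract evolution equations with a Lipschitz nonlinearity -/

section

variable {T : ℝ} {H V : Type*} [NormedAddCommGroup H] [InnerProductSpace ℝ H] [CompleteSpace H]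
  [NormedAddCommGroup V] [InnerProductSpace ℝ V] [CompleteSpace V]

theorem inner_compLpL {μ : Measure ℝ} (ι : V →L[ℝ] H) (v : Lp V 2 μ) (x : Lp H 2 μ) :
    ⟪ι.compLpL 2 μ v, x⟫ = ⟪v, (ContinuousLinearMap.adjoint ι).compLpL 2 μ x⟫ := by
  rw [L2.inner_def, L2.inner_def]
  refine integral_congr_ae ?_
  filter_upwards [ι.coeFn_compLpL v, (ContinuousLinearMap.adjoint ι).coeFn_compLpL x] with t h1 h2
  rw [h1, h2, ContinuousLinearMap.adjoint_inner_right]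

theorem volterra_nonneg {κ : ℝ} (hκ : 0 ≤ κ) (hT : 0 ≤ T) (f : Lp H 2 (expMeasure κ T)) :
    0 ≤ ⟪volterra H T hκ f, f⟫ :=
  (mul_nonneg hκ (sq_nonneg _)).trans (volterra_accretive hκ hT f)

/-- The linear problem `w = ι ι* y`, `w = ∫₀ᵗ (G - y)`: here `y` plays the role of the elliptic
operator applied to `w`, the inner product of `V` being its form. -/
theorem exists_linear_evolution {κ : ℝ} (hκ : 0 ≤ κ) (hT : 0 ≤ T) (ι : V →L[ℝ] H)
    (G : Lp H 2 (expMeasure κ T)) :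
    ∃ y : Lp H 2 (expMeasure κ T),
      ι.compLpL 2 _ ((ContinuousLinearMap.adjoint ι).compLpL 2 _ y) = volterra H T hκ (G - y) := by
  obtain ⟨y, hy⟩ := exists_add_eq_of_commute (ι.compLpL 2 (expMeasure κ T))
    ((ContinuousLinearMap.adjoint ι).compLpL 2 (expMeasure κ T)) (inner_compLpL ι)
    (volterra H T hκ) (volterra V T hκ) (volterra_nonneg hκ hT) (volterra_nonneg hκ hT)
    (fun v => volterra_compLpL hκ ι v)
    (fun x => volterra_compLpL hκ _ x) G
  exact ⟨y, by rw [map_sub]; exact eq_sub_of_add_eq hy⟩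

/-- With the weight `e^{-2κt}`, solutions of the linear problem depend on the datum with Lipschitz
constant `1/κ`. -/
theorem norm_linear_evolution_le {κ : ℝ} (hκ : 0 ≤ κ) (hT : 0 ≤ T) (ι : V →L[ℝ] H)
    {G y w : Lp H 2 (expMeasure κ T)} (hw : w = volterra H T hκ (G - y))
    (hwy : w = ι.compLpL 2 _ ((ContinuousLinearMap.adjoint ι).compLpL 2 _ y)) :
    κ * ‖w‖ ≤ ‖G‖ := by
  have h1 := volterra_accretive hκ hT (G - y)
  rw [← hw, inner_sub_right] at h1
  have h2 : 0 ≤ ⟪w, y⟫ := by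
    rw [hwy, inner_compLpL]
    exact real_inner_self_nonneg
  have h3 := real_inner_le_norm w G
  rcases (norm_nonneg w).eq_or_lt with h | h
  · rw [← h, mul_zero]
    exact norm_nonneg G
  · have : ‖w‖ * (κ * ‖w‖) ≤ ‖w‖ * ‖G‖ := by nlinarith
    exact le_of_mul_le_mul_left this h

theorem memLp_superposition {H : Type*} [NormedAddCommGroup H] {κ L : ℝ} {N : ℝ → H → H}
    (hN : Continuous (Function.uncurry N)) (hL : ∀ t h h', ‖N t h - N t h'‖ ≤ L * ‖h - h'‖)
    {f : ℝ → H} (hf : MemLp f 2 (expMeasure κ T)) :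
    MemLp (fun t => N t (f t)) 2 (expMeasure κ T) := by
  have h0 : MemLp (fun t => N t 0) 2 (expMeasure κ T) := by
    have hc : Continuous fun t => N t 0 := hN.comp (continuous_id.prodMk continuous_const)
    obtain ⟨C, hC⟩ := isCompact_Icc.exists_bound_of_continuousOn (hc.continuousOn (s := Icc 0 T))
    refine MemLp.of_bound hc.aestronglyMeasurable C ?_
    filter_upwards [expMeasure_absolutelyContinuous (ae_restrict_mem measurableSet_Ioc)] with t ht
    exact hC t ⟨ht.1.le, ht.2⟩
  have hm : AEStronglyMeasurable (fun t => N t (f t)) (expMeasure κ T) :=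
    hN.comp_aestronglyMeasurable (aestronglyMeasurable_id.prodMk hf.1)
  have h1 : MemLp (fun t => N t (f t) - N t 0) 2 (expMeasure κ T) :=
    hf.of_le_mul (c := L) (hm.sub h0.1) (Eventually.of_forall fun t => by simpa using hL t (f t) 0)
  exact (h1.add h0).ae_eq (Eventually.of_forall fun t => by simp)

/-- Weak solvability of `w' + A w + N(t, w) = 0`, `w(0) = 0`, where `A` is the operator on `H`
whose form is the inner product of `V` and `N` is Lipschitz in `w`. In the space weighted by
`e^{-2κt}` with `κ` above the Lipschitz constant, the solution map of the linear problem composed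
with `N` is a contraction. -/
theorem exists_nonlinear_evolution {L : ℝ} (hL0 : 0 ≤ L) (hT : 0 ≤ T) (ι : V →L[ℝ] H)
    {N : ℝ → H → H} (hN : Continuous (Function.uncurry N))
    (hL : ∀ t h h', ‖N t h - N t h'‖ ≤ L * ‖h - h'‖) :
    ∃ (w : ℝ → H) (W : ℝ → V), Continuous w ∧ w 0 = 0 ∧
      MemLp W 2 (volume.restrict (Ioc 0 T)) ∧ (∀ᵐ t ∂(volume.restrict (Ioc 0 T)), w t = ι (W t)) ∧
      ∀ φ : V, ∀ t ∈ Icc 0 T,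
        ⟪w t, ι φ⟫ + ∫ τ in (0 : ℝ)..t, (⟪W τ, φ⟫ + ⟪N τ (w τ), ι φ⟫) = 0 := by
  have hκ : 0 ≤ L + 1 := by linarith
  set S : Lp H 2 (expMeasure (L + 1) T) → Lp H 2 (expMeasure (L + 1) T) :=
    fun f => -(memLp_superposition hN hL (Lp.memLp f)).toLp with hS
  choose y hy using exists_linear_evolution (T := T) hκ hT ι
  set Φ : Lp H 2 (expMeasure (L + 1) T) → Lp H 2 (expMeasure (L + 1) T) :=
    fun f => volterra H T hκ (S f - y (S f)) with hΦ
  have hSlip : ∀ f g, ‖S f - S g‖ ≤ L * ‖f - g‖ := by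
    intro f g
    refine Lp.norm_le_mul_norm_of_ae_le_mul ?_
    simp only [hS]
    rw [neg_sub_neg, ← MemLp.toLp_sub]
    filter_upwards [MemLp.coeFn_toLp ((memLp_superposition hN hL (Lp.memLp g)).sub
      (memLp_superposition hN hL (Lp.memLp f))), Lp.coeFn_sub f g] with t h1 h2
    rw [h1, h2]
    simp only [Pi.sub_apply]
    rw [norm_sub_rev]
    exact hL _ _ _
  have hΦlip : ∀ f g, (L + 1) * ‖Φ f - Φ g‖ ≤ L * ‖f - g‖ := by
    intro f g
    refine (norm_linear_evolution_le hκ hT ι (G := S f - S g) (y := y (S f) - y (S g)) ?_ ?_).trans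
      (hSlip f g)
    · simp only [hΦ, ← map_sub]
      congr 1
      abel
    · simp only [hΦ, ← hy, map_sub]
  have hL1 : 0 < L + 1 := by linarith
  have hcontr : ContractingWith (Real.toNNReal (L / (L + 1))) Φ := by
    refine ⟨?_, LipschitzWith.of_dist_le_mul fun f g => ?_⟩
    · rw [Real.toNNReal_lt_one, div_lt_one hL1]
      linarith
    · rw [dist_eq_norm, dist_eq_norm, Real.coe_toNNReal _ (by positivity), div_mul_eq_mul_div,
        le_div_iff₀ hL1, mul_comm]
      exact hΦlip f g
  obtain ⟨f, hf, -⟩ := hcontr.exists_fixedPoint (0 : Lp H 2 (expMeasure (L + 1) T))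
    (edist_ne_top _ _)
  have hfix : Φ f = f := hf
  set G := S f with hG
  set z := y G with hz
  have hint := integrableOn_of_expMeasure hκ (Lp.memLp (G - z))
  have hac := absolutelyContinuous_expMeasure (T := T) hκ
  set ιa := ContinuousLinearMap.adjoint ι with hιa
  set w : ℝ → H := primitive T (G - z : Lp H 2 (expMeasure (L + 1) T)) with hw
  set W : Lp V 2 (expMeasure (L + 1) T) := ιa.compLpL 2 _ z with hW
  have hwf : ∀ᵐ t ∂(volume.restrict (Ioc 0 T)), f t = w t := by
    have := hac (coeFn_volterra hκ (G - z))
    filter_upwards [this] with t ht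
    refine Eq.trans ?_ ht
    change f t = (Φ f) t
    rw [hfix]
  have hGz : ∀ᵐ t ∂(volume.restrict (Ioc 0 T)),
      (G - z : Lp H 2 (expMeasure (L + 1) T)) t = -N t (w t) - z t := by
    filter_upwards [hwf, hac (Lp.coeFn_sub G z),
      hac (Lp.coeFn_neg (memLp_superposition hN hL (Lp.memLp f)).toLp),
      hac (memLp_superposition hN hL (Lp.memLp f)).coeFn_toLp] with t h1 h2 h3 h4
    rw [h2, Pi.sub_apply, hG, hS]
    simp only
    rw [h3, Pi.neg_apply, h4, h1]
  refine ⟨w, W, continuous_primitive hint, primitive_zero _,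
    MemLp.restrict_of_expMeasure hκ (Lp.memLp W), ?_, fun φ t ht => ?_⟩
  · filter_upwards [hwf, hac (ι.coeFn_compLpL W)] with t h1 h2
    rw [← h2, hW, hy, ← h1]
    change f t = (Φ f) t
    rw [hfix]
  · have hi : IntervalIntegrable (G - z : Lp H 2 (expMeasure (L + 1) T)) volume 0 t := by
      rw [intervalIntegrable_iff, uIoc_of_le ht.1]
      exact hint.mono_set (Ioc_subset_Ioc_right ht.2)
    have h1 : ⟪w t, ι φ⟫ =
        ∫ τ in (0 : ℝ)..t, ⟪(G - z : Lp H 2 (expMeasure (L + 1) T)) τ, ι φ⟫ := by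
      rw [hw, primitive_eq ht]
      have := ((innerSL ℝ) (ι φ)).intervalIntegral_comp_comm hi
      simp only [innerSL_apply_apply] at this
      rw [real_inner_comm, ← this]
      congr 1
      ext τ
      exact real_inner_comm _ _
    rw [h1]
    have h2 : ∫ τ in (0 : ℝ)..t, (⟪W τ, φ⟫ + ⟪N τ (w τ), ι φ⟫) =
        ∫ τ in (0 : ℝ)..t, -⟪(G - z : Lp H 2 (expMeasure (L + 1) T)) τ, ι φ⟫ := by
      refine intervalIntegral.integral_congr_ae ?_
      rw [← ae_restrict_iff' measurableSet_uIoc, uIoc_of_le ht.1]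
      refine ae_mono (Measure.restrict_mono (Ioc_subset_Ioc_right ht.2) le_rfl) ?_
      filter_upwards [hGz, hac (ιa.coeFn_compLpL z)] with τ h3 h4
      rw [h3, hW, h4, hιa, ContinuousLinearMap.adjoint_inner_left, inner_sub_left, inner_neg_left]
      ring
    rw [h2, intervalIntegral.integral_neg, add_neg_cancel]

end

/-! ### Jointly measurable representatives of curves in `L²` -/

/-- A continuous curve in `L²` has a representative that is jointly measurable and represents the
curve at every time: round the time down to finer and finer grids, chosen so that the roundings
converge geometrically, hence almost everywhere, at every time. -/
theorem exists_jointly_measurable_representative {X : Type*} [MeasurableSpace X] {μ : Measure X}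
    {w : ℝ → Lp ℝ 2 μ} (hw : Continuous w) (T : ℝ) :
    ∃ U : X → ℝ → ℝ, Measurable (fun p : X × ℝ => U p.1 p.2) ∧
      ∀ t ∈ Icc 0 T, (fun x => U x t) =ᵐ[μ] w t := by
  have huc := isCompact_Icc.uniformContinuousOn_of_continuous (hw.continuousOn (s := Icc 0 T))
  rw [Metric.uniformContinuousOn_iff] at huc
  have hpow : ∀ k : ℕ, (0 : ℝ) < (1 / 2) ^ k := fun k => by positivity
  choose δ hδ0 hδ using fun k : ℕ => huc _ (hpow k)
  set grid : ℕ → ℝ → ℝ := fun k t => δ k * ⌊t / δ k⌋ with hgrid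
  have hclose : ∀ k, ∀ t ∈ Icc 0 T, dist (w (grid k t)) (w t) < (1 / 2) ^ k := by
    intro k t ht
    have h1 : grid k t ≤ t := by
      have := Int.floor_le (t / δ k)
      rw [le_div_iff₀ (hδ0 k), mul_comm] at this
      exact this
    have h2 : t < grid k t + δ k := by
      have := Int.lt_floor_add_one (t / δ k)
      rw [div_lt_iff₀ (hδ0 k)] at this
      simp only [hgrid]
      linarith
    have h3 : 0 ≤ grid k t := mul_nonneg (hδ0 k).le
      (by exact_mod_cast Int.floor_nonneg.2 (div_nonneg ht.1 (hδ0 k).le))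
    refine hδ k _ ⟨h3, h1.trans ht.2⟩ _ ht ?_
    rw [Real.dist_eq, abs_lt]
    constructor <;> linarith
  have hmeas : ∀ k, Measurable fun p : X × ℝ => w (grid k p.2) p.1 := by
    intro k
    have h1 : Measurable fun p : X × ℤ => w (δ k * (p.2 : ℝ)) p.1 :=
      measurable_from_prod_countable_left fun j => (Lp.stronglyMeasurable (w (δ k * j))).measurable
    exact h1.comp (measurable_fst.prodMk
      (Int.measurable_floor.comp (measurable_snd.div_const _)))
  refine ⟨fun x t => limUnder atTop fun k => w (grid k t) x,
    (StronglyMeasurable.limUnder fun k => (hmeas k).stronglyMeasurable).measurable, fun t ht => ?_⟩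
  have hconv : ∀ᵐ x ∂μ, ∃ l, Tendsto (fun k => w (grid k t) x) atTop (𝓝 l) := by
    refine Lp.ae_tendsto_of_cauchy_eLpNorm (p := 2)
      (fun k => Lp.aestronglyMeasurable (w (grid k t)))
      (by norm_num) (B := fun N => ENNReal.ofReal (3 * (1 / 2) ^ N))
      (summable_geometric_two.mul_left 3).tsum_ofReal_ne_top fun N k l hk hl => ?_
    rw [← Lp.edist_def, Lp.edist_dist, ENNReal.ofReal_lt_ofReal_iff (by positivity)]
    have h1 : ((1 : ℝ) / 2) ^ k ≤ (1 / 2) ^ N := pow_le_pow_of_le_one (by norm_num) (by norm_num) hk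
    have h2 : ((1 : ℝ) / 2) ^ l ≤ (1 / 2) ^ N := pow_le_pow_of_le_one (by norm_num) (by norm_num) hl
    have h3 := dist_triangle_right (w (grid k t)) (w (grid l t)) (w t)
    have h4 := hclose k t ht
    have h5 := hclose l t ht
    have h6 := hpow N
    linarith
  have hlim : Tendsto (fun k => w (grid k t)) atTop (𝓝 (w t)) := by
    rw [tendsto_iff_dist_tendsto_zero]
    exact squeeze_zero (fun _ => dist_nonneg) (fun k => (hclose k t ht).le)
      (tendsto_pow_atTop_nhds_zero_of_lt_one (by norm_num) (by norm_num))
  obtain ⟨ns, hns, hsub⟩ := (tendstoInMeasure_of_tendsto_Lp hlim).exists_seq_tendsto_ae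
  filter_upwards [hconv, hsub] with x hx hx'
  exact tendsto_nhds_unique ((tendsto_nhds_limUnder hx).comp hns.tendsto_atTop) hx'

/-! ### The energy space -/

section

variable {n : ℕ} {s : ℝ} {Ω : Set (EuclideanSpace ℝ (Fin n))}

theorem diffQuot_add (u v : EuclideanSpace ℝ (Fin n) → ℝ)
    (p : EuclideanSpace ℝ (Fin n) × EuclideanSpace ℝ (Fin n)) :
    diffQuot s (u + v) p = diffQuot s u p + diffQuot s v p := by
  simp only [diffQuot, Pi.add_apply]
  ring

theorem diffQuot_smul (c : ℝ) (u : EuclideanSpace ℝ (Fin n) → ℝ)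
    (p : EuclideanSpace ℝ (Fin n) × EuclideanSpace ℝ (Fin n)) :
    diffQuot s (c • u) p = c * diffQuot s u p := by
  simp only [diffQuot, Pi.smul_apply, smul_eq_mul]
  ring

/-- The energy space of functions vanishing outside `Ω`, as the graph of the normalized difference
quotient in `L²(ℝⁿ) × L²(ℝⁿ × ℝⁿ)`. Its inner product is `⟪u, v⟫ + ⟨(-Δ)^s u, v⟩`. -/
noncomputable def energySpace (s : ℝ) (Ω : Set (EuclideanSpace ℝ (Fin n))) :
    Submodule ℝ (WithLp 2 (Lp ℝ 2 (volume : Measure (EuclideanSpace ℝ (Fin n))) ×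
      Lp ℝ 2 (volume : Measure (EuclideanSpace ℝ (Fin n) × EuclideanSpace ℝ (Fin n))))) where
  carrier := {v | (∀ᵐ x, x ∉ Ω → v.fst x = 0) ∧
    v.snd =ᵐ[volume] fun p => √(fracConst n s / 2) * diffQuot s v.fst p}
  zero_mem' := by
    refine ⟨?_, ?_⟩
    · filter_upwards [Lp.coeFn_zero ℝ 2 (volume : Measure (EuclideanSpace ℝ (Fin n)))] with x hx _
      exact hx
    · filter_upwards [Lp.coeFn_zero ℝ 2
          (volume : Measure (EuclideanSpace ℝ (Fin n) × EuclideanSpace ℝ (Fin n))),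
        diffQuot_congr_ae (s := s)
          (Lp.coeFn_zero ℝ 2 (volume : Measure (EuclideanSpace ℝ (Fin n))))] with p h1 h2
      refine h1.trans ?_
      change 0 = √(fracConst n s / 2) *
        diffQuot s (0 : Lp ℝ 2 (volume : Measure (EuclideanSpace ℝ (Fin n)))) p
      rw [h2]
      simp [diffQuot]
  add_mem' := by
    rintro u v ⟨hu1, hu2⟩ ⟨hv1, hv2⟩
    refine ⟨?_, ?_⟩
    · filter_upwards [hu1, hv1, Lp.coeFn_add u.fst v.fst] with x h1 h2 h3 hx
      rw [WithLp.add_fst, h3, Pi.add_apply, h1 hx, h2 hx, add_zero]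
    · filter_upwards [hu2, hv2, Lp.coeFn_add u.snd v.snd,
        diffQuot_congr_ae (s := s) (Lp.coeFn_add u.fst v.fst)] with p h1 h2 h3 h4
      rw [WithLp.add_snd, WithLp.add_fst, h3, Pi.add_apply, h1, h2, h4, diffQuot_add, mul_add]
  smul_mem' := by
    rintro c u ⟨hu1, hu2⟩
    refine ⟨?_, ?_⟩
    · filter_upwards [hu1, Lp.coeFn_smul c u.fst] with x h1 h3 hx
      rw [WithLp.smul_fst, h3, Pi.smul_apply, h1 hx, smul_zero]
    · filter_upwards [hu2, Lp.coeFn_smul c u.snd,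
        diffQuot_congr_ae (s := s) (Lp.coeFn_smul c u.fst)] with p h1 h3 h4
      rw [WithLp.smul_snd, WithLp.smul_fst, h3, Pi.smul_apply, h1, h4, diffQuot_smul, smul_eq_mul]
      ring

theorem exists_subseq_ae_tendsto {X : Type*} [MeasurableSpace X] {μ : Measure X}
    {f : ℕ → Lp ℝ 2 μ} {g : Lp ℝ 2 μ} (h : Tendsto f atTop (𝓝 g)) :
    ∃ ns : ℕ → ℕ, StrictMono ns ∧ ∀ᵐ x ∂μ, Tendsto (fun i => f (ns i) x) atTop (𝓝 (g x)) :=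
  (tendstoInMeasure_of_tendsto_Lp h).exists_seq_tendsto_ae

theorem isClosed_energySpace : IsClosed (energySpace s Ω : Set (WithLp 2
    (Lp ℝ 2 (volume : Measure (EuclideanSpace ℝ (Fin n))) ×
      Lp ℝ 2 (volume : Measure (EuclideanSpace ℝ (Fin n) × EuclideanSpace ℝ (Fin n)))))) := by
  refine IsSeqClosed.isClosed fun u v hu huv => ?_
  have h1 : Tendsto (fun k => (u k).fst) atTop (𝓝 v.fst) :=
    ((WithLp.fstL 2 ℝ _ _).continuous.tendsto v).comp huv
  obtain ⟨ns, hns, hf⟩ := exists_subseq_ae_tendsto h1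
  have h2 : Tendsto (fun k => (u (ns k)).snd) atTop (𝓝 v.snd) :=
    (((WithLp.sndL 2 ℝ _ _).continuous.tendsto v).comp huv).comp hns.tendsto_atTop
  obtain ⟨ms, hms, hs⟩ := exists_subseq_ae_tendsto h2
  refine ⟨?_, ?_⟩
  · have h3 := ae_all_iff.2 fun k => (hu (ns k)).1
    filter_upwards [hf, h3] with x h4 h5 hx
    refine tendsto_nhds_unique h4 ?_
    simp only [h5 _ hx]
    exact tendsto_const_nhds
  · have h3 := ae_all_iff.2 fun k => (hu (ns (ms k))).2
    have hf1 := (Measure.quasiMeasurePreserving_fst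
      (μ := (volume : Measure (EuclideanSpace ℝ (Fin n))))
      (ν := (volume : Measure (EuclideanSpace ℝ (Fin n))))).ae hf
    have hf2 := (Measure.quasiMeasurePreserving_snd
      (μ := (volume : Measure (EuclideanSpace ℝ (Fin n))))
      (ν := (volume : Measure (EuclideanSpace ℝ (Fin n))))).ae hf
    filter_upwards [hf1, hf2, hs, h3] with p h4 h5 h6 h7
    refine tendsto_nhds_unique h6 ?_
    simp only [h7]
    exact ((((h4.comp hms.tendsto_atTop).sub (h5.comp hms.tendsto_atTop)).div_const _).const_mul _)

instance : CompleteSpace (energySpace s Ω) := isClosed_energySpace.completeSpace_coe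

/-- The embedding of the energy space into `L²(ℝⁿ)`. -/
noncomputable def energyEmbedding (s : ℝ) (Ω : Set (EuclideanSpace ℝ (Fin n))) :
    energySpace s Ω →L[ℝ] Lp ℝ 2 (volume : Measure (EuclideanSpace ℝ (Fin n))) :=
  (WithLp.fstL 2 ℝ _ _).comp (energySpace s Ω).subtypeL

theorem energyEmbedding_apply (v : energySpace s Ω) : energyEmbedding s Ω v = v.1.fst := rfl

theorem exists_energySpace_of_isTestFunction {v : EuclideanSpace ℝ (Fin n) → ℝ}
    (hv : IsTestFunction s Ω v) (hΩ : MeasurableSet Ω) :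
    ∃ φ : energySpace s Ω, φ.1.fst =ᵐ[volume] v := by
  have h1 := hv.memLp.coeFn_toLp
  have h2 := (hv.memLp_diffQuot.const_mul (√(fracConst n s / 2))).coeFn_toLp
  refine ⟨⟨WithLp.toLp 2 (hv.memLp.toLp v,
    (hv.memLp_diffQuot.const_mul (√(fracConst n s / 2))).toLp), ?_, ?_⟩, h1⟩
  · filter_upwards [h1, hv.ae_eq_zero hΩ] with x h3 h4 hx
    exact h3.trans (h4 hx)
  · filter_upwards [h2, diffQuot_congr_ae (s := s) h1] with p h3 h4
    refine h3.trans ?_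
    change _ = √(fracConst n s / 2) * diffQuot s (hv.memLp.toLp v) p
    rw [h4]

theorem inner_energySpace (hs : 0 < s) (hs' : s < 1) (w φ : energySpace s Ω) :
    inner ℝ w φ = inner ℝ w.1.fst φ.1.fst + fracForm s w.1.fst φ.1.fst := by
  have hc : 0 ≤ fracConst n s / 2 := (half_pos (fracConst_pos hs hs')).le
  rw [Submodule.coe_inner, WithLp.prod_inner_apply]
  congr 1
  rw [L2.inner_def, fracForm_eq_integral_diffQuot, ← integral_const_mul]
  refine integral_congr_ae ?_
  filter_upwards [w.2.2, φ.2.2] with p h1 h2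
  change inner ℝ (w.1.snd p) (φ.1.snd p) = _
  rw [h1, h2]
  simp only [RCLike.inner_apply, conj_trivial]
  linear_combination (diffQuot s w.1.fst p * diffQuot s φ.1.fst p) * Real.mul_self_sqrt hc

end

/-! ### Weak solutions for bounded Lipschitz reaction terms -/

section

variable {n : ℕ} {s T : ℝ} {Ω : Set (EuclideanSpace ℝ (Fin n))}

theorem fracForm_comm (u v : EuclideanSpace ℝ (Fin n) → ℝ) : fracForm s u v = fracForm s v u := by
  simp only [fracForm, mul_comm]

/-- The superposition operator of a bounded function with support of finite measure that is
Lipschitz in the last variable and uniformly continuous in time. -/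
theorem exists_superposition {X : Type*} [MeasurableSpace X] {μ : Measure X} {S : Set X}
    (hS : MeasurableSet S) (hSv : μ S ≠ ⊤) {b : X → ℝ → ℝ → ℝ} {T M L : ℝ} (hT : 0 ≤ T) (hL : 0 ≤ L)
    (hmeas : Measurable fun p : X × ℝ × ℝ => b p.1 p.2.1 p.2.2)
    (hM : ∀ x t z, |b x t z| ≤ M) (hsupp : ∀ x ∉ S, ∀ t z, b x t z = 0)
    (hlip : ∀ x t z z', |b x t z - b x t z'| ≤ L * |z - z'|)
    (hunif : ∀ ε > 0, ∃ δ > 0, ∀ x, ∀ t ∈ Icc 0 T, ∀ t' ∈ Icc 0 T, |t - t'| < δ →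
      ∀ z, |b x t z - b x t' z| ≤ ε) :
    ∃ N : ℝ → Lp ℝ 2 μ → Lp ℝ 2 μ, Continuous (Function.uncurry N) ∧
      (∀ t h h', ‖N t h - N t h'‖ ≤ L * ‖h - h'‖) ∧
      ∀ t ∈ Icc 0 T, ∀ h, N t h =ᵐ[μ] fun x => b x t (h x) := by
  have hproj : ∀ t : ℝ, max 0 (min t T) ∈ Icc 0 T := fun t =>
    ⟨le_max_left _ _, max_le hT (min_le_right _ _)⟩
  have hmem : ∀ (t : ℝ) (h : Lp ℝ 2 μ), MemLp (fun x => b x (max 0 (min t T)) (h x)) 2 μ := by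
    intro t h
    refine (memLp_indicator_const 2 hS M (Or.inr hSv)).mono
      (hmeas.comp (measurable_id.prodMk (measurable_const.prodMk
        (Lp.stronglyMeasurable h).measurable))).aestronglyMeasurable
      (Eventually.of_forall fun x => ?_)
    by_cases hx : x ∈ S
    · rw [indicator_of_mem hx, Real.norm_eq_abs, Real.norm_eq_abs]
      exact (hM _ _ _).trans (le_abs_self M)
    · rw [hsupp x hx, norm_zero]
      exact norm_nonneg _
  have hlip' : ∀ t h h', ‖(hmem t h).toLp - (hmem t h').toLp‖ ≤ L * ‖h - h'‖ := by
    intro t h h'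
    refine Lp.norm_le_mul_norm_of_ae_le_mul ?_
    filter_upwards [Lp.coeFn_sub (hmem t h).toLp (hmem t h').toLp, Lp.coeFn_sub h h',
      (hmem t h).coeFn_toLp, (hmem t h').coeFn_toLp] with x h1 h2 h3 h4
    rw [h1, h2, Pi.sub_apply, Pi.sub_apply, h3, h4]
    exact hlip _ _ _ _
  refine ⟨fun t h => (hmem t h).toLp, ?_, hlip', fun t ht h => ?_⟩
  · refine continuous_prod_of_continuous_lipschitzWith' _ ⟨L, hL⟩ (fun t => ?_) fun h => ?_
    · refine LipschitzWith.of_dist_le_mul fun h h' => ?_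
      rw [dist_eq_norm, dist_eq_norm]
      exact hlip' t h h'
    · rw [Metric.continuous_iff]
      intro t ε hε
      set C := ‖indicatorConstLp 2 hS hSv (1 : ℝ)‖ with hC
      have hC0 : 0 ≤ C := norm_nonneg _
      obtain ⟨δ, hδ, hb⟩ := hunif (ε / (C + 1)) (by positivity)
      refine ⟨δ, hδ, fun t' htt => ?_⟩
      have hclose : |max 0 (min t' T) - max 0 (min t T)| < δ := by
        refine lt_of_le_of_lt ?_ htt
        rw [Real.dist_eq]
        have h1 := abs_max_sub_max_le_abs (min t' T) (min t T) 0
        have h2 := abs_inf_sub_inf_le_abs t' t T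
        rw [max_comm 0, max_comm 0]
        exact h1.trans h2
      have hle : ‖(hmem t' h).toLp - (hmem t h).toLp‖ ≤
          ε / (C + 1) * ‖indicatorConstLp 2 hS hSv (1 : ℝ)‖ := by
        refine Lp.norm_le_mul_norm_of_ae_le_mul ?_
        filter_upwards [Lp.coeFn_sub (hmem t' h).toLp (hmem t h).toLp,
          (hmem t' h).coeFn_toLp, (hmem t h).coeFn_toLp,
          indicatorConstLp_coeFn (p := 2) (hs := hS) (hμs := hSv) (c := (1 : ℝ))] with x h1 h2 h3 h4
        rw [h1, Pi.sub_apply, h2, h3, h4]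
        by_cases hx : x ∈ S
        · rw [indicator_of_mem hx, norm_one, mul_one]
          exact hb x _ (hproj t') _ (hproj t) hclose _
        · rw [hsupp x hx, hsupp x hx, indicator_of_notMem hx]
          simp
      change dist (hmem t' h).toLp (hmem t h).toLp < ε
      rw [dist_eq_norm]
      refine hle.trans_lt ?_
      rw [← hC, div_mul_eq_mul_div, div_lt_iff₀ (by positivity)]
      nlinarith
  · have ht' : max 0 (min t T) = t := by rw [min_eq_left ht.2, max_eq_right ht.1]
    refine (hmem t h).coeFn_toLp.trans (Eventually.of_forall fun x => ?_)
    simp only [ht']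

theorem inner_eq_setIntegral {X : Type*} [MeasurableSpace X] {μ : Measure X} {S : Set X}
    (h : Lp ℝ 2 μ) {φ : Lp ℝ 2 μ} {v : X → ℝ} (hφ : φ =ᵐ[μ] v) (hv : ∀ᵐ x ∂μ, x ∉ S → v x = 0) :
    inner ℝ h φ = ∫ x in S, h x * v x ∂μ := by
  rw [L2.inner_def, setIntegral_eq_integral_of_ae_compl_eq_zero]
  · refine integral_congr_ae ?_
    filter_upwards [hφ] with x hx
    rw [hx, real_inner_comm]
    rfl
  · filter_upwards [hv] with x hx hxS
    rw [hx hxS, mul_zero]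

set_option maxHeartbeats 400000 in
/-- The abstract evolution problem in the energy space. Its solution is a curve in `L²`, of which a
jointly measurable representative vanishing outside `Ω` is taken. -/
theorem exists_weakSol_of_bounded_lipschitz (hs : 0 < s) (hs' : s < 1) (hT : 0 ≤ T)
    (hΩ : MeasurableSet Ω) (hΩv : volume Ω ≠ ⊤)
    {b : EuclideanSpace ℝ (Fin n) → ℝ → ℝ → ℝ} {M L : ℝ} (hL : 0 ≤ L)
    (hmeas : Measurable fun p : EuclideanSpace ℝ (Fin n) × ℝ × ℝ => b p.1 p.2.1 p.2.2)
    (hM : ∀ x t z, |b x t z| ≤ M) (hsupp : ∀ x ∉ Ω, ∀ t z, b x t z = 0)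
    (hlip : ∀ x t z z', |b x t z - b x t z'| ≤ L * |z - z'|)
    (hunif : ∀ ε > 0, ∃ δ > 0, ∀ x, ∀ t ∈ Icc 0 T, ∀ t' ∈ Icc 0 T, |t - t'| < δ →
      ∀ z, |b x t z - b x t' z| ≤ ε) :
    ∃ u : EuclideanSpace ℝ (Fin n) → ℝ → ℝ, WeakSol s T Ω u (fun x t => b x t (u x t)) ∧
      (∀ x ∉ Ω, ∀ t, u x t = 0) ∧ ∀ᵐ x, u x 0 = 0 := by
  obtain ⟨N, hNc, hNl, hN⟩ := exists_superposition hΩ hΩv hT hL hmeas hM hsupp hlip hunif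
  have hNc' : Continuous (Function.uncurry fun (t : ℝ)
      (h : Lp ℝ 2 (volume : Measure (EuclideanSpace ℝ (Fin n)))) => N t h - h) :=
    hNc.sub continuous_snd
  -- The energy space carries the form `⟪u, v⟫ + ⟨(-Δ)^s u, v⟩`, so `⟪u, v⟫` is subtracted here.
  obtain ⟨w, W, hwc, hw0, hW, hwW, heq⟩ := exists_nonlinear_evolution (L := L + 1) (by linarith) hT
    (energyEmbedding s Ω) hNc' (fun t h h' => by
      have h1 := hNl t h h'
      have h2 := norm_sub_le (N t h - N t h') (h - h')
      have h3 : N t h - h - (N t h' - h') = N t h - N t h' - (h - h') := by abel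
      rw [h3]
      linarith)
  have hIoo : volume.restrict (Ioo (0 : ℝ) T) = volume.restrict (Ioc 0 T) :=
    Measure.restrict_congr_set Ioo_ae_eq_Ioc
  rw [← hIoo] at hW hwW
  obtain ⟨U, hUm, hU⟩ := exists_jointly_measurable_representative hwc T
  obtain ⟨u, hu⟩ : ∃ u : EuclideanSpace ℝ (Fin n) → ℝ → ℝ,
      ∀ x t, u x t = Ω.indicator (fun y => U y t) x := ⟨_, fun _ _ => rfl⟩
  have h0 : (0 : ℝ) ∈ Icc 0 T := ⟨le_rfl, hT⟩
  have huw : ∀ t ∈ Icc 0 T, (fun x => u x t) =ᵐ[volume.restrict Ω] w t := by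
    intro t ht
    filter_upwards [ae_restrict_of_ae (hU t ht), ae_restrict_mem hΩ] with x hx hxΩ
    rw [hu, indicator_of_mem hxΩ, hx]
  have huoff : ∀ x ∉ Ω, ∀ t, u x t = 0 := fun x hx t => by
    rw [hu, indicator_of_notMem hx]
  have huW : ∀ᵐ τ ∂(volume.restrict (Ioo 0 T)), (fun x => u x τ) =ᵐ[volume] (W τ).1.fst := by
    filter_upwards [hwW, ae_restrict_mem measurableSet_Ioo] with τ h1 h2
    have h3 := (ae_restrict_iff' hΩ).1 (huw τ ⟨h2.1.le, h2.2.le⟩)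
    have h6 : w τ = (W τ).1.fst := h1.trans (energyEmbedding_apply _)
    have h7 := (W τ).2.1
    rw [← h6] at h7 ⊢
    filter_upwards [h3, h7] with x h4 h5
    by_cases hx : x ∈ Ω
    · exact h4 hx
    · exact (huoff x hx τ).trans (h5 hx).symm
  have hum : Measurable fun p : EuclideanSpace ℝ (Fin n) × ℝ => u p.1 p.2 := by
    have : (fun p : EuclideanSpace ℝ (Fin n) × ℝ => u p.1 p.2) =
        (Prod.fst ⁻¹' Ω).indicator fun p => U p.1 p.2 := by
      ext p
      by_cases hp : p.1 ∈ Ω <;> simp [hu, hp]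
    rw [this]
    exact hUm.indicator (measurable_fst hΩ)
  have hum' : Measurable fun p : ℝ × EuclideanSpace ℝ (Fin n) => u p.2 p.1 :=
    hum.comp measurable_swap
  have hc := half_pos (fracConst_pos (n := n) hs hs')
  have hslice : ∀ᵐ τ ∂(volume.restrict (Ioo 0 T)),
      (W τ).1.snd =ᵐ[volume] fun p => √(fracConst n s / 2) * diffQuot s (fun x => u x τ) p := by
    filter_upwards [huW] with τ h1
    filter_upwards [(W τ).2.2, diffQuot_congr_ae (s := s) h1] with p h2 h3
    rw [h2, h3]
  have hsq : ∀ᵐ τ ∂(volume.restrict (Ioo 0 T)),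
      (fun p => diffQuot s (fun x => u x τ) p ^ 2) =ᵐ[volume]
        fun p => (fracConst n s / 2)⁻¹ * (W τ).1.snd p ^ 2 := by
    filter_upwards [hslice] with τ h1
    filter_upwards [h1] with p h2
    rw [h2, mul_pow, Real.sq_sqrt hc.le, inv_mul_cancel_left₀ hc.ne']
  have henergy : MemLp (fun p : ℝ × EuclideanSpace ℝ (Fin n) × EuclideanSpace ℝ (Fin n) =>
      diffQuot s (fun x => u x p.1) p.2) 2 ((volume.restrict (Ioo 0 T)).prod volume) := by
    have hm := aestronglyMeasurable_diffQuot_time (s := s) (T := T) hum'.aestronglyMeasurable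
    rw [memLp_two_iff_integrable_sq hm]
    refine (integrable_prod_iff (hm.pow 2)).2 ⟨?_, ?_⟩
    · filter_upwards [hsq] with τ h1
      exact ((Lp.memLp (W τ).1.snd).integrable_sq.const_mul _).congr h1.symm
    · have h2 : MemLp (fun τ => (W τ).1.snd) 2 (volume.restrict (Ioo 0 T)) :=
        ((WithLp.sndL 2 ℝ _ _).comp (energySpace s Ω).subtypeL).comp_memLp' hW
      refine ((h2.norm.integrable_sq).const_mul (fracConst n s / 2)⁻¹).congr ?_
      filter_upwards [hsq] with τ h1
      rw [← real_inner_self_eq_norm_sq, L2.inner_def, ← integral_const_mul]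
      refine integral_congr_ae ?_
      filter_upwards [h1] with p h3
      rw [Pi.pow_apply, Real.norm_of_nonneg (sq_nonneg _), h3]
      simp [sq]
  have : IsFiniteMeasure (volume.restrict Ω) := ⟨by simpa using hΩv.lt_top⟩
  have hmemΩ : ∀ t ∈ Icc 0 T, MemLp (fun x => u x t) 2 (volume.restrict Ω) := fun t ht =>
    ((Lp.memLp (w t)).restrict Ω).ae_eq (huw t ht).symm
  have hu0 : ∀ᵐ x, u x 0 = 0 := by
    have h1 := hU 0 h0
    rw [hw0] at h1
    filter_upwards [h1,
      Lp.coeFn_zero ℝ 2 (volume : Measure (EuclideanSpace ℝ (Fin n)))] with x h2 h3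
    by_cases hx : x ∈ Ω
    · rw [hu, indicator_of_mem hx]
      exact h2.trans h3
    · exact huoff x hx 0
  refine ⟨u, ⟨hum'.aestronglyMeasurable, henergy.mono_measure
    (Measure.prod_mono le_rfl Measure.restrict_le_self), hmemΩ,
    fun t₀ ht₀ => ?_, ?_, ?_⟩, huoff, hu0⟩
  · have h1 : Tendsto (fun t => edist (w t) (w t₀)) (𝓝[Icc 0 T] t₀) (𝓝 0) := by
      have h2 : Continuous fun t => edist (w t) (w t₀) := by fun_prop
      have h3 := h2.tendsto t₀
      rw [edist_self] at h3
      exact h3.mono_left nhdsWithin_le_nhds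
    refine tendsto_of_tendsto_of_tendsto_of_le_of_le' tendsto_const_nhds h1
      (Eventually.of_forall fun _ => zero_le) ?_
    filter_upwards [self_mem_nhdsWithin] with t ht
    rw [Lp.edist_def]
    refine le_trans (le_of_eq (eLpNorm_congr_ae ?_))
      (eLpNorm_mono_measure _ Measure.restrict_le_self)
    filter_upwards [huw t ht, huw t₀ ht₀] with x h2 h3
    rw [h2, h3, Pi.sub_apply]
  · refine MemLp.of_bound (Measurable.aestronglyMeasurable ?_) M (Eventually.of_forall fun p =>
      hM _ _ _)
    exact hmeas.comp (measurable_snd.prodMk (measurable_fst.prodMk hum'))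
  · intro v hv t ht
    obtain ⟨φ, hφ⟩ := exists_energySpace_of_isTestFunction hv hΩ
    have hin : ∀ h : Lp ℝ 2 (volume : Measure (EuclideanSpace ℝ (Fin n))),
        inner ℝ h φ.1.fst = ∫ x in Ω, h x * v x := fun h =>
      inner_eq_setIntegral h hφ (hv.ae_eq_zero hΩ)
    have hzero : ∫ x in Ω, u x 0 * v x = 0 := by
      refine integral_eq_zero_of_ae ?_
      filter_upwards [ae_restrict_of_ae hu0] with x hx
      simp [hx]
    have hfin : ∫ x in Ω, u x t * v x = inner ℝ (w t) (energyEmbedding s Ω φ) := by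
      rw [energyEmbedding_apply, hin]
      refine integral_congr_ae ?_
      filter_upwards [huw t ht] with x hx
      rw [hx]
    rw [hzero, hfin]
    refine Eq.trans (congrArg _ ?_) (heq φ t ht)
    refine intervalIntegral.integral_congr_ae (ae_uIoc_of_ae_Ioo ?_ ht)
    filter_upwards [huW, hwW, ae_restrict_mem measurableSet_Ioo] with τ h1 h2 h3
    have hτ : τ ∈ Icc 0 T := ⟨h3.1.le, h3.2.le⟩
    have h2' : w τ = (W τ).1.fst := h2
    have h4 : ∫ x in Ω, N τ (w τ) x * v x = ∫ x in Ω, b x τ (u x τ) * v x := by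
      refine integral_congr_ae ?_
      rw [← h2'] at h1
      filter_upwards [ae_restrict_of_ae (hN τ hτ (w τ)), ae_restrict_of_ae h1] with x h5 h6
      rw [h5, h6]
    have h5 : fracForm s (W τ).1.fst φ.1.fst = fracForm s (fun x => u x τ) v := by
      rw [← fracForm_congr_ae h1, fracForm_comm, fracForm_congr_ae hφ, fracForm_comm]
    have h6 : inner ℝ (W τ) φ = inner ℝ (w τ) φ.1.fst + fracForm s (W τ).1.fst φ.1.fst := by
      rw [h2', inner_energySpace hs hs']
    have h7 : inner ℝ (N τ (w τ) - w τ) φ.1.fst =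
        (∫ x in Ω, N τ (w τ) x * v x) - inner ℝ (w τ) φ.1.fst := by
      rw [inner_sub_left, hin (N τ (w τ))]
    rw [energyEmbedding_apply, h6, h7, h4, h5]
    ring

end

/-! ### Exterior data supported away from the domain -/

section

variable {n : ℕ} {s T d C : ℝ} {Ω K : Set (EuclideanSpace ℝ (Fin n))}
  {g : EuclideanSpace ℝ (Fin n) → ℝ → ℝ}

/-- `g` is continuous, bounded by `C`, and uniformly continuous in time, and its spatial support is
contained in a set `K` of finite measure at distance at least `d > 0` from `Ω`. -/
structure IsSeparatedDatum (Ω K : Set (EuclideanSpace ℝ (Fin n))) (d C : ℝ)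
    (g : EuclideanSpace ℝ (Fin n) → ℝ → ℝ) : Prop where
  continuous : Continuous fun q : EuclideanSpace ℝ (Fin n) × ℝ => g q.1 q.2
  measurableSet : MeasurableSet K
  volume_ne_top : volume K ≠ ⊤
  pos : 0 < d
  le_norm_sub : ∀ x ∈ Ω, ∀ y ∈ K, d ≤ ‖x - y‖
  abs_le : ∀ y t, |g y t| ≤ C
  eq_zero : ∀ y ∉ K, ∀ t, g y t = 0
  modulus : ∀ ε > 0, ∃ δ > 0, ∀ t t', |t - t'| < δ → ∀ y, |g y t - g y t'| ≤ ε

/-- Smooth data with compact support in the exterior cylinder are separated from `Ω`. -/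
theorem exists_isSeparatedDatum (hg : Continuous fun q : EuclideanSpace ℝ (Fin n) × ℝ => g q.1 q.2)
    (hgc : HasCompactSupport fun q : EuclideanSpace ℝ (Fin n) × ℝ => g q.1 q.2) {I : Set ℝ}
    (hgs : tsupport (fun q : EuclideanSpace ℝ (Fin n) × ℝ => g q.1 q.2) ⊆ exterior Ω ×ˢ I) :
    ∃ K d C, IsSeparatedDatum Ω K d C g := by
  have hK : IsCompact (Prod.fst '' tsupport fun q : EuclideanSpace ℝ (Fin n) × ℝ => g q.1 q.2) :=
    hgc.image continuous_fst
  have hdisj : Disjoint (Prod.fst '' tsupport fun q : EuclideanSpace ℝ (Fin n) × ℝ => g q.1 q.2)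
      (closure Ω) := by
    rw [Set.disjoint_left]
    rintro _ ⟨q, hq, rfl⟩ hq'
    exact (hgs hq).1 hq'
  obtain ⟨r, hr, hsep⟩ := Metric.exists_pos_forall_lt_edist hK isClosed_closure hdisj
  obtain ⟨C, hC⟩ := hgc.exists_bound_of_continuous hg
  have huc := hg.uniformContinuous_of_tendsto_cocompact hgc.is_zero_at_infty
  refine ⟨_, r, C, hg, hK.measurableSet, hK.measure_lt_top.ne, by exact_mod_cast hr,
    fun x hx y hy => ?_, fun y t => hC (y, t), fun y hy t => ?_, fun ε hε => ?_⟩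
  · have h := (hsep y hy x (subset_closure hx)).le
    rw [edist_comm, edist_nndist, ENNReal.coe_le_coe] at h
    rw [← dist_eq_norm]
    exact_mod_cast h
  · by_contra h
    exact hy ⟨(y, t), subset_tsupport _ h, rfl⟩
  · obtain ⟨δ, hδ, h⟩ := Metric.uniformContinuous_iff.1 huc ε hε
    refine ⟨δ, hδ, fun t t' htt y => (h (a := (y, t)) (b := (y, t')) ?_).le⟩
    rw [Prod.dist_eq, dist_self, max_eq_right dist_nonneg]
    exact htt

/-- The function `-(-Δ)^s g` in `Ω`, for `g` supported in `K`: the integral is not singular, as `K`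
has positive distance from `Ω`. -/
noncomputable def exteriorSource (s : ℝ) (K : Set (EuclideanSpace ℝ (Fin n)))
    (g : EuclideanSpace ℝ (Fin n) → ℝ → ℝ) (x : EuclideanSpace ℝ (Fin n)) (t : ℝ) : ℝ :=
  fracConst n s * ∫ y in K, g y t / ‖x - y‖ ^ ((n : ℝ) + 2 * s)

namespace IsSeparatedDatum

theorem bound_nonneg (hg : IsSeparatedDatum Ω K d C g) : 0 ≤ C :=
  (abs_nonneg _).trans (hg.abs_le 0 0)

theorem eq_zero_of_mem (hg : IsSeparatedDatum Ω K d C g) {x : EuclideanSpace ℝ (Fin n)} (hx : x ∈ Ω)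
    (t : ℝ) : g x t = 0 := by
  refine hg.eq_zero x (fun hxK => ?_) t
  have := hg.le_norm_sub x hx x hxK
  rw [sub_self, norm_zero] at this
  exact absurd this (not_le.2 hg.pos)

theorem abs_div_rpow_le (hg : IsSeparatedDatum Ω K d C g) {r A : ℝ} (hr : 0 ≤ r)
    {x y : EuclideanSpace ℝ (Fin n)} (hx : x ∈ Ω) (hy : y ∈ K) {c : ℝ} (hc : |c| ≤ A) :
    |c / ‖x - y‖ ^ r| ≤ A / d ^ r := by
  rw [abs_div, abs_of_nonneg (Real.rpow_nonneg (norm_nonneg (x - y)) r)]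
  exact div_le_div₀ ((abs_nonneg _).trans hc) hc (Real.rpow_pos_of_pos hg.pos _)
    (Real.rpow_le_rpow hg.pos.le (hg.le_norm_sub x hx y hy) hr)

theorem abs_integral_le (hg : IsSeparatedDatum Ω K d C g) {r A : ℝ} (hr : 0 ≤ r)
    {x : EuclideanSpace ℝ (Fin n)} (hx : x ∈ Ω) {h : EuclideanSpace ℝ (Fin n) → ℝ}
    (hA : ∀ y, |h y| ≤ A) :
    |∫ y in K, h y / ‖x - y‖ ^ r| ≤ A / d ^ r * volume.real K :=
  norm_setIntegral_le_of_norm_le_const (f := fun y => h y / ‖x - y‖ ^ r) hg.volume_ne_top.lt_top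
    fun y hy => hg.abs_div_rpow_le hr hx hy (hA y)

theorem measurable_slice (hg : IsSeparatedDatum Ω K d C g) (t : ℝ) : Measurable fun y => g y t :=
  (hg.continuous.comp
    (by fun_prop : Continuous fun y : EuclideanSpace ℝ (Fin n) => (y, t))).measurable

theorem integrableOn_div_rpow (hg : IsSeparatedDatum Ω K d C g) {r : ℝ} (hr : 0 ≤ r)
    {x : EuclideanSpace ℝ (Fin n)} (hx : x ∈ Ω) (t : ℝ) :
    IntegrableOn (fun y => g y t / ‖x - y‖ ^ r) K := by
  refine Measure.integrableOn_of_bounded (M := C / d ^ r) hg.volume_ne_top ?_ ?_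
  · exact ((hg.measurable_slice t).div
      (((measurable_const.sub measurable_id).norm).pow_const r)).aestronglyMeasurable
  · filter_upwards [ae_restrict_mem hg.measurableSet] with y hy
    exact hg.abs_div_rpow_le hr hx hy (hg.abs_le y t)

theorem abs_exteriorSource_le (hg : IsSeparatedDatum Ω K d C g) (hs : 0 < s) (hs' : s < 1)
    {x : EuclideanSpace ℝ (Fin n)} (hx : x ∈ Ω) (t : ℝ) :
    |exteriorSource s K g x t| ≤
      fracConst n s * (C / d ^ ((n : ℝ) + 2 * s) * volume.real K) := by
  rw [exteriorSource, abs_mul, abs_of_pos (fracConst_pos hs hs')]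
  exact mul_le_mul_of_nonneg_left (hg.abs_integral_le (by positivity) hx fun y => hg.abs_le y t)
    (fracConst_pos hs hs').le

theorem exteriorSource_modulus (hg : IsSeparatedDatum Ω K d C g) (hs : 0 < s) (hs' : s < 1)
    {ε : ℝ} (hε : 0 < ε) : ∃ δ > 0, ∀ x ∈ Ω, ∀ t t', |t - t'| < δ →
      |exteriorSource s K g x t - exteriorSource s K g x t'| ≤ ε := by
  have hc := fracConst_pos (n := n) hs hs'
  have hd := Real.rpow_pos_of_pos hg.pos ((n : ℝ) + 2 * s)
  set P := fracConst n s * (1 / d ^ ((n : ℝ) + 2 * s) * volume.real K) with hP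
  have hP0 : 0 ≤ P := by positivity
  obtain ⟨δ, hδ, h⟩ := hg.modulus (ε / (P + 1)) (by positivity)
  refine ⟨δ, hδ, fun x hx t t' htt => ?_⟩
  have hr : (0 : ℝ) ≤ (n : ℝ) + 2 * s := by positivity
  rw [exteriorSource, exteriorSource, ← mul_sub,
    ← integral_sub (hg.integrableOn_div_rpow hr hx t) (hg.integrableOn_div_rpow hr hx t'),
    abs_mul, abs_of_pos hc]
  simp only [← sub_div]
  refine (mul_le_mul_of_nonneg_left (hg.abs_integral_le hr hx fun y => h t t' htt y) hc.le).trans ?_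
  calc fracConst n s * (ε / (P + 1) / d ^ ((n : ℝ) + 2 * s) * volume.real K)
      = ε * (P / (P + 1)) := by rw [hP]; ring
    _ ≤ ε * 1 := by
        gcongr
        rw [div_le_one (by positivity)]
        linarith
    _ = ε := mul_one ε

theorem measurable_exteriorSource (hg : IsSeparatedDatum Ω K d C g) :
    Measurable fun q : EuclideanSpace ℝ (Fin n) × ℝ => exteriorSource s K g q.1 q.2 := by
  have h : StronglyMeasurable fun p : (EuclideanSpace ℝ (Fin n) × ℝ) × EuclideanSpace ℝ (Fin n) =>
      g p.2 p.1.2 / ‖p.1.1 - p.2‖ ^ ((n : ℝ) + 2 * s) := by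
    have h1 : Measurable fun p : (EuclideanSpace ℝ (Fin n) × ℝ) × EuclideanSpace ℝ (Fin n) =>
        g p.2 p.1.2 :=
      hg.continuous.measurable.comp (measurable_snd.prodMk measurable_fst.snd)
    exact (h1.div ((measurable_norm_sub_rpow _).comp
      (measurable_fst.fst.prodMk measurable_snd))).stronglyMeasurable
  exact (h.integral_prod_right' (ν := volume.restrict K)).measurable.const_mul _

theorem integrable_kernel (hg : IsSeparatedDatum Ω K d C g) (hs : 0 < s) (hΩ : MeasurableSet Ω)
    (hΩv : volume Ω ≠ ⊤) {v : EuclideanSpace ℝ (Fin n) → ℝ} (hv : IsTestFunction s Ω v) (t : ℝ) :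
    Integrable (fun p : EuclideanSpace ℝ (Fin n) × EuclideanSpace ℝ (Fin n) =>
      v p.1 * (g p.2 t / ‖p.1 - p.2‖ ^ ((n : ℝ) + 2 * s))) := by
  have hfin : IsFiniteMeasure (volume.restrict Ω) := ⟨by simpa using hΩv.lt_top⟩
  have hvΩ : IntegrableOn v Ω volume := (hv.memLp.restrict Ω).integrable (by norm_num)
  have hvi : Integrable v := hvΩ.integrable_of_ae_notMem_eq_zero (hv.ae_eq_zero hΩ)
  have hKi : Integrable (K.indicator fun _ : EuclideanSpace ℝ (Fin n) =>
      C / d ^ ((n : ℝ) + 2 * s)) :=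
    (integrableOn_const hg.volume_ne_top).integrable_indicator hg.measurableSet
  refine (hvi.mul_prod hKi).mono ?_ ?_
  · exact hvi.1.comp_fst.mul (((hg.measurable_slice t).comp measurable_snd).div
      (measurable_norm_sub_rpow _)).aestronglyMeasurable
  · filter_upwards [(Measure.quasiMeasurePreserving_fst
      (μ := (volume : Measure (EuclideanSpace ℝ (Fin n))))
      (ν := (volume : Measure (EuclideanSpace ℝ (Fin n))))).ae (hv.ae_eq_zero hΩ)] with p hp
    by_cases hx : p.1 ∈ Ω
    · rw [norm_mul, norm_mul]
      refine mul_le_mul_of_nonneg_left ?_ (norm_nonneg _)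
      by_cases hy : p.2 ∈ K
      · rw [indicator_of_mem hy]
        exact (hg.abs_div_rpow_le (by positivity) hx hy (hg.abs_le _ t)).trans (le_abs_self _)
      · rw [hg.eq_zero _ hy, zero_div, norm_zero]
        exact norm_nonneg _
    · rw [hp hx, zero_mul, norm_zero]
      exact norm_nonneg _

theorem fracForm_eq (hg : IsSeparatedDatum Ω K d C g) (hs : 0 < s) (hΩ : MeasurableSet Ω)
    (hΩv : volume Ω ≠ ⊤) {v : EuclideanSpace ℝ (Fin n) → ℝ} (hv : IsTestFunction s Ω v) (t : ℝ) :
    fracForm s (fun x => g x t) v = -∫ x in Ω, exteriorSource s K g x t * v x := by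
  have hk := hg.integrable_kernel hs hΩ hΩv hv t
  set k : EuclideanSpace ℝ (Fin n) × EuclideanSpace ℝ (Fin n) → ℝ := fun p =>
    v p.1 * (g p.2 t / ‖p.1 - p.2‖ ^ ((n : ℝ) + 2 * s)) with hk_def
  have hgv : ∀ᵐ x, g x t * v x = 0 := by
    filter_upwards [hv.ae_eq_zero hΩ] with x hx
    by_cases hxΩ : x ∈ Ω
    · rw [hg.eq_zero_of_mem hxΩ, zero_mul]
    · rw [hx hxΩ, mul_zero]
  have hswap : ∫ p, k (Prod.swap p) = ∫ p, k p := by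
    rw [Measure.volume_eq_prod]
    exact integral_prod_swap k
  have hki : Integrable fun p => k (Prod.swap p) := by
    rw [Measure.volume_eq_prod] at hk ⊢
    exact hk.swap
  have h1 : ∫ p : EuclideanSpace ℝ (Fin n) × EuclideanSpace ℝ (Fin n),
      (g p.1 t - g p.2 t) * (v p.1 - v p.2) / ‖p.1 - p.2‖ ^ ((n : ℝ) + 2 * s) =
      ∫ p, -(k p + k (Prod.swap p)) := by
    refine integral_congr_ae ?_
    filter_upwards [(Measure.quasiMeasurePreserving_fst
      (μ := (volume : Measure (EuclideanSpace ℝ (Fin n))))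
      (ν := (volume : Measure (EuclideanSpace ℝ (Fin n))))).ae hgv,
      (Measure.quasiMeasurePreserving_snd
      (μ := (volume : Measure (EuclideanSpace ℝ (Fin n))))
      (ν := (volume : Measure (EuclideanSpace ℝ (Fin n))))).ae hgv] with p h1 h2
    have h3 : (g p.1 t - g p.2 t) * (v p.1 - v p.2) = -(v p.1 * g p.2 t) - v p.2 * g p.1 t := by
      linear_combination h1 + h2
    simp only [hk_def, Prod.fst_swap, Prod.snd_swap, norm_sub_rev p.2 p.1, h3]
    ring
  have h2 : ∫ p, k p = ∫ x in Ω, v x * ∫ y in K, g y t / ‖x - y‖ ^ ((n : ℝ) + 2 * s) := by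
    rw [Measure.volume_eq_prod] at hk ⊢
    rw [integral_prod _ hk, setIntegral_eq_integral_of_ae_compl_eq_zero]
    · refine integral_congr_ae (Eventually.of_forall fun x => ?_)
      simp only [hk_def, integral_const_mul]
      rw [setIntegral_eq_integral_of_forall_compl_eq_zero]
      intro y hy
      rw [hg.eq_zero y hy, zero_div]
    · filter_upwards [hv.ae_eq_zero hΩ] with x hx hxΩ
      rw [hx hxΩ, zero_mul]
  rw [fracForm, h1, integral_neg, integral_add hk hki, hswap, h2]
  have h3 : ∫ x in Ω, exteriorSource s K g x t * v x =
      fracConst n s * ∫ x in Ω, v x * ∫ y in K, g y t / ‖x - y‖ ^ ((n : ℝ) + 2 * s) := by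
    rw [← integral_const_mul]
    refine integral_congr_ae (Eventually.of_forall fun x => ?_)
    simp only [exteriorSource]
    ring
  rw [h3]
  ring

theorem memLp_diffQuot (hg : IsSeparatedDatum Ω K d C g) (hs : 0 < s) (hΩ : MeasurableSet Ω)
    (hΩv : volume Ω ≠ ⊤) :
    MemLp (fun p : ℝ × EuclideanSpace ℝ (Fin n) × EuclideanSpace ℝ (Fin n) =>
      diffQuot s (fun x => g x p.1) p.2) 2
      ((volume.restrict (Ioo 0 T)).prod (volume.restrict (nearPairs Ω))) := by
  set S : Set (EuclideanSpace ℝ (Fin n) × EuclideanSpace ℝ (Fin n)) := Ω ×ˢ K ∪ K ×ˢ Ω with hS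
  have hSm : MeasurableSet S := (hΩ.prod hg.measurableSet).union (hg.measurableSet.prod hΩ)
  have hSv : volume S ≠ ⊤ := by
    refine (measure_union_lt_top ?_ ?_).ne <;>
    · rw [Measure.volume_eq_prod, Measure.prod_prod]
      exact ENNReal.mul_lt_top (by first | exact hΩv.lt_top | exact hg.volume_ne_top.lt_top)
        (by first | exact hΩv.lt_top | exact hg.volume_ne_top.lt_top)
  have hdom : MemLp ((univ ×ˢ S).indicator fun _ : ℝ × EuclideanSpace ℝ (Fin n) ×
      EuclideanSpace ℝ (Fin n) => C / d ^ (((n : ℝ) + 2 * s) / 2)) 2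
      ((volume.restrict (Ioo 0 T)).prod (volume.restrict (nearPairs Ω))) := by
    refine memLp_indicator_const 2 (MeasurableSet.univ.prod hSm) _ (Or.inr ?_)
    rw [Measure.prod_prod]
    refine (ENNReal.mul_lt_top (measure_lt_top _ _) ?_).ne
    exact (Measure.restrict_le_self _).trans_lt hSv.lt_top
  refine hdom.mono ?_ ?_
  · have hm : AEStronglyMeasurable (fun p : ℝ × EuclideanSpace ℝ (Fin n) => g p.2 p.1)
        ((volume.restrict (Ioo 0 T)).prod volume) :=
      (hg.continuous.comp continuous_swap).aestronglyMeasurable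
    exact (aestronglyMeasurable_diffQuot_time hm).mono_measure
      (Measure.prod_mono le_rfl Measure.restrict_le_self)
  · filter_upwards [Measure.quasiMeasurePreserving_snd.ae
      (ae_restrict_mem (measurableSet_nearPairs hΩ))] with p hp
    have hr : 0 ≤ ((n : ℝ) + 2 * s) / 2 := by positivity
    by_cases hpS : p.2 ∈ S
    · rw [indicator_of_mem (show p ∈ univ ×ˢ S from ⟨mem_univ _, hpS⟩)]
      refine le_trans ?_ (le_abs_self _)
      rcases hpS with ⟨h1, h2⟩ | ⟨h1, h2⟩
      · rw [diffQuot, hg.eq_zero_of_mem h1, zero_sub]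
        exact hg.abs_div_rpow_le hr h1 h2 (by rw [abs_neg]; exact hg.abs_le _ _)
      · rw [diffQuot, hg.eq_zero_of_mem h2, sub_zero, norm_sub_rev p.2.1]
        exact hg.abs_div_rpow_le hr h2 h1 (hg.abs_le _ _)
    · have hzero : g p.2.1 p.1 - g p.2.2 p.1 = 0 := by
        simp only [nearPairs, mem_compl_iff, mem_prod, not_and_or, not_not] at hp
        rcases hp with h1 | h1
        · rw [hg.eq_zero_of_mem h1, hg.eq_zero _ fun h2 => hpS (Or.inl ⟨h1, h2⟩), sub_zero]
        · rw [hg.eq_zero_of_mem h1, hg.eq_zero _ fun h2 => hpS (Or.inr ⟨h2, h1⟩), sub_zero]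
      rw [diffQuot, hzero, zero_div, norm_zero]
      exact norm_nonneg _

/-- As `g` vanishes in `Ω`, it solves the equation there with reaction term `-(-Δ)^s g`. -/
theorem weakSol (hg : IsSeparatedDatum Ω K d C g) (hs : 0 < s) (hs' : s < 1) (hΩ : MeasurableSet Ω)
    (hΩv : volume Ω ≠ ⊤) : WeakSol s T Ω g (exteriorSource s K g) := by
  have hfin : IsFiniteMeasure (volume.restrict Ω) := ⟨by simpa using hΩv.lt_top⟩
  have hzero : ∀ t, (fun x => g x t) =ᵐ[volume.restrict Ω] fun _ => 0 := by
    intro t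
    filter_upwards [ae_restrict_mem hΩ] with x hx
    exact hg.eq_zero_of_mem hx t
  have hint : ∀ (v : EuclideanSpace ℝ (Fin n) → ℝ) t, ∫ x in Ω, g x t * v x = 0 := by
    intro v t
    refine integral_eq_zero_of_ae ?_
    filter_upwards [hzero t] with x hx
    rw [hx, zero_mul]
    rfl
  refine ⟨(hg.continuous.comp continuous_swap).aestronglyMeasurable, hg.memLp_diffQuot hs hΩ hΩv,
    fun t _ => MemLp.zero'.ae_eq (hzero t).symm, fun t₀ _ => ?_, ?_, fun v hv t _ => ?_⟩
  · have h1 : ∀ t, eLpNorm (fun x => g x t - g x t₀) 2 (volume.restrict Ω) = 0 := by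
      intro t
      rw [← eLpNorm_zero' (ε := ℝ) (p := 2) (μ := volume.restrict Ω)]
      refine eLpNorm_congr_ae ?_
      filter_upwards [hzero t, hzero t₀] with x h1 h2
      rw [h1, h2, sub_zero]
    simp only [h1]
    exact tendsto_const_nhds
  · refine MemLp.of_bound (hg.measurable_exteriorSource.comp measurable_swap).aestronglyMeasurable
      (fracConst n s * (C / d ^ ((n : ℝ) + 2 * s) * volume.real K)) ?_
    filter_upwards [ae_mem_cylinder hΩ] with p hp
    exact hg.abs_exteriorSource_le hs hs' hp.2 _
  · rw [hint, hint]
    simp only [hg.fracForm_eq hs hΩ hΩv hv, neg_add_cancel,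
      intervalIntegral.integral_zero, add_zero]

end IsSeparatedDatum

end

/-! ### The truncated reaction term -/

theorem abs_abs_rpow_mul_sub_le {b R : ℝ} (hb : 0 < b) {y z : ℝ} (hy : |y| ≤ R) (hz : |z| ≤ R) :
    |(|y| ^ b * y - |z| ^ b * z)| ≤ (b + 1) * R ^ b * |y - z| := by
  have hR : 0 ≤ R := (abs_nonneg y).trans hy
  have key : ∀ x ∈ Icc 0 R, ∀ y ∈ Icc 0 R,
      |x ^ b * x - y ^ b * y| ≤ (b + 1) * R ^ b * |x - y| := by
    intro x hx y hy
    have h := (convex_Icc (0 : ℝ) R).norm_image_sub_le_of_norm_hasDerivWithin_le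
      (f := fun z : ℝ => z ^ (b + 1)) (f' := fun z => (b + 1) * z ^ (b + 1 - 1))
      (C := (b + 1) * R ^ b)
      (fun z _ => (Real.hasDerivAt_rpow_const (Or.inr (by linarith))).hasDerivWithinAt)
      (fun z hz => by
        have hz0 := hz.1
        rw [Real.norm_of_nonneg (by positivity), add_sub_cancel_right]
        exact mul_le_mul_of_nonneg_left (Real.rpow_le_rpow hz.1 hz.2 hb.le) (by linarith)) hy hx
    simpa only [Real.norm_eq_abs, Real.rpow_add_one' hx.1 (by linarith : b + 1 ≠ 0),
      Real.rpow_add_one' hy.1 (by linarith : b + 1 ≠ 0)] using h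
  have h0 : (0 : ℝ) ∈ Icc 0 R := ⟨le_rfl, hR⟩
  have hzero : ∀ x ∈ Icc 0 R, x ^ b * x ≤ (b + 1) * R ^ b * x := by
    intro x hx
    have := key x hx 0 h0
    rw [mul_zero, sub_zero, sub_zero, abs_of_nonneg hx.1,
      abs_of_nonneg (mul_nonneg (Real.rpow_nonneg hx.1 b) hx.1)] at this
    exact this
  rcases le_total 0 y with hy0 | hy0 <;> rcases le_total 0 z with hz0 | hz0
  · rw [abs_of_nonneg hy0] at hy ⊢
    rw [abs_of_nonneg hz0] at hz ⊢
    exact key y ⟨hy0, hy⟩ z ⟨hz0, hz⟩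
  · rw [abs_of_nonneg hy0] at hy ⊢
    rw [abs_of_nonpos hz0] at hz ⊢
    have h1 := hzero y ⟨hy0, hy⟩
    have h2 := hzero (-z) ⟨by linarith, hz⟩
    have h3 : 0 ≤ y ^ b * y := by positivity
    have h4 : 0 ≤ (-z) ^ b * (-z) := mul_nonneg (Real.rpow_nonneg (by linarith) b) (by linarith)
    rw [abs_of_nonneg (by linarith), abs_of_nonneg (by linarith)]
    linarith
  · rw [abs_of_nonpos hy0] at hy ⊢
    rw [abs_of_nonneg hz0] at hz ⊢
    have h1 := hzero z ⟨hz0, hz⟩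
    have h2 := hzero (-y) ⟨by linarith, hy⟩
    have h3 : 0 ≤ z ^ b * z := by positivity
    have h4 : 0 ≤ (-y) ^ b * (-y) := mul_nonneg (Real.rpow_nonneg (by linarith) b) (by linarith)
    rw [abs_of_nonpos (by linarith), abs_of_nonpos (by linarith)]
    linarith
  · rw [abs_of_nonpos hy0] at hy ⊢
    rw [abs_of_nonpos hz0] at hz ⊢
    have h1 := key (-y) ⟨by linarith, hy⟩ (-z) ⟨by linarith, hz⟩
    rw [abs_sub_comm] at h1
    have e1 : (-y) ^ b * y - (-z) ^ b * z = (-z) ^ b * (-z) - (-y) ^ b * (-y) := by ring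
    have e2 : |-y - -z| = |y - z| := by rw [neg_sub_neg, abs_sub_comm]
    rw [e1, ← e2]
    exact h1

/-- Truncation of a real number to `[-R, R]`. -/
def clip (R z : ℝ) : ℝ := max (-R) (min z R)

theorem clip_mem {R : ℝ} (hR : 0 ≤ R) (z : ℝ) : clip R z ∈ Icc (-R) R :=
  ⟨le_max_left _ _, max_le (by linarith) (min_le_right _ _)⟩

theorem clip_eq_self {R z : ℝ} (hz : |z| ≤ R) : clip R z = z := by
  rw [clip, min_eq_left (abs_le.1 hz).2, max_eq_right (abs_le.1 hz).1]

theorem clip_nonneg {R z : ℝ} (hR : 0 ≤ R) (hz : 0 ≤ z) : 0 ≤ clip R z :=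
  le_max_of_le_right (le_min hz hR)

theorem clip_nonpos {R z : ℝ} (hR : 0 ≤ R) (hz : z ≤ 0) : clip R z ≤ 0 :=
  max_le (by linarith) ((min_le_left _ _).trans hz)

theorem abs_clip_sub_clip_le (R y z : ℝ) : |clip R y - clip R z| ≤ |y - z| := by
  rw [clip, clip, max_comm, max_comm (-R)]
  exact (abs_max_sub_max_le_abs _ _ _).trans (abs_inf_sub_inf_le_abs y z R)

theorem continuous_clip (R : ℝ) : Continuous (clip R) :=
  continuous_const.max (continuous_id.min continuous_const)

section

variable {n m : ℕ} {s T R : ℝ} {Ω : Set (EuclideanSpace ℝ (Fin n))}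
  {a : Fin m → EuclideanSpace ℝ (Fin n) → ℝ → ℝ} {b : Fin m → ℝ}
  {F : EuclideanSpace ℝ (Fin n) → ℝ → ℝ}

/-- The reaction term `a(x, t, z) - F(x, t)` in the cylinder `Ω × [0, T]`, made bounded and
globally Lipschitz by truncating `z` to `[-R, R]`. -/
noncomputable def truncatedReaction (T R : ℝ) (Ω : Set (EuclideanSpace ℝ (Fin n)))
    (a : Fin m → EuclideanSpace ℝ (Fin n) → ℝ → ℝ) (b : Fin m → ℝ)
    (F : EuclideanSpace ℝ (Fin n) → ℝ → ℝ) (x : EuclideanSpace ℝ (Fin n)) (t z : ℝ) : ℝ :=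
  (Ω ×ˢ Icc 0 T).indicator (fun q => nonlinearity a b q.1 q.2 (clip R z) - F q.1 q.2) (x, t)

theorem truncatedReaction_of_mem {x : EuclideanSpace ℝ (Fin n)} {t : ℝ} (hx : x ∈ Ω)
    (ht : t ∈ Icc 0 T) (z : ℝ) :
    truncatedReaction T R Ω a b F x t z = nonlinearity a b x t (clip R z) - F x t :=
  indicator_of_mem (show (x, t) ∈ Ω ×ˢ Icc 0 T from ⟨hx, ht⟩) _

theorem truncatedReaction_of_notMem {x : EuclideanSpace ℝ (Fin n)} {t : ℝ}
    (h : ¬(x ∈ Ω ∧ t ∈ Icc 0 T)) (z : ℝ) : truncatedReaction T R Ω a b F x t z = 0 :=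
  indicator_of_notMem (show (x, t) ∉ Ω ×ˢ Icc 0 T from h) _

theorem continuousOn_nonlinearity
    (ha : ∀ k, ContinuousOn (fun q : EuclideanSpace ℝ (Fin n) × ℝ => a k q.1 q.2)
      (closure Ω ×ˢ Icc 0 T)) (hb : ∀ k, 0 < b k) :
    ContinuousOn (fun q : EuclideanSpace ℝ (Fin n) × ℝ × ℝ => nonlinearity a b q.1 q.2.1 q.2.2)
      (closure Ω ×ˢ Icc 0 T ×ˢ univ) := by
  refine continuousOn_finsetSum _ fun k _ => ContinuousOn.mul ?_ ?_
  · exact (ha k).comp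
      (by fun_prop : Continuous fun q : EuclideanSpace ℝ (Fin n) × ℝ × ℝ =>
        (q.1, q.2.1)).continuousOn
      fun q hq => ⟨hq.1, hq.2.1⟩
  · have h1 : Continuous fun q : EuclideanSpace ℝ (Fin n) × ℝ × ℝ => |q.2.2| ^ b k :=
      (continuous_snd.snd.abs).rpow_const fun _ => Or.inr (hb k).le
    exact (h1.mul continuous_snd.snd).continuousOn

theorem measurable_truncatedReaction (hΩ : MeasurableSet Ω)
    (ha : ∀ k, ContinuousOn (fun q : EuclideanSpace ℝ (Fin n) × ℝ => a k q.1 q.2)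
      (closure Ω ×ˢ Icc 0 T)) (hb : ∀ k, 0 < b k)
    (hF : Measurable fun q : EuclideanSpace ℝ (Fin n) × ℝ => F q.1 q.2) :
    Measurable fun p : EuclideanSpace ℝ (Fin n) × ℝ × ℝ =>
      truncatedReaction T R Ω a b F p.1 p.2.1 p.2.2 := by
  classical
  set S : Set (EuclideanSpace ℝ (Fin n) × ℝ × ℝ) := Ω ×ˢ Icc 0 T ×ˢ univ with hS
  have hSm : MeasurableSet S := hΩ.prod (measurableSet_Icc.prod MeasurableSet.univ)
  have hcont : ContinuousOn (fun p : EuclideanSpace ℝ (Fin n) × ℝ × ℝ =>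
      nonlinearity a b p.1 p.2.1 (clip R p.2.2)) S := by
    have h1 : Continuous fun p : EuclideanSpace ℝ (Fin n) × ℝ × ℝ => (p.1, p.2.1, clip R p.2.2) :=
      continuous_fst.prodMk (continuous_snd.fst.prodMk
        ((continuous_clip R).comp continuous_snd.snd))
    exact (continuousOn_nonlinearity ha hb).comp h1.continuousOn
      fun p hp => ⟨subset_closure hp.1, hp.2.1, mem_univ _⟩
  have h1 := hcont.measurable_piecewise (continuousOn_const (c := (0 : ℝ))) hSm
  have h2 : Measurable (S.indicator fun p : EuclideanSpace ℝ (Fin n) × ℝ × ℝ => F p.1 p.2.1) :=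
    (hF.comp (measurable_fst.prodMk measurable_snd.fst)).indicator hSm
  convert h1.sub h2 using 1
  ext p
  by_cases hp : p.1 ∈ Ω ∧ p.2.1 ∈ Icc 0 T
  · have hpS : p ∈ S := ⟨hp.1, hp.2, mem_univ _⟩
    rw [truncatedReaction_of_mem hp.1 hp.2, Pi.sub_apply, piecewise_eq_of_mem _ _ _ hpS,
      indicator_of_mem hpS]
  · have hpS : p ∉ S := fun h => hp ⟨h.1, h.2.1⟩
    rw [truncatedReaction_of_notMem hp, Pi.sub_apply, piecewise_eq_of_notMem _ _ _ hpS,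
      indicator_of_notMem hpS, sub_zero]

theorem exists_abs_truncatedReaction_le (hΩ : Bornology.IsBounded Ω) (hR : 0 ≤ R)
    (ha : ∀ k, ContinuousOn (fun q : EuclideanSpace ℝ (Fin n) × ℝ => a k q.1 q.2)
      (closure Ω ×ˢ Icc 0 T)) (hb : ∀ k, 0 < b k) {A : ℝ} (hA : 0 ≤ A)
    (hF : ∀ x ∈ Ω, ∀ t, |F x t| ≤ A) :
    ∃ M, ∀ x t z, |truncatedReaction T R Ω a b F x t z| ≤ M := by
  obtain ⟨B, hB⟩ := (hΩ.isCompact_closure.prod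
    ((isCompact_Icc (a := (0 : ℝ)) (b := T)).prod
      (isCompact_Icc (a := -R) (b := R)))).exists_bound_of_continuousOn
      ((continuousOn_nonlinearity ha hb).mono
        (prod_mono_right (prod_mono_right (subset_univ _))))
  refine ⟨|B| + A, fun x t z => ?_⟩
  by_cases h : x ∈ Ω ∧ t ∈ Icc 0 T
  · rw [truncatedReaction_of_mem h.1 h.2]
    exact (abs_sub _ _).trans (add_le_add ((hB (x, t, clip R z)
      ⟨subset_closure h.1, h.2, clip_mem hR z⟩).trans (le_abs_self B)) (hF x h.1 t))
  · rw [truncatedReaction_of_notMem h, abs_zero]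
    positivity

theorem exists_lipschitz_truncatedReaction (hΩ : Bornology.IsBounded Ω) (hR : 0 ≤ R)
    (ha : ∀ k, ContinuousOn (fun q : EuclideanSpace ℝ (Fin n) × ℝ => a k q.1 q.2)
      (closure Ω ×ˢ Icc 0 T)) (hb : ∀ k, 0 < b k) :
    ∃ L, 0 ≤ L ∧ ∀ x t y z, |truncatedReaction T R Ω a b F x t y -
      truncatedReaction T R Ω a b F x t z| ≤ L * |y - z| := by
  choose B hB using fun k => (hΩ.isCompact_closure.prod
    (isCompact_Icc (a := (0 : ℝ)) (b := T))).exists_bound_of_continuousOn (ha k)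
  have hb' : ∀ k, 0 ≤ b k + 1 := fun k => by linarith [hb k]
  have hL0 : 0 ≤ ∑ k, |B k| * ((b k + 1) * R ^ b k) := Finset.sum_nonneg fun k _ =>
    mul_nonneg (abs_nonneg _) (mul_nonneg (hb' k) (Real.rpow_nonneg hR _))
  refine ⟨_, hL0, fun x t y z => ?_⟩
  by_cases h : x ∈ Ω ∧ t ∈ Icc 0 T
  · rw [truncatedReaction_of_mem h.1 h.2, truncatedReaction_of_mem h.1 h.2,
      sub_sub_sub_cancel_right,
      nonlinearity, nonlinearity, ← Finset.sum_sub_distrib, Finset.sum_mul]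
    refine (Finset.abs_sum_le_sum_abs _ _).trans (Finset.sum_le_sum fun k _ => ?_)
    rw [← mul_sub, abs_mul, mul_assoc |B k|]
    refine mul_le_mul ((hB k (x, t) ⟨subset_closure h.1, h.2⟩).trans (le_abs_self _)) ?_
      (abs_nonneg _) (abs_nonneg _)
    exact (abs_abs_rpow_mul_sub_le (hb k) (abs_le.2 (clip_mem hR y))
      (abs_le.2 (clip_mem hR z))).trans
      (mul_le_mul_of_nonneg_left (abs_clip_sub_clip_le R y z)
        (mul_nonneg (hb' k) (Real.rpow_nonneg hR _)))
  · rw [truncatedReaction_of_notMem h, truncatedReaction_of_notMem h, sub_zero, abs_zero]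
    exact mul_nonneg hL0 (abs_nonneg _)

theorem truncatedReaction_modulus (hΩ : Bornology.IsBounded Ω) (hR : 0 ≤ R)
    (ha : ∀ k, ContinuousOn (fun q : EuclideanSpace ℝ (Fin n) × ℝ => a k q.1 q.2)
      (closure Ω ×ˢ Icc 0 T)) (hb : ∀ k, 0 < b k)
    (hF : ∀ ε > 0, ∃ δ > 0, ∀ x ∈ Ω, ∀ t t', |t - t'| < δ → |F x t - F x t'| ≤ ε)
    {ε : ℝ} (hε : 0 < ε) :
    ∃ δ > 0, ∀ x, ∀ t ∈ Icc 0 T, ∀ t' ∈ Icc 0 T, |t - t'| < δ → ∀ z,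
      |truncatedReaction T R Ω a b F x t z - truncatedReaction T R Ω a b F x t' z| ≤ ε := by
  have huc := (hΩ.isCompact_closure.prod
    ((isCompact_Icc (a := (0 : ℝ)) (b := T)).prod
      (isCompact_Icc (a := -R) (b := R)))).uniformContinuousOn_of_continuous
      ((continuousOn_nonlinearity ha hb).mono
        (prod_mono_right (prod_mono_right (subset_univ _))))
  obtain ⟨δ₁, hδ₁, h₁⟩ := Metric.uniformContinuousOn_iff.1 huc (ε / 2) (half_pos hε)
  obtain ⟨δ₂, hδ₂, h₂⟩ := hF (ε / 2) (half_pos hε)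
  refine ⟨min δ₁ δ₂, lt_min hδ₁ hδ₂, fun x t ht t' ht' htt z => ?_⟩
  by_cases hx : x ∈ Ω
  · rw [truncatedReaction_of_mem hx ht, truncatedReaction_of_mem hx ht']
    have e1 := h₁ (x, t, clip R z) ⟨subset_closure hx, ht, clip_mem hR z⟩ (x, t', clip R z)
      ⟨subset_closure hx, ht', clip_mem hR z⟩ (by
        rw [Prod.dist_eq, Prod.dist_eq, dist_self, dist_self, max_eq_left dist_nonneg,
          max_eq_right dist_nonneg]
        exact htt.trans_le (min_le_left _ _))
    have e2 := h₂ x hx t t' (htt.trans_le (min_le_right _ _))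
    rw [Real.dist_eq] at e1
    simp only at e1
    have e3 : nonlinearity a b x t (clip R z) - F x t -
        (nonlinearity a b x t' (clip R z) - F x t') =
      (nonlinearity a b x t (clip R z) - nonlinearity a b x t' (clip R z)) - (F x t - F x t') := by
      ring
    rw [e3]
    refine (abs_sub _ _).trans ?_
    linarith
  · rw [truncatedReaction_of_notMem fun h => hx h.1, truncatedReaction_of_notMem fun h => hx h.1,
      sub_zero, abs_zero]
    exact hε.le

end

/-! ### Existence for exterior data supported away from the domain -/

section

variable {n m : ℕ} {s T : ℝ} {Ω : Set (EuclideanSpace ℝ (Fin n))}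
  {a : Fin m → EuclideanSpace ℝ (Fin n) → ℝ → ℝ} {b : Fin m → ℝ}
  {g : EuclideanSpace ℝ (Fin n) → ℝ → ℝ}

theorem WeakSol.isSolution {u : EuclideanSpace ℝ (Fin n) → ℝ → ℝ}
    (hu : WeakSol s T Ω u fun x t => nonlinearity a b x t (u x t))
    (hext : ∀ᵐ q ∂((volume : Measure (EuclideanSpace ℝ (Fin n) × ℝ)).restrict
      (exterior Ω ×ˢ Ioo 0 T)), u q.1 q.2 = g q.1 q.2) (hinit : ∀ᵐ x, u x 0 = 0) :
    IsSolution s T Ω a b (fun _ _ => 0) g u where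
  measurable := by
    rw [Measure.volume_eq_prod, ← Measure.prod_restrict, Measure.restrict_univ]
    exact hu.meas.prod_swap
  finite_energy := by
    rw [IntegrableOn, Measure.volume_eq_prod, ← Measure.prod_restrict]
    have h := hu.energy.integrable_sq
    simp only [diffQuot_sq, nearPairs] at h
    exact h
  memLp := hu.memLp
  continuous := hu.continuous
  nonlinear_memLp := by
    rw [Measure.volume_eq_prod, ← Measure.prod_restrict]
    exact hu.source.comp_measurePreserving Measure.measurePreserving_swap
  exterior_eq := hext
  initial_eq := hinit
  equation v hv t ht := by
    have h0 : ∫ x in Ω, u x 0 * v x = 0 := by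
      refine integral_eq_zero_of_ae ?_
      filter_upwards [ae_restrict_of_ae hinit] with x hx
      simp [hx]
    rw [hu.equation v hv t ht, h0]
    simp

/-- The solution is `w + g`, where `w` vanishes outside `Ω` and solves the equation with source
`-(-Δ)^s g`, which is bounded in `Ω`. The equation for `w` is solved with a truncated reaction term;
by the maximum principle `w` stays below the level of truncation. -/
theorem exists_isSolution (hs : 0 < s) (hs' : s < 1) (hT : 0 < T) (hΩ : IsSmoothBoundedDomain Ω)
    (hac : ∀ k, ContinuousOn (fun q : EuclideanSpace ℝ (Fin n) × ℝ => a k q.1 q.2)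
      (closure Ω ×ˢ Icc 0 T))
    (ha : ∀ k, ∀ x ∈ closure Ω, ∀ t ∈ Icc 0 T, 0 ≤ a k x t) (hb : ∀ k, 0 < b k)
    (hg : Continuous fun q : EuclideanSpace ℝ (Fin n) × ℝ => g q.1 q.2)
    (hgc : HasCompactSupport fun q : EuclideanSpace ℝ (Fin n) × ℝ => g q.1 q.2)
    (hgs : tsupport (fun q : EuclideanSpace ℝ (Fin n) × ℝ => g q.1 q.2) ⊆
      exterior Ω ×ˢ Ioo 0 T) :
    ∃ u, IsSolution s T Ω a b (fun _ _ => 0) g u := by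
  obtain ⟨K, d, C, hgd⟩ := exists_isSeparatedDatum hg hgc hgs
  have hΩm := hΩ.isOpen.measurableSet
  have hΩv := hΩ.volume_ne_top
  obtain ⟨A, hA0, hA⟩ : ∃ A, 0 ≤ A ∧ ∀ x ∈ Ω, ∀ t, |exteriorSource s K g x t| ≤ A := by
    refine ⟨_, ?_, fun x hx t => hgd.abs_exteriorSource_le hs hs' hx t⟩
    have h1 := Real.rpow_pos_of_pos hgd.pos ((n : ℝ) + 2 * s)
    have h2 := hgd.bound_nonneg
    have h3 := fracConst_pos (n := n) hs hs'
    positivity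
  have hR : 0 ≤ A * T := by positivity
  obtain ⟨M, hM⟩ := exists_abs_truncatedReaction_le hΩ.isBounded hR hac hb hA0 hA
  obtain ⟨L, hL0, hL⟩ := exists_lipschitz_truncatedReaction (F := exteriorSource s K g)
    hΩ.isBounded hR hac hb
  obtain ⟨w, hw, hwoff, hw0⟩ := exists_weakSol_of_bounded_lipschitz hs hs' hT.le hΩm hΩv hL0
    (measurable_truncatedReaction hΩm hac hb hgd.measurable_exteriorSource) hM
    (fun x hx t z => truncatedReaction_of_notMem (fun h => hx h.1) z) hL
    fun ε hε => truncatedReaction_modulus hΩ.isBounded hR hac hb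
      (fun ε hε => hgd.exteriorSource_modulus hs hs' hε) hε
  have hmax := hw.ae_abs_le hs hs' hT.le hΩm hΩv hA0 le_rfl
    (Eventually.of_forall fun p hp => by rw [hwoff _ hp, abs_zero]) (ae_restrict_of_ae hw0) (by
      filter_upwards [ae_mem_cylinder hΩm] with p hp
      have ht : p.1 ∈ Icc 0 T := ⟨hp.1.1.le, hp.1.2.le⟩
      have hmono : Monotone (nonlinearity a b p.2 p.1) := nonlinearity_mono
        (fun k => ha k _ (subset_closure hp.2) _ ht) hb
      have h0 := nonlinearity_zero (a := a) (b := b) p.2 p.1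
      have h1 := abs_le.1 (hA p.2 hp.2 p.1)
      rw [truncatedReaction_of_mem hp.2 ht]
      refine ⟨fun hpos => ?_, fun hneg => ?_⟩
      · linarith [hmono (clip_nonneg hR hpos.le), h1.2]
      · linarith [hmono (clip_nonpos hR hneg.le), h1.1])
  have hmaxΩ := ae_mono (Measure.prod_mono (le_refl (volume.restrict (Ioo 0 T)))
    (Measure.restrict_le_self (μ := (volume : Measure (EuclideanSpace ℝ (Fin n)))) (s := Ω))) hmax
  refine ⟨_, ((hw.linComb (hgd.weakSol hs hs' hΩm hΩv) hΩm hT.le 1 1).congr_source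
    ?_).isSolution ?_ ?_⟩
  · filter_upwards [hmaxΩ, ae_mem_cylinder hΩm] with p h1 hp
    have ht : p.1 ∈ Icc 0 T := ⟨hp.1.1.le, hp.1.2.le⟩
    rw [zero_add] at h1
    simp only [truncatedReaction_of_mem hp.2 ht, clip_eq_self h1, hgd.eq_zero_of_mem hp.2, one_mul,
      add_zero, sub_add_cancel]
  · filter_upwards [ae_restrict_mem
      (isClosed_closure.isOpen_compl.measurableSet.prod measurableSet_Ioo)] with q hq
    rw [hwoff _ fun h => hq.1 (subset_closure h)]
    ring
  · filter_upwards [hw0] with x hx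
    have h1 : g x 0 = 0 := by
      by_contra h
      exact lt_irrefl 0 (hgs (subset_tsupport _
        (show (x, (0 : ℝ)) ∈ Function.support _ from h))).2.1
    rw [hx, h1]
    ring

end

end FracPara

theorem proposition3p3 {n : ℕ} (hn : 2 ≤ n) {s T : ℝ} (hs : 0 < s) (hs' : s < 1) (hT : 0 < T)
    {Ω : Set (EuclideanSpace ℝ (Fin n))} (hΩ : FracPara.IsSmoothBoundedDomain Ω)
    {m : ℕ} (a : Fin m → EuclideanSpace ℝ (Fin n) → ℝ → ℝ) (b : Fin m → ℝ)
    (ha_cont : ∀ k, ContinuousOn (fun q : EuclideanSpace ℝ (Fin n) × ℝ => a k q.1 q.2)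
      (closure Ω ×ˢ Icc 0 T))
    (ha_nonneg : ∀ k, ∀ x ∈ closure Ω, ∀ t ∈ Icc 0 T, 0 ≤ a k x t)
    (hb_pos : ∀ k, 0 < b k) (hb_mono : StrictMono b) :
    -- the sup-norm estimate
    (∀ f g u : EuclideanSpace ℝ (Fin n) → ℝ → ℝ,
      MemLp (fun q : EuclideanSpace ℝ (Fin n) × ℝ => f q.1 q.2) 2
        (volume.restrict (Ω ×ˢ Ioo 0 T)) →
      FracPara.IsSolution s T Ω a b f g u →
      eLpNorm (fun q : EuclideanSpace ℝ (Fin n) × ℝ => u q.1 q.2) ⊤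
          (volume.restrict (univ ×ˢ Ioo 0 T)) ≤
        ENNReal.ofReal T * eLpNorm (fun q : EuclideanSpace ℝ (Fin n) × ℝ => f q.1 q.2) ⊤
            (volume.restrict (Ω ×ˢ Ioo 0 T)) +
          eLpNorm (fun q : EuclideanSpace ℝ (Fin n) × ℝ => g q.1 q.2) ⊤
            (volume.restrict (FracPara.exterior Ω ×ˢ Ioo 0 T))) ∧
    -- uniqueness of solutions
    (∀ f g u₁ u₂ : EuclideanSpace ℝ (Fin n) → ℝ → ℝ,
      MemLp (fun q : EuclideanSpace ℝ (Fin n) × ℝ => f q.1 q.2) 2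
        (volume.restrict (Ω ×ˢ Ioo 0 T)) →
      FracPara.IsSolution s T Ω a b f g u₁ →
      FracPara.IsSolution s T Ω a b f g u₂ →
      ∀ᵐ q ∂((volume : Measure (EuclideanSpace ℝ (Fin n) × ℝ)).restrict (univ ×ˢ Ioo 0 T)),
        u₁ q.1 q.2 = u₂ q.1 q.2) ∧
    -- well-posedness of the problem with `f = 0`, for regular and small exterior data
    (∃ ε : ℝ, 0 < ε ∧ ∀ g : EuclideanSpace ℝ (Fin n) → ℝ → ℝ,
      ContDiff ℝ ((⊤ : ℕ∞) : WithTop ℕ∞)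
        (fun q : EuclideanSpace ℝ (Fin n) × ℝ => g q.1 q.2) →
      HasCompactSupport (fun q : EuclideanSpace ℝ (Fin n) × ℝ => g q.1 q.2) →
      tsupport (fun q : EuclideanSpace ℝ (Fin n) × ℝ => g q.1 q.2) ⊆
        FracPara.exterior Ω ×ˢ Ioo 0 T →
      (∀ j ≤ 2, ∀ x, ∀ t, ‖iteratedFDeriv ℝ j (fun y => g y t) x‖ ≤ ε) →
      ∃ u : EuclideanSpace ℝ (Fin n) → ℝ → ℝ,
        FracPara.IsSolution s T Ω a b (fun _ _ => 0) g u ∧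
        ∀ u' : EuclideanSpace ℝ (Fin n) → ℝ → ℝ,
          FracPara.IsSolution s T Ω a b (fun _ _ => 0) g u' →
          ∀ᵐ q ∂((volume : Measure (EuclideanSpace ℝ (Fin n) × ℝ)).restrict (univ ×ˢ Ioo 0 T)),
            u' q.1 q.2 = u q.1 q.2) := by
  have hf0 : MemLp (fun _ : EuclideanSpace ℝ (Fin n) × ℝ => (0 : ℝ)) 2
      (volume.restrict (Ω ×ˢ Ioo 0 T)) := MemLp.zero'
  -- Existence holds for data of any size, so `ε = 1` serves.
  refine ⟨fun f g u hf hu => hu.eLpNorm_top_le hs hs' hT hΩ ha_nonneg hb_pos hf,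
    fun f g u₁ u₂ hf h₁ h₂ => h₁.ae_eq h₂ hs hs' hT hΩ ha_nonneg hb_pos hf,
    1, one_pos, fun g hg hgc hgs _ => ?_⟩
  obtain ⟨u, hu⟩ :=
    FracPara.exists_isSolution hs hs' hT hΩ ha_cont ha_nonneg hb_pos hg.continuous hgc hgs
  exact ⟨u, hu, fun u' hu' => hu'.ae_eq hu hs hs' hT hΩ ha_nonneg hb_pos hf0⟩
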